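/- Let $\Sigma^+=\{(x,y): x\ge 0,\ y\ge 0\}$, $\Sigma^-=\{x\le 0\}\cup\{x\ge 0,\ y\le 0\}$ and $\Sigma=\Sigma^+\cap\Sigma^-$, the union of the positive $x$- and $y$-half-axes. Consider the planar discontinuous piecewise differential systems given by $\dot z=F(z)$ in $\Sigma^+$ and $\dot z=G(z)$ in $\Sigma^-$, where $F$ is a linear Hamiltonian saddle $$F(x,y)=(-Ax-\delta y+B,\ \mu x+Ay+C),\qquad A,\delta,\mu,B,C\in\mathbb R,\quad A^2-\delta\mu>0,$$ and $G$ is obtained by an invertible affine change of variables from one of Loud's quadratic isochronous centers $$Q_1:\ \dot x=-y+x^2-y^2,\ \dot y=x(1+2y);\qquad Q_2:\ \dot x=-y+x^2,\ \dot y=x(1+y);$$ $$Q_3:\ \dot x=-y-\tfrac43x^2,\ \dot y=x\bigl(1-\tfrac{16}3y\bigr);\qquad Q_4:\ \dot x=-y+\tfrac{16}3x^2-\tfrac43y^2,\ \dot y=x\bigl(1+\tfrac83y\bigr).$$ A point of $\Sigma\setminus\{(0,0)\}$ is a crossing point if the components of $F$ and $G$ normal to $\Sigma$ at it have a positive product.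 A crossing periodic orbit is a periodic orbit of the piecewise system that meets $\Sigma$ in exactly two points, both of them crossing points; a crossing limit cycle is a crossing periodic orbit $\Gamma$ that has an open neighbourhood containing no other crossing periodic orbit. Then: (i) if $G$ is of type $Q_1$, the system has at most $5$ crossing limit cycles that cut $\Sigma$ in one point $(x,0)$, $x>0$, and one point $(0,y)$, $y>0$; (ii) if $G$ is of type $Q_2$, it has at most $7$ such limit cycles; (iii) if $G$ is of type $Q_3$, it has at most $9$ such limit cycles; (iv) if $G$ is of type $Q_4$, it has at most $11$ such limit cycles. Moreover, for each $i\in\{1,2,3,4\}$ there is a system with $G$ of type $Q_i$ that has exactly four crossing limit cycles, each of which cuts $\Sigma$ in one point $(x,0)$, $x>0$, and one point $(0,y)$, $y>0$. -/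

import Mathlib

open Set

namespace CornerPWS

/-- The closed first quadrant, the zone of the saddle. -/
def SigmaPlus : Set (ℝ × ℝ) := {z | 0 ≤ z.1 ∧ 0 ≤ z.2}

/-- The closure of the complement of the first quadrant, the zone of the isochronous center. -/
def SigmaMinus : Set (ℝ × ℝ) := {z | z.1 ≤ 0} ∪ {z | 0 ≤ z.1 ∧ z.2 ≤ 0}

/-- The switching curve: the two closed positive half-axes, with the corner at the origin. -/
def Sigma : Set (ℝ × ℝ) := SigmaPlus ∩ SigmaMinus

theorem mem_Sigma_iff (z : ℝ × ℝ) :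
    z ∈ Sigma ↔ (0 ≤ z.1 ∧ z.2 = 0) ∨ (z.1 = 0 ∧ 0 ≤ z.2) := by
  simp only [Sigma, SigmaPlus, SigmaMinus, mem_inter_iff, mem_union, mem_ofPred_eq]
  grind

/-- The linear Hamiltonian saddles. The family is invariant under affine changes of variables
(they preserve the trace and the determinant of the linear part) and under reversal of time. -/
def IsLinearHamiltonianSaddle (F : ℝ × ℝ → ℝ × ℝ) : Prop :=
  ∃ A δ μ B C : ℝ, 0 < A ^ 2 - δ * μ ∧
    ∀ x y : ℝ, F (x, y) = (-A * x - δ * y + B, μ * x + A * y + C)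

/-- Loud's first quadratic isochronous center. -/
noncomputable def Q1 (z : ℝ × ℝ) : ℝ × ℝ :=
  (-z.2 + z.1 ^ 2 - z.2 ^ 2, z.1 * (1 + 2 * z.2))

/-- Loud's second quadratic isochronous center. -/
noncomputable def Q2 (z : ℝ × ℝ) : ℝ × ℝ :=
  (-z.2 + z.1 ^ 2, z.1 * (1 + z.2))

/-- Loud's third quadratic isochronous center. -/
noncomputable def Q3 (z : ℝ × ℝ) : ℝ × ℝ :=
  (-z.2 - 4 / 3 * z.1 ^ 2, z.1 * (1 - 16 / 3 * z.2))

/-- Loud's fourth quadratic isochronous center. -/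
noncomputable def Q4 (z : ℝ × ℝ) : ℝ × ℝ :=
  (-z.2 + 16 / 3 * z.1 ^ 2 - 4 / 3 * z.2 ^ 2, z.1 * (1 + 8 / 3 * z.2))

/-- `G` is the vector field `Q` written in other affine coordinates: for an invertible affine map
`e` of the plane, `z` solves `z' = G z` exactly when `e z` solves `w' = Q w`. -/
def IsAffineCopy (Q G : ℝ × ℝ → ℝ × ℝ) : Prop :=
  ∃ e : (ℝ × ℝ) ≃ᵃ[ℝ] (ℝ × ℝ), ∀ z : ℝ × ℝ, e.linear (G z) = Q (e z)

/-- Crossing points: points of the switching curve other than the corner at which the components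
of the two fields normal to the curve are nonzero and have the same sign. -/
def IsCrossingPoint (F G : ℝ × ℝ → ℝ × ℝ) (p : ℝ × ℝ) : Prop :=
  (0 < p.1 ∧ p.2 = 0 ∧ 0 < (F p).2 * (G p).2) ∨
  (p.1 = 0 ∧ 0 < p.2 ∧ 0 < (F p).1 * (G p).1)

/-- `a` is (the image of) a piece of orbit of `F` that runs from `p` to `q` and lies, its two end
points excepted, in the zone `R` and off the switching curve. -/
def IsOrbitArc (F : ℝ × ℝ → ℝ × ℝ) (R : Set (ℝ × ℝ)) (p q : ℝ × ℝ) (a : Set (ℝ × ℝ)) : Prop :=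
  ∃ (T : ℝ) (γ : ℝ → ℝ × ℝ), 0 < T ∧
    (∀ t ∈ Icc 0 T, HasDerivWithinAt γ (F (γ t)) (Icc 0 T) t) ∧
    γ 0 = p ∧ γ T = q ∧ (∀ t ∈ Ioo 0 T, γ t ∈ R \ Sigma) ∧ a = γ '' Icc 0 T

/-- Crossing periodic orbits of the piecewise system with field `F` on `SigmaPlus` and `G` on
`SigmaMinus`: closed orbits that meet the switching curve in exactly two points, both of them
crossing points. -/
def IsCrossingPeriodicOrbit (F G : ℝ × ℝ → ℝ × ℝ) (Γ : Set (ℝ × ℝ)) : Prop :=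
  ∃ (p q : ℝ × ℝ) (a b : Set (ℝ × ℝ)), p ≠ q ∧
    IsCrossingPoint F G p ∧ IsCrossingPoint F G q ∧
    IsOrbitArc F SigmaPlus p q a ∧ IsOrbitArc G SigmaMinus q p b ∧ Γ = a ∪ b

/-- Crossing limit cycles: crossing periodic orbits that are isolated among all of them. -/
def IsCrossingLimitCycle (F G : ℝ × ℝ → ℝ × ℝ) (Γ : Set (ℝ × ℝ)) : Prop :=
  IsCrossingPeriodicOrbit F G Γ ∧
    ∃ U : Set (ℝ × ℝ), IsOpen U ∧ Γ ⊆ U ∧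
      ∀ Γ' : Set (ℝ × ℝ), IsCrossingPeriodicOrbit F G Γ' → Γ' ⊆ U → Γ' = Γ

/-- The set of all crossing limit cycles. -/
def limitCycles (F G : ℝ × ℝ → ℝ × ℝ) : Set (Set (ℝ × ℝ)) :=
  {Γ | IsCrossingLimitCycle F G Γ}

/-- The crossing limit cycles that cut the switching curve once on each open half-axis. -/
def cornerLimitCycles (F G : ℝ × ℝ → ℝ × ℝ) : Set (Set (ℝ × ℝ)) :=
  {Γ | IsCrossingLimitCycle F G Γ ∧
    (∃ x : ℝ, 0 < x ∧ (x, 0) ∈ Γ) ∧ ∃ y : ℝ, 0 < y ∧ (0, y) ∈ Γ}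

end CornerPWS

open CornerPWS

/-! Upper bounds. The saddle has the quadratic Hamiltonian `ham`, and each center has a rational
first integral `N / l ^ k` with `N` of degree at most `m` on lines and `l` affine. A corner cycle
through `(x, 0)` and `(0, y)` therefore solves two equations: a conic through the origin, from
`ham`, and `n₁(x) d₂(y) = n₂(y) d₁(x)`, from the center. Projecting the conic from the origin, `t =
y / x`, writes `x` and `y` as quotients of polynomials of degree at most two in `t`, and the second
equation becomes a polynomial equation in `t` of degree at most `2 (m + k)`. The origin satisfies
both equations and uses up one root, so `2 (m + k) - 1` isolated solutions remain
(`encard_isolatedMeets_le`). The pairs `(m, k) = (2, 1), (2, 2), (4, 1), (2, 4)` give 5, 7, 9, 11.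

Only isolated solutions are counted, so a limit cycle must be shown to give one. At crossing points
the arcs are transversal to the half-axes and persist under perturbation
(`IsSol.eventually_exists_arc`). Where the first integrals are injective along the half-axes near
the crossing points, a nearby solution of the equations comes from a nearby cycle
(`IsCycle.eventually_eq`). For `Q3` this injectivity can fail on one singular level; there a square
root `J` of the integral (up to an affine function) replaces it, and the extra solutions, where `J`
takes opposite values at the two points, are excluded by a sign argument
(`RatIntegral.Signed.isolated`).

Examples. For the saddles `saddle α β` every crossing cycle goes through the first quadrant from
`(x, 0)` to `(0, α x ^ 2 + β x)`, so cycles correspond to zeros of one polynomial in `x`. Its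
parameters make it alternate in sign at five points, while a weak form of Descartes' rule allows at
most four relevant roots. Explicit linearizations turn the centers into a rotation and provide the
orbits that join the required points; since the first integral is injective on each half-axis where
`l > 0`, these orbits do not meet the switching curve in between
(`RatIntegral.exists_four_limitCycles`). -/

open Filter Topology Metric

namespace CornerPWS

/-! ### Existence, uniqueness and continuous dependence of solutions -/

/-- `γ` solves `z' = V z` on the time interval `[0, T]`. -/
def IsSol (V : ℝ × ℝ → ℝ × ℝ) (T : ℝ) (γ : ℝ → ℝ × ℝ) : Prop :=
  ∀ t ∈ Icc 0 T, HasDerivWithinAt γ (V (γ t)) (Icc 0 T) t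

theorem IsSol.continuousOn {V : ℝ × ℝ → ℝ × ℝ} {T : ℝ} {γ : ℝ → ℝ × ℝ} (h : IsSol V T γ) :
    ContinuousOn γ (Icc 0 T) :=
  fun t ht => (h t ht).continuousWithinAt

theorem IsSol.mono {V : ℝ × ℝ → ℝ × ℝ} {T T' : ℝ} {γ : ℝ → ℝ × ℝ} (h : IsSol V T γ)
    (hT : T' ≤ T) : IsSol V T' γ :=
  fun t ht => (h t ⟨ht.1, ht.2.trans hT⟩).mono (Icc_subset_Icc_right hT)

theorem IsSol.hasDerivWithinAt_Ici {V : ℝ × ℝ → ℝ × ℝ} {T : ℝ} {γ : ℝ → ℝ × ℝ}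
    (h : IsSol V T γ) {t : ℝ} (ht : t ∈ Ico 0 T) : HasDerivWithinAt γ (V (γ t)) (Ici t) t :=
  (h t (Ico_subset_Icc_self ht)).mono_of_mem_nhdsWithin
    (mem_of_superset (Icc_mem_nhdsGE ht.2) (Icc_subset_Icc_left ht.1))

theorem IsSol.congr_field {V W : ℝ × ℝ → ℝ × ℝ} {T : ℝ} {γ : ℝ → ℝ × ℝ} (h : IsSol V T γ)
    (hVW : ∀ t ∈ Icc 0 T, V (γ t) = W (γ t)) : IsSol W T γ :=
  fun t ht => hVW t ht ▸ h t ht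

theorem IsSol.hasDerivAt {V : ℝ × ℝ → ℝ × ℝ} {T : ℝ} {γ : ℝ → ℝ × ℝ}
    (h : IsSol V T γ) {t : ℝ} (ht : t ∈ Ioo 0 T) : HasDerivAt γ (V (γ t)) t :=
  (h t (Ioo_subset_Icc_self ht)).hasDerivAt (Icc_mem_nhds ht.1 ht.2)

/-- A global bound `L` lets Picard–Lindelöf run in the ball of radius `L * T`, so the length of the
time interval is not restricted. -/
theorem exists_isSol_of_bounded {V : ℝ × ℝ → ℝ × ℝ} {K L : NNReal} (hV : LipschitzWith K V)
    (hb : ∀ z, ‖V z‖ ≤ L) {T : ℝ} (hT : 0 ≤ T) (p : ℝ × ℝ) : ∃ γ, γ 0 = p ∧ IsSol V T γ := by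
  have h : IsPicardLindelof (fun _ => V) (tmin := 0) (tmax := T) ⟨0, le_rfl, hT⟩ p
      (L * ⟨T, hT⟩) 0 L K := by
    refine IsPicardLindelof.of_time_independent (fun x _ => hb x) hV.lipschitzOnWith ?_
    simp only [sub_zero, sub_self, NNReal.coe_zero, max_eq_left hT]
    exact le_rfl
  exact h.exists_eq_forall_mem_Icc_hasDerivWithinAt₀

/-- Retraction of the plane onto the square of half-side `M`. -/
noncomputable def clamp (M : ℝ) (z : ℝ × ℝ) : ℝ × ℝ :=
  (max (-M) (min M z.1), max (-M) (min M z.2))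

theorem lipschitzWith_clamp (M : ℝ) : LipschitzWith 1 (clamp M) := by
  have := ((LipschitzWith.prod_fst (α := ℝ) (β := ℝ)).const_min M).const_max (-M)
  have h2 := ((LipschitzWith.prod_snd (α := ℝ) (β := ℝ)).const_min M).const_max (-M)
  exact max_self (1 : NNReal) ▸ this.prodMk h2

theorem clamp_mem {M : ℝ} (hM : 0 ≤ M) (z : ℝ × ℝ) : clamp M z ∈ closedBall (0 : ℝ × ℝ) M := by
  simp only [clamp, mem_closedBall, dist_zero_right, Prod.norm_def, Real.norm_eq_abs, sup_le_iff,
    abs_le]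
  refine ⟨⟨le_max_left _ _, ?_⟩, le_max_left _ _, ?_⟩ <;>
  exact ⟨by linarith, min_le_left _ _⟩

theorem clamp_eq {M : ℝ} {z : ℝ × ℝ} (hz : z ∈ closedBall (0 : ℝ × ℝ) M) : clamp M z = z := by
  simp only [mem_closedBall, dist_zero_right, Prod.norm_def, Real.norm_eq_abs, sup_le_iff,
    abs_le] at hz
  ext <;> simp [clamp, hz]

theorem exists_lipschitzOnWith_closedBall {V : ℝ × ℝ → ℝ × ℝ} (hV : ContDiff ℝ 1 V) (M : ℝ) :
    ∃ K, LipschitzOnWith K V (closedBall 0 M) :=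
  hV.contDiffOn.exists_lipschitzOnWith (by simp) (convex_closedBall _ _)
    (isCompact_closedBall _ _)

theorem IsSol.exists_mem_closedBall {V : ℝ × ℝ → ℝ × ℝ} {T : ℝ} {γ : ℝ → ℝ × ℝ}
    (h : IsSol V T γ) : ∃ M, 0 ≤ M ∧ ∀ t ∈ Icc 0 T, γ t ∈ closedBall (0 : ℝ × ℝ) M := by
  obtain ⟨M, hM⟩ :=
    (isCompact_Icc.image_of_continuousOn h.continuousOn).isBounded.subset_closedBall 0
  exact ⟨max M 0, le_max_right _ _, fun t ht =>
    closedBall_subset_closedBall (le_max_left _ _) (hM (mem_image_of_mem _ ht))⟩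

/-- A `C¹` field is Lipschitz on balls only; both solutions are first confined to a common ball by
compactness of the time interval. -/
theorem IsSol.eqOn {V : ℝ × ℝ → ℝ × ℝ} (hV : ContDiff ℝ 1 V) {T : ℝ} {γ γ' : ℝ → ℝ × ℝ}
    (h : IsSol V T γ) (h' : IsSol V T γ') (h0 : γ 0 = γ' 0) : EqOn γ γ' (Icc 0 T) := by
  obtain ⟨M, -, hM⟩ := h.exists_mem_closedBall
  obtain ⟨M', -, hM'⟩ := h'.exists_mem_closedBall
  obtain ⟨K, hK⟩ := exists_lipschitzOnWith_closedBall hV (max M M')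
  exact ODE_solution_unique_of_mem_Icc_right (v := fun _ => V)
    (s := fun _ => closedBall 0 (max M M')) (fun _ _ => hK) h.continuousOn
    (fun t ht => h.hasDerivWithinAt_Ici ht)
    (fun t ht => closedBall_subset_closedBall (le_max_left _ _) (hM t (Ico_subset_Icc_self ht)))
    h'.continuousOn (fun t ht => h'.hasDerivWithinAt_Ici ht)
    (fun t ht => closedBall_subset_closedBall (le_max_right _ _) (hM' t (Ico_subset_Icc_self ht)))
    h0

/-- An arc of given zone is determined by its initial point. -/
theorem IsOrbitArc.unique {V : ℝ × ℝ → ℝ × ℝ} (hV : ContDiff ℝ 1 V) {R : Set (ℝ × ℝ)}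
    {p q q' : ℝ × ℝ} {a a' : Set (ℝ × ℝ)} (h : IsOrbitArc V R p q a) (h' : IsOrbitArc V R p q' a')
    (hq : q ∈ Sigma) (hq' : q' ∈ Sigma) : q = q' ∧ a = a' := by
  obtain ⟨T, γ, hT, hd, h0, h1, hin, rfl⟩ := h
  obtain ⟨T', γ', hT', hd', h0', h1', hin', rfl⟩ := h'
  have key : T = T' := by
    by_contra hne
    rcases lt_or_gt_of_ne hne with hlt | hlt
    · have := IsSol.eqOn hV (T := T) hd (IsSol.mono hd' hlt.le) (h0.trans h0'.symm)
        (right_mem_Icc.2 hT.le)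
      exact (hin' T ⟨hT, hlt⟩).2 (by rwa [← this, h1])
    · have := IsSol.eqOn hV (T := T') hd' (IsSol.mono hd hlt.le) (h0'.trans h0.symm)
        (right_mem_Icc.2 hT'.le)
      exact (hin T' ⟨hT', hlt⟩).2 (by rwa [← this, h1'])
  subst key
  have := IsSol.eqOn hV (T := T) hd hd' (h0.trans h0'.symm)
  exact ⟨by rw [← h1, ← h1', this (right_mem_Icc.2 hT.le)], this.image_eq⟩

/-- Solutions that start near a given solution exist a little longer and stay close to it. -/
theorem IsSol.exists_tube {V : ℝ × ℝ → ℝ × ℝ} (hV : ContDiff ℝ 1 V) {T : ℝ} (hT : 0 < T)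
    {γ : ℝ → ℝ × ℝ} (h : IsSol V T γ) :
    ∃ η > 0, ∃ γ', IsSol V (T + η) γ' ∧ EqOn γ' γ (Icc 0 T) ∧ ∀ ε > 0, ∀ᶠ p in 𝓝 (γ 0),
      ∃ β, β 0 = p ∧ IsSol V (T + η) β ∧ ∀ t ∈ Icc 0 (T + η), dist (β t) (γ' t) < ε := by
  obtain ⟨M, hM0, hM⟩ := h.exists_mem_closedBall
  obtain ⟨K, hK⟩ := exists_lipschitzOnWith_closedBall hV (M + 2)
  -- The truncated field is bounded and globally Lipschitz, hence has solutions for all times. The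
  -- radii leave room: `γ` stays in radius `M`, its extension in `M + 1`, the perturbed solutions in
  -- `M + 2`, where `W = V`.
  set W : ℝ × ℝ → ℝ × ℝ := V ∘ clamp (M + 2) with hWdef
  have hMM : 0 ≤ M + 2 := by linarith
  have hWL : LipschitzWith K W := by
    have := hK.comp (lipschitzWith_clamp (M + 2)).lipschitzOnWith (s := univ)
      (fun z _ => clamp_mem hMM z)
    rw [← lipschitzOnWith_univ]
    simpa using this
  have hWV : ∀ z ∈ closedBall (0 : ℝ × ℝ) (M + 2), W z = V z := fun z hz => by
    simp [hWdef, clamp_eq hz]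
  obtain ⟨L, hL⟩ : ∃ L : NNReal, ∀ z, ‖W z‖ ≤ L := by
    obtain ⟨L, hL⟩ :=
      ((isCompact_closedBall (0 : ℝ × ℝ) (M + 2)).image hV.continuous).isBounded.subset_closedBall 0
    refine ⟨⟨max L 0, le_max_right _ _⟩, fun z => ?_⟩
    have := hL (mem_image_of_mem V (clamp_mem hMM z))
    rw [mem_closedBall, dist_zero_right] at this
    exact this.trans (le_max_left L 0)
  obtain ⟨γ', h0', hs'⟩ := exists_isSol_of_bounded hWL hL (T := T + 1) (by linarith) (γ 0)
  have hball : ∀ z ∈ closedBall (0 : ℝ × ℝ) M, z ∈ closedBall (0 : ℝ × ℝ) (M + 2) :=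
    fun z hz => closedBall_subset_closedBall (by linarith) hz
  have heq : EqOn γ' γ (Icc 0 T) := by
    have hγW : IsSol W T γ := h.congr_field fun t ht => (hWV _ (hball _ (hM t ht))).symm
    have hs'' := hs'.mono (T' := T) (by linarith)
    exact ODE_solution_unique_of_mem_Icc_right (v := fun _ => W) (s := fun _ => univ)
      (fun _ _ => hWL.lipschitzOnWith) hs''.continuousOn
      (fun t ht => hs''.hasDerivWithinAt_Ici ht) (fun _ _ => trivial) hγW.continuousOn
      (fun t ht => hγW.hasDerivWithinAt_Ici ht) (fun _ _ => trivial) h0'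
  have hTmem : T ∈ Icc (0 : ℝ) (T + 1) := ⟨hT.le, by linarith⟩
  have hγT : γ' T ∈ ball (0 : ℝ × ℝ) (M + 1) := by
    rw [heq (right_mem_Icc.2 hT.le)]
    exact closedBall_subset_ball (by linarith) (hM T (right_mem_Icc.2 hT.le))
  have hcont := hs'.continuousOn T hTmem
  obtain ⟨η, hη, hη'⟩ := Metric.mem_nhdsWithin_iff.1 (hcont (isOpen_ball.mem_nhds hγT))
  set η₁ := min (η / 2) 1
  have hη₁ : 0 < η₁ := lt_min (by linarith) one_pos
  have hη₁1 : η₁ ≤ 1 := min_le_right _ _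
  have hη₁2 : η₁ ≤ η / 2 := min_le_left _ _
  have hin : ∀ t ∈ Icc 0 (T + η₁), γ' t ∈ closedBall (0 : ℝ × ℝ) (M + 1) := by
    intro t ht
    rcases le_total t T with htT | htT
    · rw [heq ⟨ht.1, htT⟩]
      exact closedBall_subset_closedBall (by linarith) (hM t ⟨ht.1, htT⟩)
    · apply ball_subset_closedBall
      apply hη'
      refine ⟨?_, ht.1, by linarith [ht.2]⟩
      rw [mem_ball, Real.dist_eq, abs_of_nonneg (by linarith)]
      linarith [ht.2]
  refine ⟨η₁, hη₁, γ', ?_, heq, fun ε hε => ?_⟩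
  · exact (hs'.mono (by linarith)).congr_field fun t ht => hWV _
      (closedBall_subset_closedBall (by linarith) (hin t ht))
  · set C := Real.exp (K * (T + η₁)) with hC
    have hCpos : 0 < C := Real.exp_pos _
    -- Grönwall multiplies the initial distance by at most `C`, so the distance stays below both `ε`
    -- and `1`.
    set δ := min ε 1 / (2 * C)
    have hδ : 0 < δ := by positivity
    filter_upwards [closedBall_mem_nhds (γ 0) hδ] with p hp
    obtain ⟨β, hβ0, hβ⟩ := exists_isSol_of_bounded hWL hL (T := T + η₁) (by linarith) p
    have hsm := hs'.mono (T' := T + η₁) (by linarith)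
    have hd : ∀ t ∈ Icc 0 (T + η₁), dist (β t) (γ' t) ≤ δ * C := by
      intro t ht
      refine (dist_le_of_trajectories_ODE (v := fun _ => W) (δ := δ) (fun _ => hWL) hβ.continuousOn
        (fun t ht => hβ.hasDerivWithinAt_Ici ht) hsm.continuousOn
        (fun t ht => hsm.hasDerivWithinAt_Ici ht) (by rw [hβ0, h0']; exact hp) t ht).trans ?_
      rw [sub_zero, hC]
      gcongr
      exact ht.2
    have hδC : δ * C = min ε 1 / 2 := by simp only [δ]; field_simp
    rw [hδC] at hd
    have hm1 : min ε 1 ≤ 1 := min_le_right _ _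
    have hm2 : min ε 1 ≤ ε := min_le_left _ _
    have hm3 : 0 < min ε 1 := lt_min hε one_pos
    refine ⟨β, hβ0, hβ.congr_field fun t ht => hWV _ ?_, fun t ht => ?_⟩
    · have h1 := hin t ht
      rw [mem_closedBall] at h1 ⊢
      linarith [dist_triangle (β t) (γ' t) 0, hd t ht]
    · linarith [hd t ht]

/-! ### Persistence of transversal arcs -/

theorem IsSol.strictMonoOn {V : ℝ × ℝ → ℝ × ℝ} {T : ℝ} {γ : ℝ → ℝ × ℝ} (h : IsSol V T γ)
    (σ : (ℝ × ℝ) →L[ℝ] ℝ) {a b : ℝ} (ha : 0 ≤ a) (hb : b ≤ T)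
    (hpos : ∀ t ∈ Icc a b, 0 < σ (V (γ t))) : StrictMonoOn (fun t => σ (γ t)) (Icc a b) := by
  apply strictMonoOn_of_deriv_pos (convex_Icc a b)
  · exact σ.continuous.comp_continuousOn (h.continuousOn.mono (Icc_subset_Icc ha hb))
  · intro t ht
    rw [interior_Icc] at ht
    have := (σ.hasFDerivAt (x := γ t)).comp_hasDerivAt t
      (h.hasDerivAt ⟨ha.trans_lt ht.1, ht.2.trans_le hb⟩)
    rw [show deriv (fun t => σ (γ t)) t = σ (V (γ t)) from this.deriv]
    exact hpos t (Ioo_subset_Icc_self ht)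

/-- An arc through the open set `O` that leaves and reaches the boundary of `O` transversally
persists under small changes of its initial point. -/
theorem IsSol.eventually_exists_arc {V : ℝ × ℝ → ℝ × ℝ} (hV : ContDiff ℝ 1 V)
    {O U W : Set (ℝ × ℝ)} (hO : IsOpen O) {γ : ℝ → ℝ × ℝ} {T : ℝ} (hT : 0 < T)
    (hγ : IsSol V T γ) (hin : ∀ t ∈ Ioo 0 T, γ t ∈ O) {σ τ : (ℝ × ℝ) →L[ℝ] ℝ}
    (hσ : ∀ᶠ z in 𝓝 (γ 0), z ∈ O ↔ 0 < σ z) (hτ : ∀ᶠ z in 𝓝 (γ T), z ∈ O ↔ 0 < τ z)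
    (hτ0 : τ (γ T) = 0) (hσV : 0 < σ (V (γ 0))) (hτV : τ (V (γ T)) < 0)
    (hU : IsOpen U) (hγU : γ '' Icc 0 T ⊆ U) (hW : W ∈ 𝓝 (γ T)) :
    ∀ᶠ p in 𝓝 (γ 0), σ p = 0 → ∃ T' > 0, ∃ β, IsSol V T' β ∧ β 0 = p ∧
      (∀ t ∈ Ioo 0 T', β t ∈ O) ∧ β '' Icc 0 T' ⊆ U ∧ τ (β T') = 0 ∧ β T' ∈ W := by
  obtain ⟨η, hη, γ', hγ', heq, htube⟩ := hγ.exists_tube hV hT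
  have hU' : ∀ t ∈ Icc 0 T, U ∈ 𝓝 (γ t) := fun t ht =>
    hU.mem_nhds (hγU (mem_image_of_mem _ ht))
  have e0 : γ' 0 = γ 0 := heq (left_mem_Icc.2 hT.le)
  have eT : γ' T = γ T := heq (right_mem_Icc.2 hT.le)
  -- neighbourhoods of the end points
  have hP : ∀ᶠ z in 𝓝 (γ 0), (z ∈ O ↔ 0 < σ z) ∧ 0 < σ (V z) ∧ z ∈ U :=
    hσ.and (((σ.continuous.comp hV.continuous).continuousAt.eventually
      (lt_mem_nhds hσV)).and (hU' 0 (left_mem_Icc.2 hT.le)))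
  have hQ : ∀ᶠ z in 𝓝 (γ T), (z ∈ O ↔ 0 < τ z) ∧ τ (V z) < 0 ∧ z ∈ U ∧ z ∈ W :=
    hτ.and (((τ.continuous.comp hV.continuous).continuousAt.eventually
      (gt_mem_nhds hτV)).and
        ((show ∀ᶠ z in 𝓝 (γ T), z ∈ U from hU' T (right_mem_Icc.2 hT.le)).and hW))
  obtain ⟨ρ, hρ, hP⟩ := Metric.eventually_nhds_iff.1 hP
  obtain ⟨ρ', hρ', hQ⟩ := Metric.eventually_nhds_iff.1 hQ
  have c0 : Tendsto γ' (𝓝[Icc 0 (T + η)] 0) (𝓝 (γ 0)) := by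
    rw [← e0]; exact hγ'.continuousOn 0 ⟨le_rfl, by linarith⟩
  have cT : Tendsto γ' (𝓝[Icc 0 (T + η)] T) (𝓝 (γ T)) := by
    rw [← eT]; exact hγ'.continuousOn T ⟨hT.le, by linarith⟩
  obtain ⟨r, hr, hr'⟩ := Metric.mem_nhdsWithin_iff.1 (c0 (ball_mem_nhds _ (half_pos hρ)))
  obtain ⟨s, hs, hs'⟩ := Metric.mem_nhdsWithin_iff.1 (cT (ball_mem_nhds _ (half_pos hρ')))
  -- The time interval is cut into two end pieces governed by `d`, where transversality decides on
  -- which side of the boundary the orbit is, and a middle piece, where compactness keeps it in `O ∩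
  -- U`.
  obtain ⟨d, hd0, hdr, hds, hdη, hdT⟩ : ∃ d > 0, d < r ∧ d < s ∧ d < η ∧ d < T / 2 := by
    refine ⟨min (min r s) (min η (T / 2)) / 2, by positivity, ?_⟩
    have : 0 < min (min r s) (min η (T / 2)) := by positivity
    have h1 : min (min r s) (min η (T / 2)) ≤ min r s := min_le_left _ _
    have h2 : min (min r s) (min η (T / 2)) ≤ min η (T / 2) := min_le_right _ _
    have h3 := min_le_left r s
    have h4 := min_le_right r s
    have h5 := min_le_left η (T / 2)
    have h6 := min_le_right η (T / 2)
    refine ⟨?_, ?_, ?_, ?_⟩ <;> linarith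
  have near0 : ∀ t ∈ Icc 0 d, dist (γ' t) (γ 0) < ρ / 2 := fun t ht => by
    refine hr' ⟨?_, ht.1, by linarith [ht.2]⟩
    rw [mem_ball, Real.dist_eq, sub_zero, abs_of_nonneg ht.1]; linarith [ht.2]
  have nearT : ∀ t ∈ Icc (T - d) (T + d), dist (γ' t) (γ T) < ρ' / 2 := fun t ht => by
    refine hs' ⟨?_, by linarith [ht.1], by linarith [ht.2]⟩
    rw [mem_ball, Real.dist_eq, abs_lt]; constructor <;> linarith [ht.2, ht.1]
  -- Continued beyond `T`, the orbit has really left `O`; this strict inequality passes to nearby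
  -- orbits and makes them cross `τ = 0`.
  have hdec : τ (γ' (T + d)) < 0 := by
    have := hγ'.strictMonoOn (-τ) (a := T) (b := T + d) hT.le (by linarith) (fun t ht => by
      have := (hQ ((nearT t ⟨by linarith [ht.1], ht.2⟩).trans (half_lt_self hρ'))).2.1
      simpa using this)
    have := this (left_mem_Icc.2 (by linarith)) (right_mem_Icc.2 (by linarith))
      (by linarith : T < T + d)
    simp only [neg_apply, eT, hτ0] at this
    linarith
  -- the middle part
  have hmid : γ' '' Icc d (T - d) ⊆ O ∩ U := by
    rintro _ ⟨t, ht, rfl⟩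
    have ht' : t ∈ Ioo 0 T := ⟨by linarith [ht.1], by linarith [ht.2]⟩
    rw [heq (Ioo_subset_Icc_self ht')]
    exact ⟨hin t ht', hγU (mem_image_of_mem _ (Ioo_subset_Icc_self ht'))⟩
  have hcpt : IsCompact (γ' '' Icc d (T - d)) := isCompact_Icc.image_of_continuousOn
    (hγ'.continuousOn.mono (Icc_subset_Icc hd0.le (by linarith)))
  obtain ⟨m, hm, hm'⟩ := hcpt.exists_thickening_subset_open (hO.inter hU) hmid
  obtain ⟨k, hk, hk'⟩ := Metric.eventually_nhds_iff.1
    (τ.continuous.continuousAt.eventually (gt_mem_nhds hdec))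
  have hε : 0 < min (min (ρ / 2) (ρ' / 2)) (min m k) := by positivity
  filter_upwards [htube _ hε] with p hp hp0
  obtain ⟨β, hβ0, hβ, hβd⟩ := hp
  have hβd' : ∀ t ∈ Icc 0 (T + η), dist (β t) (γ' t) < ρ / 2 ∧ dist (β t) (γ' t) < ρ' / 2 ∧
      dist (β t) (γ' t) < m ∧ dist (β t) (γ' t) < k := fun t ht => by
    have := hβd t ht
    simp only [lt_min_iff] at this
    exact ⟨this.1.1, this.1.2, this.2.1, this.2.2⟩
  have b0 : ∀ t ∈ Icc 0 d, (β t ∈ O ↔ 0 < σ (β t)) ∧ 0 < σ (V (β t)) ∧ β t ∈ U := fun t ht => by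
    apply hP
    linarith [dist_triangle (β t) (γ' t) (γ 0), near0 t ht,
      (hβd' t ⟨ht.1, by linarith [ht.2]⟩).1]
  have bT : ∀ t ∈ Icc (T - d) (T + d), (β t ∈ O ↔ 0 < τ (β t)) ∧ τ (V (β t)) < 0 ∧ β t ∈ U ∧
      β t ∈ W := fun t ht => by
    apply hQ
    linarith [dist_triangle (β t) (γ' t) (γ T), nearT t ht,
      (hβd' t ⟨by linarith [ht.1], by linarith [ht.2]⟩).2.1]
  have bM : ∀ t ∈ Icc d (T - d), β t ∈ O ∩ U := fun t ht => by
    apply hm'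
    exact mem_thickening_iff.2 ⟨γ' t, mem_image_of_mem _ ht,
      (hβd' t ⟨by linarith [ht.1], by linarith [ht.2]⟩).2.2.1⟩
  have mono0 := hβ.strictMonoOn σ (a := 0) (b := d) le_rfl (by linarith) fun t ht => (b0 t ht).2.1
  have monoT := hβ.strictMonoOn (-τ) (a := T - d) (b := T + d) (by linarith) (by linarith)
    fun t ht => by simpa using (bT t ht).2.1
  have hend : τ (β (T + d)) < 0 := hk' (hβd' (T + d) ⟨by linarith, by linarith⟩).2.2.2
  have hstart : 0 < τ (β (T - d)) :=
    (bT (T - d) ⟨le_rfl, by linarith⟩).1.1 (bM (T - d) ⟨by linarith, le_rfl⟩).1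
  have hcont : ContinuousOn (fun t => τ (β t)) (Icc (T - d) (T + d)) :=
    τ.continuous.comp_continuousOn
      (hβ.continuousOn.mono (Icc_subset_Icc (by linarith) (by linarith)))
  obtain ⟨T', hT', hT'0⟩ := intermediate_value_Ioo' (by linarith : T - d ≤ T + d) hcont
    (mem_Ioo.2 ⟨hend, hstart⟩)
  have hT'0 : τ (β T') = 0 := hT'0
  refine ⟨T', by linarith [hT'.1], β, hβ.mono (by linarith [hT'.2]), hβ0, ?_, ?_, hT'0,
    (bT T' (Ioo_subset_Icc_self hT')).2.2.2⟩
  · intro t ht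
    rcases le_total t d with htd | htd
    · rw [(b0 t ⟨ht.1.le, htd⟩).1]
      have := mono0 (left_mem_Icc.2 hd0.le) ⟨ht.1.le, htd⟩ ht.1
      simpa only [hβ0, hp0] using this
    · rcases le_total t (T - d) with htT | htT
      · exact (bM t ⟨htd, htT⟩).1
      · have htm : t ∈ Icc (T - d) (T + d) := ⟨htT, by linarith [ht.2, hT'.2]⟩
        rw [(bT t htm).1]
        have := monoT htm (Ioo_subset_Icc_self hT') ht.2
        simp only [neg_apply, hT'0] at this
        linarith
  · rintro _ ⟨t, ht, rfl⟩
    rcases le_total t d with htd | htd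
    · exact (b0 t ⟨ht.1, htd⟩).2.2
    · rcases le_total t (T - d) with htT | htT
      · exact (bM t ⟨htd, htT⟩).2
      · exact (bT t ⟨htT, by linarith [ht.2, hT'.2]⟩).2.2.1

/-! ### Counting the isolated points on a conic -/

section

open Polynomial

/-- The homogenization of `p`, as a polynomial of degree `n`, evaluated at `(U, W)`. -/
noncomputable def homog (p : ℝ[X]) (n : ℕ) (U W : ℝ[X]) : ℝ[X] :=
  ∑ i ∈ Finset.range (n + 1), C (p.coeff i) * U ^ i * W ^ (n - i)

theorem homog_eval {p : ℝ[X]} {n : ℕ} (hp : p.natDegree ≤ n) (U W : ℝ[X]) {t : ℝ}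
    (hw : W.eval t ≠ 0) :
    (homog p n U W).eval t = W.eval t ^ n * p.eval (U.eval t / W.eval t) := by
  rw [eval_eq_sum_range' (Nat.lt_succ_of_le hp), Finset.mul_sum, homog, eval_finsetSum]
  refine Finset.sum_congr rfl fun i hi => ?_
  have hi : i ≤ n := Nat.lt_succ_iff.1 (Finset.mem_range.1 hi)
  simp only [eval_mul, eval_C, eval_pow, div_pow]
  rw [pow_sub₀ _ hw hi]
  field_simp

/-- Unlike `homog_eval`, this allows the denominator `W` to vanish as well. It is needed at the
parameter of the origin, where that can happen. -/
theorem homog_eval_of_eq_zero (p : ℝ[X]) (n : ℕ) (U W : ℝ[X]) {t : ℝ} (hu : U.eval t = 0) :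
    (homog p n U W).eval t = p.eval 0 * W.eval t ^ n := by
  rw [homog, eval_finsetSum, Finset.sum_range_succ']
  simp [hu, coeff_zero_eq_eval_zero]

theorem natDegree_homog_le (p : ℝ[X]) (n : ℕ) {U W : ℝ[X]} {d : ℕ} (hU : U.natDegree ≤ d)
    (hW : W.natDegree ≤ d) : (homog p n U W).natDegree ≤ n * d := by
  refine natDegree_sum_le_of_forall_le _ _ fun i hi => ?_
  have hi : i ≤ n := Nat.lt_succ_iff.1 (Finset.mem_range.1 hi)
  refine (natDegree_mul_le).trans ?_
  have h1 := natDegree_C_mul_le (p.coeff i) (U ^ i)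
  have h2 : (U ^ i).natDegree ≤ i * d := natDegree_pow_le.trans (Nat.mul_le_mul_left i hU)
  have h3 : (W ^ (n - i)).natDegree ≤ (n - i) * d :=
    natDegree_pow_le.trans (Nat.mul_le_mul_left _ hW)
  have h4 : i * d + (n - i) * d = n * d := by rw [← add_mul, Nat.add_sub_cancel' hi]
  omega

/-- The zero set of a nonzero polynomial of degree at most `n` has at most `n` elements. -/
theorem encard_le_of_eval_eq_zero {p : ℝ[X]} (hp : p ≠ 0) {n : ℕ} (hn : p.natDegree ≤ n)
    {T : Set ℝ} (hT : ∀ t ∈ T, p.eval t = 0) : T.encard ≤ n := by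
  have : T ⊆ (p.roots.toFinset : Set ℝ) := fun t ht => by
    simpa [hp] using hT t ht
  refine (encard_le_encard this).trans ?_
  rw [encard_coe_eq_coe_finsetCard]
  exact_mod_cast (Multiset.toFinset_card_le _).trans ((card_roots' p).trans hn)

section Count

variable {n₁ d₁ n₂ d₂ : ℝ[X]} {a b c d : ℝ}

/-- The pairs at which two level functions `n₁ / d₁`, `n₂ / d₂` agree and that lie on a conic
`a x ^ 2 + b x = c y ^ 2 + d y`. -/
def Meets (n₁ d₁ n₂ d₂ : ℝ[X]) (a b c d : ℝ) (z : ℝ × ℝ) : Prop :=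
  a * z.1 ^ 2 + b * z.1 = c * z.2 ^ 2 + d * z.2 ∧
    n₁.eval z.1 * d₂.eval z.2 = n₂.eval z.2 * d₁.eval z.1

/-- Isolated positive solutions. -/
def IsolatedMeets (n₁ d₁ n₂ d₂ : ℝ[X]) (a b c d : ℝ) : Set (ℝ × ℝ) :=
  {z | 0 < z.1 ∧ 0 < z.2 ∧ Meets n₁ d₁ n₂ d₂ a b c d z ∧
    ∀ᶠ w in 𝓝 z, Meets n₁ d₁ n₂ d₂ a b c d w → w = z}

/-- Along a line `y = l(x)` inside the conic the level equation is polynomial in `x` of degree at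
most `m + k`. If it vanishes identically, all points of the line are solutions and none is isolated.
If the line passes through the origin, `x = 0` is one more root. -/
theorem encard_line_le {m k : ℕ} (hmk : 1 ≤ m + k) (hn₁ : n₁.natDegree ≤ m)
    (hn₂ : n₂.natDegree ≤ m) (hd₁ : d₁.natDegree ≤ k) (hd₂ : d₂.natDegree ≤ k)
    (hn : n₁.eval 0 = n₂.eval 0) (hd : d₁.eval 0 = d₂.eval 0) {l : ℝ[X]} (hl : l.natDegree ≤ 1)
    (hconic : ∀ x, a * x ^ 2 + b * x = c * l.eval x ^ 2 + d * l.eval x)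
    {S : Set (ℝ × ℝ)} (hS : S ⊆ IsolatedMeets n₁ d₁ n₂ d₂ a b c d)
    (hSl : ∀ z ∈ S, z.2 = l.eval z.1) :
    S.encard ≤ (m + k : ℕ) ∧ (l.eval 0 = 0 → S.encard + 1 ≤ (m + k : ℕ)) := by
  set p := n₁ * d₂.comp l - n₂.comp l * d₁ with hp
  have hpe : ∀ x, p.eval x = n₁.eval x * d₂.eval (l.eval x) - n₂.eval (l.eval x) * d₁.eval x := by
    intro x; simp [hp]
  by_cases hp0 : p = 0
  · have : S = ∅ := by
      refine eq_empty_of_forall_notMem fun z hz => ?_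
      obtain ⟨-, -, -, hiso⟩ := hS hz
      have hcont : Tendsto (fun x : ℝ => (x, l.eval x)) (𝓝 z.1) (𝓝 z) := by
        have : ContinuousAt (fun x : ℝ => (x, l.eval x)) z.1 := by fun_prop
        have h2 : (z.1, l.eval z.1) = z := by rw [← hSl z hz]
        rw [ContinuousAt, h2] at this
        exact this
      have h1 := hcont.eventually hiso
      obtain ⟨x, hx, hxne⟩ := ((h1.filter_mono nhdsWithin_le_nhds).and
        (self_mem_nhdsWithin (s := {z.1}ᶜ))).exists
      refine hxne ?_
      have := hx ⟨hconic x, by have := hpe x; rw [hp0] at this; simp at this; linarith⟩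
      exact congrArg Prod.fst this
    subst this
    simp only [encard_empty, zero_add, zero_le, true_and]
    intro _; exact_mod_cast hmk
  · have hdeg : p.natDegree ≤ m + k := by
      refine (natDegree_sub_le _ _).trans (max_le ?_ ?_)
      · refine natDegree_mul_le.trans (add_le_add hn₁ (natDegree_comp_le.trans ?_))
        nlinarith
      · refine natDegree_mul_le.trans (add_le_add (natDegree_comp_le.trans ?_) hd₁)
        nlinarith
    have hinj : InjOn Prod.fst S := fun z hz w hw h => by
      ext
      · exact h
      · rw [hSl z hz, hSl w hw, h]
    have hroot : ∀ t ∈ Prod.fst '' S, p.eval t = 0 := by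
      rintro _ ⟨z, hz, rfl⟩
      rw [hpe, ← hSl z hz]
      have := (hS hz).2.2.1.2
      linarith
    rw [← hinj.encard_image]
    refine ⟨encard_le_of_eval_eq_zero hp0 hdeg hroot, fun h0 => ?_⟩
    have hmem : (0 : ℝ) ∉ Prod.fst '' S := by
      rintro ⟨z, hz, hz0⟩
      exact absurd (hS hz).1 (by rw [hz0]; exact lt_irrefl _)
    rw [← encard_insert_of_notMem hmem]
    refine encard_le_of_eval_eq_zero hp0 hdeg fun t ht => ?_
    rcases ht with rfl | ht
    · rw [hpe, h0, hn, hd]; ring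
    · exact hroot t ht

/-- The conic contains a line through the origin. -/
theorem encard_le_of_reducible {m k : ℕ} (hmk : 1 ≤ m + k) (hn₁ : n₁.natDegree ≤ m)
    (hn₂ : n₂.natDegree ≤ m) (hd₁ : d₁.natDegree ≤ k) (hd₂ : d₂.natDegree ≤ k)
    (hn : n₁.eval 0 = n₂.eval 0) (hd : d₁.eval 0 = d₂.eval 0) {t : ℝ} (ha : a = c * t ^ 2)
    (hb : b = d * t) (hcd : c ≠ 0 ∨ d ≠ 0) :
    (IsolatedMeets n₁ d₁ n₂ d₂ a b c d).encard + 1 ≤ (2 * (m + k) : ℕ) := by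
  set S := IsolatedMeets n₁ d₁ n₂ d₂ a b c d
  have h1 := encard_line_le (l := C t * X) (S := {z ∈ S | z.2 = t * z.1}) hmk hn₁ hn₂ hd₁ hd₂ hn hd
    ((natDegree_C_mul_le _ _).trans natDegree_X_le)
    (fun x => by simp [ha, hb]; ring) (sep_subset _ _) (fun z hz => by simpa using hz.2)
  have h1 := h1.2 (by simp)
  have h2 : ({z ∈ S | c * (t * z.1 + z.2) + d = 0}).encard ≤ (m + k : ℕ) := by
    -- For `c = 0` the second factor of the conic is the nonzero constant `d`, so there is no second
    -- line.
    by_cases hc : c = 0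
    · have : {z ∈ S | c * (t * z.1 + z.2) + d = 0} = ∅ := by
        refine eq_empty_of_forall_notMem fun z hz => ?_
        have := hz.2
        simp [hc] at this hcd
        exact hcd this
      rw [this]; simp
    · refine (encard_line_le (l := C (-t) * X + C (-d / c)) hmk hn₁ hn₂ hd₁ hd₂ hn hd
        natDegree_linear_le (fun x => ?_) (sep_subset _ _) (fun z hz => ?_)).1
      · simp [ha, hb]; field_simp; ring
      · have := hz.2
        simp; field_simp; linarith
  have hsub : S ⊆ {z ∈ S | z.2 = t * z.1} ∪ {z ∈ S | c * (t * z.1 + z.2) + d = 0} := by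
    intro z hz
    -- The conic splits into these two factors; only the first need vanish at the origin, which
    -- saves one root in total.
    have h : (t * z.1 - z.2) * (c * (t * z.1 + z.2) + d) = 0 := by
      have := hz.2.2.1.1
      rw [ha, hb] at this
      linear_combination this
    rcases mul_eq_zero.1 h with h | h
    · exact Or.inl ⟨hz, by linarith⟩
    · exact Or.inr ⟨hz, h⟩
  calc S.encard + 1
    _ ≤ ({z ∈ S | z.2 = t * z.1} ∪ {z ∈ S | c * (t * z.1 + z.2) + d = 0}).encard + 1 := by
        gcongr
    _ ≤ ({z ∈ S | z.2 = t * z.1}.encard + {z ∈ S | c * (t * z.1 + z.2) + d = 0}.encard) + 1 := by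
        gcongr; exact encard_union_le _ _
    _ = ({z ∈ S | z.2 = t * z.1}.encard + 1) + {z ∈ S | c * (t * z.1 + z.2) + d = 0}.encard := by
        rw [add_right_comm]
    _ ≤ (m + k : ℕ) + (m + k : ℕ) := add_le_add h1 h2
    _ = (2 * (m + k) : ℕ) := by rw [two_mul]; norm_cast

/-- The slope `t = y / x` parametrizes the conic by `x = V / W`, `y = t V / W` with `V = d t - b`
and `W = a - c t ^ 2`. After clearing denominators the level equation is a polynomial `P` in `t` of
degree at most `2 (m + k)`. The slope `b / d` of the tangent at the origin is an extra root of `P`;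
it exists because `d ≠ 0`. -/
theorem encard_le_of_ne_zero {m k : ℕ} (hmk : 1 ≤ m + k) (hn₁ : n₁.natDegree ≤ m)
    (hn₂ : n₂.natDegree ≤ m) (hd₁ : d₁.natDegree ≤ k) (hd₂ : d₂.natDegree ≤ k)
    (hn : n₁.eval 0 = n₂.eval 0) (hd : d₁.eval 0 = d₂.eval 0) (hd0 : d ≠ 0) :
    (IsolatedMeets n₁ d₁ n₂ d₂ a b c d).encard + 1 ≤ (2 * (m + k) : ℕ) := by
  set S := IsolatedMeets n₁ d₁ n₂ d₂ a b c d with hSdef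
  have hconic : ∀ z ∈ S, z.1 * (a - c * (z.2 / z.1) ^ 2) = d * (z.2 / z.1) - b := fun z hz => by
    have h1 := hz.1.ne'
    have := hz.2.2.1.1
    field_simp
    linear_combination this
  -- If `W` vanishes at the slope of a solution, so does `V`; then the conic contains the whole line
  -- through the origin with that slope.
  by_cases hw : ∃ z ∈ S, a - c * (z.2 / z.1) ^ 2 = 0
  · obtain ⟨z, hz, hz0⟩ := hw
    have := hconic z hz
    rw [hz0] at this
    exact encard_le_of_reducible hmk hn₁ hn₂ hd₁ hd₂ hn hd (t := z.2 / z.1) (by linarith)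
      (by linarith) (Or.inr hd0)
  push Not at hw
  set W : ℝ[X] := C a - C c * X ^ 2 with hW
  set V : ℝ[X] := C d * X - C b with hV
  have hWe : ∀ t, W.eval t = a - c * t ^ 2 := fun t => by simp [hW]
  have hVe : ∀ t, V.eval t = d * t - b := fun t => by simp [hV]
  have hWd : W.natDegree ≤ 2 := by rw [hW]; compute_degree
  have hVd : V.natDegree ≤ 1 := by rw [hV]; compute_degree
  have hXVd : (X * V).natDegree ≤ 2 :=
    natDegree_mul_le.trans (by have := natDegree_X_le (R := ℝ); omega)
  set P := homog n₁ m V W * homog d₂ k (X * V) W - homog n₂ m (X * V) W * homog d₁ k V W with hP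
  have hPd : P.natDegree ≤ 2 * (m + k) := by
    refine (natDegree_sub_le _ _).trans (max_le ?_ ?_) <;> refine natDegree_mul_le.trans ?_
    · have := natDegree_homog_le n₁ m (hVd.trans one_le_two) hWd
      have := natDegree_homog_le d₂ k hXVd hWd
      omega
    · have := natDegree_homog_le n₂ m hXVd hWd
      have := natDegree_homog_le d₁ k (hVd.trans one_le_two) hWd
      omega
  have hPe : ∀ t, W.eval t ≠ 0 → P.eval t = W.eval t ^ (m + k) *
      (n₁.eval (V.eval t / W.eval t) * d₂.eval (t * V.eval t / W.eval t) -
        n₂.eval (t * V.eval t / W.eval t) * d₁.eval (V.eval t / W.eval t)) := fun t ht => by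
    simp only [hP, eval_sub, eval_mul, homog_eval hn₁ _ _ ht, homog_eval hn₂ _ _ ht,
      homog_eval hd₁ _ _ ht, homog_eval hd₂ _ _ ht, eval_X]
    ring
  have hz1 : ∀ z ∈ S, V.eval (z.2 / z.1) / W.eval (z.2 / z.1) = z.1 := fun z hz => by
    rw [hWe, hVe, ← hconic z hz, mul_div_cancel_right₀ _ (hw z hz)]
  have hz2 : ∀ z ∈ S, z.2 / z.1 * V.eval (z.2 / z.1) / W.eval (z.2 / z.1) = z.2 := fun z hz => by
    rw [mul_div_assoc, hz1 z hz, div_mul_cancel₀ _ hz.1.ne']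
  -- An identically vanishing `P` makes all points of the conic near a solution solutions too,
  -- against isolation.
  by_cases hP0 : P = 0
  · have : S = ∅ := by
      refine eq_empty_of_forall_notMem fun z hz => ?_
      have hWz : W.eval (z.2 / z.1) ≠ 0 := by rw [hWe]; exact hw z hz
      have hcont : Tendsto (fun t : ℝ => (V.eval t / W.eval t, t * V.eval t / W.eval t))
          (𝓝 (z.2 / z.1)) (𝓝 z) := by
        have : ContinuousAt (fun t : ℝ => (V.eval t / W.eval t, t * V.eval t / W.eval t))
            (z.2 / z.1) := by
          refine ContinuousAt.prodMk (ContinuousAt.div ?_ ?_ hWz) (ContinuousAt.div ?_ ?_ hWz) <;>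
          fun_prop
        rw [ContinuousAt, hz1 z hz, hz2 z hz] at this
        exact this
      have h1 := hcont.eventually hz.2.2.2
      have h2 : ∀ᶠ t in 𝓝 (z.2 / z.1), W.eval t ≠ 0 :=
        W.continuous.continuousAt.eventually_ne hWz
      obtain ⟨t, ⟨ht, htW⟩, htne⟩ := (((h1.and h2).filter_mono nhdsWithin_le_nhds).and
        (self_mem_nhdsWithin (s := {z.2 / z.1}ᶜ))).exists
      have hmeet := ht ⟨?_, ?_⟩
      · refine htne ?_
        have e1 := congrArg Prod.fst hmeet
        have e2 := congrArg Prod.snd hmeet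
        simp only [mul_div_assoc] at e1 e2
        rw [e1] at e2
        exact eq_div_of_mul_eq hz.1.ne' e2
      · have hWt := htW
        rw [hWe] at hWt
        simp only [hWe, hVe]
        field_simp
        ring
      · have := hPe t htW
        rw [hP0, eval_zero, eq_comm, mul_eq_zero] at this
        have := this.resolve_left (pow_ne_zero _ htW)
        simpa only [sub_eq_zero] using this
    rw [this]
    simp only [encard_empty, zero_add]
    exact_mod_cast (by omega : 1 ≤ 2 * (m + k))
  · have hinj : InjOn (fun z : ℝ × ℝ => z.2 / z.1) S := fun z hz w hw' h => by
      simp only at h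
      ext
      · rw [← hz1 z hz, h, hz1 w hw']
      · rw [← hz2 z hz, h, hz2 w hw']
    rw [← hinj.encard_image]
    -- At `t = b / d` the numerator `V` vanishes, so with `W ≠ 0` the point would have `x = 0`.
    have hmem : b / d ∉ (fun z : ℝ × ℝ => z.2 / z.1) '' S := by
      rintro ⟨z, hz, hzt⟩
      have h1 := hconic z hz
      simp only at hzt
      have h2 := hw z hz
      rw [hzt] at h1 h2
      rw [mul_div_cancel₀ _ hd0, sub_self, mul_eq_zero] at h1
      exact h1.elim hz.1.ne' h2
    rw [← encard_insert_of_notMem hmem]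
    refine encard_le_of_eval_eq_zero hP0 hPd fun t ht => ?_
    rcases ht with rfl | ⟨z, hz, rfl⟩
    · have hV0 : V.eval (b / d) = 0 := by rw [hVe, mul_div_cancel₀ _ hd0, sub_self]
      have hXV0 : (X * V).eval (b / d) = 0 := by rw [eval_mul, hV0, mul_zero]
      simp only [hP, eval_sub, eval_mul, homog_eval_of_eq_zero _ _ _ _ hV0,
        homog_eval_of_eq_zero _ _ _ _ hXV0, hn, hd]
      ring
    · have hWz : W.eval (z.2 / z.1) ≠ 0 := by rw [hWe]; exact hw z hz
      simp only
      rw [hPe _ hWz, hz1 z hz, hz2 z hz, hz.2.2.1.2]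
      ring

theorem encard_isolatedMeets_swap :
    (IsolatedMeets n₁ d₁ n₂ d₂ a b c d).encard = (IsolatedMeets n₂ d₂ n₁ d₁ c d a b).encard := by
  have key : ∀ (n₁ d₁ n₂ d₂ : ℝ[X]) (a b c d : ℝ), Prod.swap '' IsolatedMeets n₁ d₁ n₂ d₂ a b c d ⊆
      IsolatedMeets n₂ d₂ n₁ d₁ c d a b := by
    rintro n₁ d₁ n₂ d₂ a b c d _ ⟨z, ⟨h1, h2, ⟨h3, h4⟩, h5⟩, rfl⟩
    refine ⟨h2, h1, ⟨h3.symm, by simp only [Prod.fst_swap, Prod.snd_swap]; linarith⟩, ?_⟩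
    have hc : Tendsto Prod.swap (𝓝 z.swap) (𝓝 z) := by
      have := (continuous_swap (X := ℝ) (Y := ℝ)).tendsto z.swap
      rwa [Prod.swap_swap] at this
    filter_upwards [hc.eventually h5] with w hw hm
    rw [← hw ⟨hm.1.symm, by simp only [Prod.fst_swap, Prod.snd_swap]; linarith [hm.2]⟩,
      Prod.swap_swap]
  refine le_antisymm ?_ ?_
  · rw [← Prod.swap_injective.encard_image]
    exact encard_le_encard (key _ _ _ _ _ _ _ _)
  · rw [← Prod.swap_injective.encard_image (IsolatedMeets n₂ d₂ n₁ d₁ c d a b)]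
    exact encard_le_encard (key _ _ _ _ _ _ _ _)

/-- The number of isolated positive solutions, by a rational parametrization of the conic. -/
theorem encard_isolatedMeets_le {m k : ℕ} (hmk : 1 ≤ m + k) (hn₁ : n₁.natDegree ≤ m)
    (hn₂ : n₂.natDegree ≤ m) (hd₁ : d₁.natDegree ≤ k) (hd₂ : d₂.natDegree ≤ k)
    (hn : n₁.eval 0 = n₂.eval 0) (hd : d₁.eval 0 = d₂.eval 0)
    (h : a ≠ 0 ∨ b ≠ 0 ∨ c ≠ 0 ∨ d ≠ 0) :
    (IsolatedMeets n₁ d₁ n₂ d₂ a b c d).encard + 1 ≤ (2 * (m + k) : ℕ) := by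
  by_cases hd0 : d = 0
  -- Without linear terms the conic is `a x ^ 2 = c y ^ 2`, and any solution exhibits a line through
  -- the origin in it. If only `d` vanishes, the coordinates are exchanged.
  · by_cases hb0 : b = 0
    · rcases (IsolatedMeets n₁ d₁ n₂ d₂ a b c d).eq_empty_or_nonempty with he | ⟨z, hz⟩
      · rw [he]
        simp only [encard_empty, zero_add]
        exact_mod_cast (by omega : 1 ≤ 2 * (m + k))
      · have h1 := hz.1.ne'
        have h2 := hz.2.1.ne'
        have h3 := hz.2.2.1.1
        have hc : c ≠ 0 := by
          rintro rfl
          simp_all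
        refine encard_le_of_reducible hmk hn₁ hn₂ hd₁ hd₂ hn hd (t := z.1⁻¹ * z.2) ?_ ?_ (Or.inl hc)
        · rw [hb0, hd0] at h3
          field_simp
          linarith
        · simp [hb0, hd0]
    · rw [encard_isolatedMeets_swap]
      exact encard_le_of_ne_zero hmk hn₂ hn₁ hd₂ hd₁ hn.symm hd.symm hb0
  · exact encard_le_of_ne_zero hmk hn₁ hn₂ hd₁ hd₂ hn hd hd0

end Count

end

/-! ### The two zones and the half-axes -/

theorem mem_SigmaPlus_diff_iff (z : ℝ × ℝ) : z ∈ SigmaPlus \ Sigma ↔ 0 < z.1 ∧ 0 < z.2 := by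
  rw [Set.mem_sdiff, mem_Sigma_iff]
  simp only [SigmaPlus, mem_ofPred_eq]
  grind

theorem mem_SigmaMinus_diff_iff (z : ℝ × ℝ) : z ∈ SigmaMinus \ Sigma ↔ z.1 < 0 ∨ z.2 < 0 := by
  rw [Set.mem_sdiff, mem_Sigma_iff]
  simp only [SigmaMinus, mem_union, mem_ofPred_eq]
  grind

theorem isOpen_SigmaPlus_diff : IsOpen (SigmaPlus \ Sigma) := by
  have : SigmaPlus \ Sigma = {z : ℝ × ℝ | 0 < z.1} ∩ {z | 0 < z.2} := by
    ext z; rw [mem_SigmaPlus_diff_iff]; rfl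
  rw [this]
  exact (isOpen_lt continuous_const continuous_fst).inter
    (isOpen_lt continuous_const continuous_snd)

theorem isOpen_SigmaMinus_diff : IsOpen (SigmaMinus \ Sigma) := by
  have : SigmaMinus \ Sigma = {z : ℝ × ℝ | z.1 < 0} ∪ {z | z.2 < 0} := by
    ext z; rw [mem_SigmaMinus_diff_iff]; rfl
  rw [this]
  exact (isOpen_lt continuous_fst continuous_const).union
    (isOpen_lt continuous_snd continuous_const)

/-- The open half-axes. -/
def OnAxis (p : ℝ × ℝ) : Prop := (0 < p.1 ∧ p.2 = 0) ∨ (p.1 = 0 ∧ 0 < p.2)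

open Classical in
/-- The coordinate that vanishes on the half-axis of `p`. -/
noncomputable def nu (p : ℝ × ℝ) : (ℝ × ℝ) →L[ℝ] ℝ :=
  if p.2 = 0 then ContinuousLinearMap.snd ℝ ℝ ℝ else ContinuousLinearMap.fst ℝ ℝ ℝ

theorem nu_of_snd_eq_zero {p : ℝ × ℝ} (h : p.2 = 0) (z : ℝ × ℝ) : nu p z = z.2 := by
  simp [nu, h]

theorem nu_of_snd_pos {p : ℝ × ℝ} (h : 0 < p.2) (z : ℝ × ℝ) : nu p z = z.1 := by
  simp [nu, h.ne']

theorem isCrossingPoint_iff {F G : ℝ × ℝ → ℝ × ℝ} {p : ℝ × ℝ} :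
    IsCrossingPoint F G p ↔ OnAxis p ∧ 0 < nu p (F p) * nu p (G p) := by
  unfold IsCrossingPoint OnAxis
  constructor
  · rintro (⟨h1, h2, h3⟩ | ⟨h1, h2, h3⟩)
    · exact ⟨Or.inl ⟨h1, h2⟩, by simpa only [nu_of_snd_eq_zero h2] using h3⟩
    · exact ⟨Or.inr ⟨h1, h2⟩, by simpa only [nu_of_snd_pos h2] using h3⟩
  · rintro ⟨⟨h1, h2⟩ | ⟨h1, h2⟩, h3⟩
    · exact Or.inl ⟨h1, h2, by simpa only [nu_of_snd_eq_zero h2] using h3⟩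
    · exact Or.inr ⟨h1, h2, by simpa only [nu_of_snd_pos h2] using h3⟩

theorem OnAxis.nu_self {p : ℝ × ℝ} (h : OnAxis p) : nu p p = 0 := by
  rcases h with ⟨h1, h2⟩ | ⟨h1, h2⟩
  · rw [nu_of_snd_eq_zero h2, h2]
  · rw [nu_of_snd_pos h2, h1]

theorem OnAxis.mem_Sigma {p : ℝ × ℝ} (h : OnAxis p) : p ∈ Sigma := by
  rw [mem_Sigma_iff]
  rcases h with ⟨h1, h2⟩ | ⟨h1, h2⟩
  · exact Or.inl ⟨h1.le, h2⟩
  · exact Or.inr ⟨h1, h2.le⟩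

/-- Away from the corner the two zones are locally the two sides of one coordinate axis, so `nu p`
and `-nu p` serve as boundary functions in the persistence of arcs. -/
theorem OnAxis.eventually {p : ℝ × ℝ} (h : OnAxis p) :
    ∀ᶠ z in 𝓝 p, (z ∈ SigmaPlus \ Sigma ↔ 0 < nu p z) ∧
      (z ∈ SigmaMinus \ Sigma ↔ 0 < (-nu p) z) ∧ (nu p z = 0 → OnAxis z ∧ nu z = nu p) := by
  rcases h with ⟨h1, h2⟩ | ⟨h1, h2⟩
  · filter_upwards [continuous_fst.continuousAt.eventually (lt_mem_nhds h1)] with z hz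
    have e : nu p = ContinuousLinearMap.snd ℝ ℝ ℝ := by simp [nu, h2]
    rw [mem_SigmaPlus_diff_iff, mem_SigmaMinus_diff_iff, e]
    simp only [ContinuousLinearMap.coe_snd', hz, true_and, neg_apply, Left.neg_pos_iff,
      not_lt_of_gt hz, false_or]
    intro h0
    exact ⟨Or.inl ⟨hz, h0⟩, by simp [nu, h0]⟩
  · filter_upwards [continuous_snd.continuousAt.eventually (lt_mem_nhds h2)] with z hz
    have e : nu p = ContinuousLinearMap.fst ℝ ℝ ℝ := by simp [nu, h2.ne']
    rw [mem_SigmaPlus_diff_iff, mem_SigmaMinus_diff_iff, e]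
    simp only [ContinuousLinearMap.coe_fst', hz, and_true, neg_apply, Left.neg_pos_iff,
      not_lt_of_gt hz, or_false, true_and]
    intro h0
    exact ⟨Or.inr ⟨h0, hz⟩, by simp [nu, hz.ne']⟩

theorem nonneg_of_hasDerivWithinAt {f : ℝ → ℝ} {f' T : ℝ} (hT : 0 < T)
    (h : HasDerivWithinAt f f' (Icc 0 T) 0) (h0 : f 0 = 0)
    (hf : ∀ᶠ t in 𝓝[Ioo 0 T] 0, 0 ≤ f t) : 0 ≤ f' := by
  have h1 := hasDerivWithinAt_iff_tendsto_slope.1 h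
  have h2 : Tendsto (slope f 0) (𝓝[Ioo 0 T] 0) (𝓝 f') :=
    h1.mono_left (nhdsWithin_mono _ fun t ht => ⟨Ioo_subset_Icc_self ht, ht.1.ne'⟩)
  have : (𝓝[Ioo 0 T] (0 : ℝ)).NeBot := left_nhdsWithin_Ioo_neBot hT
  refine ge_of_tendsto h2 ?_
  filter_upwards [hf, self_mem_nhdsWithin] with t ht htm
  rw [slope_def_field, h0, sub_zero, sub_zero]
  exact div_nonneg ht htm.1.le

theorem nonpos_of_hasDerivWithinAt {f : ℝ → ℝ} {f' T : ℝ} (hT : 0 < T)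
    (h : HasDerivWithinAt f f' (Icc 0 T) T) (h0 : f T = 0)
    (hf : ∀ᶠ t in 𝓝[Ioo 0 T] T, 0 ≤ f t) : f' ≤ 0 := by
  have h1 := hasDerivWithinAt_iff_tendsto_slope.1 h
  have h2 : Tendsto (slope f T) (𝓝[Ioo 0 T] T) (𝓝 f') :=
    h1.mono_left (nhdsWithin_mono _ fun t ht => ⟨Ioo_subset_Icc_self ht, ht.2.ne⟩)
  have : (𝓝[Ioo 0 T] T).NeBot := right_nhdsWithin_Ioo_neBot hT
  refine le_of_tendsto h2 ?_
  filter_upwards [hf, self_mem_nhdsWithin] with t ht htm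
  rw [slope_def_field, h0, sub_zero]
  exact div_nonpos_of_nonneg_of_nonpos ht (by linarith [htm.2])

/-- The boundary function vanishes at the end point and is positive on the arc nearby, which fixes
the sign of the one-sided derivative. The inequalities are weak because tangency is not yet
excluded. -/
theorem IsSol.start_end_sign {V : ℝ × ℝ → ℝ × ℝ} {O : Set (ℝ × ℝ)} {γ : ℝ → ℝ × ℝ} {T : ℝ}
    (hT : 0 < T) (hγ : IsSol V T γ) (hin : ∀ t ∈ Ioo 0 T, γ t ∈ O) (σ τ : (ℝ × ℝ) →L[ℝ] ℝ)
    (hσ : ∀ᶠ z in 𝓝 (γ 0), z ∈ O ↔ 0 < σ z) (hτ : ∀ᶠ z in 𝓝 (γ T), z ∈ O ↔ 0 < τ z)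
    (hσ0 : σ (γ 0) = 0) (hτ0 : τ (γ T) = 0) : 0 ≤ σ (V (γ 0)) ∧ τ (V (γ T)) ≤ 0 := by
  have c : ∀ t₀ ∈ Icc 0 T, Tendsto γ (𝓝[Ioo 0 T] t₀) (𝓝 (γ t₀)) := fun t₀ h =>
    (hγ.continuousOn t₀ h).mono_left (nhdsWithin_mono _ Ioo_subset_Icc_self)
  have l := left_mem_Icc.2 hT.le
  have r := right_mem_Icc.2 hT.le
  constructor
  · refine nonneg_of_hasDerivWithinAt (f := fun t => σ (γ t)) hT
      (σ.hasFDerivAt.comp_hasDerivWithinAt 0 (hγ 0 l)) hσ0 ?_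
    filter_upwards [(c 0 l).eventually hσ, self_mem_nhdsWithin] with t h1 h2
    exact (h1.1 (hin t h2)).le
  · refine nonpos_of_hasDerivWithinAt (f := fun t => τ (γ t)) hT
      (τ.hasFDerivAt.comp_hasDerivWithinAt T (hγ T r)) hτ0 ?_
    filter_upwards [(c T r).eventually hτ, self_mem_nhdsWithin] with t h1 h2
    exact (h1.1 (hin t h2)).le

theorem IsOrbitArc.inter_Sigma {V : ℝ × ℝ → ℝ × ℝ} {R : Set (ℝ × ℝ)} {p q : ℝ × ℝ}
    {a : Set (ℝ × ℝ)} (h : IsOrbitArc V R p q a) : a ∩ Sigma ⊆ {p, q} := by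
  obtain ⟨T, γ, hT, -, h0, h1, hin, rfl⟩ := h
  rintro _ ⟨⟨t, ht, rfl⟩, hS⟩
  rcases eq_or_lt_of_le ht.1 with h | h
  · left; rw [← h, h0]
  · rcases eq_or_lt_of_le ht.2 with h' | h'
    · right; rw [h', h1]; rfl
    · exact absurd hS (hin t ⟨h, h'⟩).2

theorem IsOrbitArc.endpoints_mem {V : ℝ × ℝ → ℝ × ℝ} {R : Set (ℝ × ℝ)} {p q : ℝ × ℝ}
    {a : Set (ℝ × ℝ)} (h : IsOrbitArc V R p q a) : p ∈ a ∧ q ∈ a := by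
  obtain ⟨T, γ, hT, -, h0, h1, hin, rfl⟩ := h
  exact ⟨⟨0, left_mem_Icc.2 hT.le, h0⟩, ⟨T, right_mem_Icc.2 hT.le, h1⟩⟩

/-! ### Oriented crossing cycles and their perturbation -/

/-- `Γ` is a crossing periodic orbit that enters the first quadrant at `p` and leaves it at
`q`. -/
def IsCycle (F G : ℝ × ℝ → ℝ × ℝ) (p q : ℝ × ℝ) (Γ : Set (ℝ × ℝ)) : Prop :=
  p ≠ q ∧ IsCrossingPoint F G p ∧ IsCrossingPoint F G q ∧
    ∃ a b, IsOrbitArc F SigmaPlus p q a ∧ IsOrbitArc G SigmaMinus q p b ∧ Γ = a ∪ b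

theorem isCrossingPeriodicOrbit_iff {F G : ℝ × ℝ → ℝ × ℝ} {Γ : Set (ℝ × ℝ)} :
    IsCrossingPeriodicOrbit F G Γ ↔ ∃ p q, IsCycle F G p q Γ := by
  constructor
  · rintro ⟨p, q, a, b, h1, h2, h3, h4, h5, h6⟩
    exact ⟨p, q, h1, h2, h3, a, b, h4, h5, h6⟩
  · rintro ⟨p, q, h1, h2, h3, a, b, h4, h5, h6⟩
    exact ⟨p, q, a, b, h1, h2, h3, h4, h5, h6⟩

section Cycle

variable {F G : ℝ × ℝ → ℝ × ℝ} {p q : ℝ × ℝ} {Γ : Set (ℝ × ℝ)}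

theorem IsCycle.inter_Sigma (h : IsCycle F G p q Γ) : Γ ∩ Sigma = {p, q} := by
  obtain ⟨-, hp, hq, a, b, ha, hb, rfl⟩ := h
  apply subset_antisymm
  · rw [union_inter_distrib_right]
    refine union_subset ha.inter_Sigma (hb.inter_Sigma.trans ?_)
    rw [pair_comm]
  · rintro z (rfl | rfl)
    · exact ⟨Or.inl ha.endpoints_mem.1, (isCrossingPoint_iff.1 hp).1.mem_Sigma⟩
    · exact ⟨Or.inl ha.endpoints_mem.2, (isCrossingPoint_iff.1 hq).1.mem_Sigma⟩

/-- The arc of `F` gives weak signs; the crossing condition makes them strict and transfers them to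
`G`. -/
theorem IsCycle.nu_signs (h : IsCycle F G p q Γ) :
    0 < nu p (F p) ∧ 0 < nu p (G p) ∧ nu q (F q) < 0 ∧ nu q (G q) < 0 := by
  obtain ⟨-, hp, hq, a, b, ⟨T, γ, hT, hs, rfl, rfl, hin, -⟩, -, rfl⟩ := h
  obtain ⟨hpA, hp⟩ := isCrossingPoint_iff.1 hp
  obtain ⟨hqA, hq⟩ := isCrossingPoint_iff.1 hq
  have := IsSol.start_end_sign hT hs hin (nu (γ 0)) (nu (γ T))
    (hpA.eventually.mono fun z hz => hz.1) (hqA.eventually.mono fun z hz => hz.1)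
    hpA.nu_self hqA.nu_self
  refine ⟨?_, ?_, ?_, ?_⟩
  · exact lt_of_le_of_ne this.1 fun h => by simp [← h] at hp
  · exact (pos_iff_pos_of_mul_pos hp).1 (lt_of_le_of_ne this.1 fun h => by simp [← h] at hp)
  · exact lt_of_le_of_ne this.2 fun h => by simp [h] at hq
  · exact (neg_iff_neg_of_mul_pos hq).1 (lt_of_le_of_ne this.2 fun h => by simp [h] at hq)

/-- A cycle is determined by its crossing points. -/
theorem IsCycle.eq (hF : ContDiff ℝ 1 F) (hG : ContDiff ℝ 1 G) {Γ' : Set (ℝ × ℝ)}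
    (h : IsCycle F G p q Γ) (h' : IsCycle F G p q Γ') : Γ = Γ' := by
  obtain ⟨-, hp, hq, a, b, ha, hb, rfl⟩ := h
  obtain ⟨-, -, -, a', b', ha', hb', rfl⟩ := h'
  have hpS := (isCrossingPoint_iff.1 hp).1.mem_Sigma
  have hqS := (isCrossingPoint_iff.1 hq).1.mem_Sigma
  rw [(ha.unique hF ha' hqS hqS).2, (hb.unique hG hb' hpS hpS).2]

/-- Two points are crossed in one orientation only, so a pair `(x, y)` cannot belong to two
different corner cycles. -/
theorem IsCycle.not_swap {Γ' : Set (ℝ × ℝ)} (h : IsCycle F G p q Γ) : ¬ IsCycle F G q p Γ' :=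
  fun h' => lt_asymm h.nu_signs.1 h'.nu_signs.2.2.1

theorem IsOrbitArc.persist {V : ℝ × ℝ → ℝ × ℝ} (hV : ContDiff ℝ 1 V) {R : Set (ℝ × ℝ)}
    (hR : IsOpen (R \ Sigma)) {a U W : Set (ℝ × ℝ)} (ha : IsOrbitArc V R p q a)
    {σ τ : (ℝ × ℝ) →L[ℝ] ℝ}
    (hσ : ∀ᶠ z in 𝓝 p, z ∈ R \ Sigma ↔ 0 < σ z) (hτ : ∀ᶠ z in 𝓝 q, z ∈ R \ Sigma ↔ 0 < τ z)
    (hτ0 : τ q = 0) (hσV : 0 < σ (V p)) (hτV : τ (V q) < 0)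
    (hU : IsOpen U) (haU : a ⊆ U) (hW : W ∈ 𝓝 q) :
    ∀ᶠ p' in 𝓝 p, σ p' = 0 → ∃ q' a', IsOrbitArc V R p' q' a' ∧ a' ⊆ U ∧ τ q' = 0 ∧ q' ∈ W := by
  obtain ⟨T, γ, hT, hs, rfl, rfl, hin, rfl⟩ := ha
  filter_upwards [IsSol.eventually_exists_arc hV hR hT hs hin hσ hτ hτ0 hσV hτV hU haU hW]
    with p' hp' h0
  obtain ⟨T', hT', β, hβ, hβ0, hβin, hβU, hβτ, hβW⟩ := hp' h0
  exact ⟨β T', β '' Icc 0 T', ⟨T', β, hT', hβ, hβ0, rfl, hβin, rfl⟩, hβU, hβτ, hβW⟩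

/-- Near the crossing points of an isolated cycle there is no other pair of points of the
half-axes that satisfies the relations `r`, `s` between the end points of arcs. -/
theorem IsCycle.eventually_eq (hF : ContDiff ℝ 1 F) (hG : ContDiff ℝ 1 G)
    (h : IsCycle F G p q Γ) {U : Set (ℝ × ℝ)} (hU : IsOpen U) (hΓU : Γ ⊆ U)
    (hiso : ∀ Γ', IsCrossingPeriodicOrbit F G Γ' → Γ' ⊆ U → Γ' = Γ)
    {r s : ℝ × ℝ → ℝ × ℝ → Prop}
    (hr : ∀ u v a, IsOrbitArc F SigmaPlus u v a → r u v)
    (hs : ∀ u v a, IsOrbitArc G SigmaMinus u v a → s u v)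
    (hr' : ∃ W ∈ 𝓝 q, ∃ Z ∈ 𝓝 p, ∀ w ∈ W, ∀ w' ∈ W, ∀ z ∈ Z, nu q w = 0 → nu q w' = 0 →
      nu p z = 0 → r z w → r z w' → w = w')
    (hs' : ∃ W ∈ 𝓝 p, ∃ Z ∈ 𝓝 q, ∀ w ∈ W, ∀ w' ∈ W, ∀ z ∈ Z, nu p w = 0 → nu p w' = 0 →
      nu q z = 0 → s z w → s z w' → w = w') :
    ∀ᶠ w in 𝓝 (p, q), nu p w.1 = 0 → nu q w.2 = 0 → r w.1 w.2 → s w.2 w.1 → w = (p, q) := by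
  obtain ⟨sF, sG, sF', sG'⟩ := h.nu_signs
  have hI := h.inter_Sigma
  obtain ⟨hne, hp, hq, a, b, ha, hb, hΓ⟩ := h
  have haU : a ⊆ U := fun z hz => hΓU (hΓ ▸ Or.inl hz)
  have hbU : b ⊆ U := fun z hz => hΓU (hΓ ▸ Or.inr hz)
  obtain ⟨hpA, hp⟩ := isCrossingPoint_iff.1 hp
  obtain ⟨hqA, hq⟩ := isCrossingPoint_iff.1 hq
  obtain ⟨W, hW, Z, hZ, hr'⟩ := hr'
  obtain ⟨W', hW', Z', hZ', hs'⟩ := hs'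
  have e1 := ha.persist hF isOpen_SigmaPlus_diff (hpA.eventually.mono fun z hz => hz.1)
    (hqA.eventually.mono fun z hz => hz.1) hqA.nu_self sF sF' hU haU hW
  have e2 := hb.persist hG isOpen_SigmaMinus_diff (hqA.eventually.mono fun z hz => hz.2.1)
    (hpA.eventually.mono fun z hz => hz.2.1) (by simp [hpA.nu_self]) (by simpa using sG')
    (by simpa using sG) hU hbU hW'
  have cont : ∀ u : ℝ × ℝ, Continuous fun z => nu u (F z) * nu u (G z) := fun u =>
    ((nu u).continuous.comp hF.continuous).mul ((nu u).continuous.comp hG.continuous)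
  have e3 := (cont p).continuousAt.eventually (lt_mem_nhds hp)
  have e4 := (cont q).continuousAt.eventually (lt_mem_nhds hq)
  have e5 : ∀ᶠ w : (ℝ × ℝ) × (ℝ × ℝ) in 𝓝 (p, q), w.1 ≠ w.2 :=
    (isOpen_ne_fun continuous_fst continuous_snd).mem_nhds hne
  have P := e1.and (e3.and (hpA.eventually.and ((eventually_ne_nhds hne).and
    ((show ∀ᶠ z in 𝓝 p, z ∈ W' from hW').and (show ∀ᶠ z in 𝓝 p, z ∈ Z from hZ)))))
  have Q := e2.and (e4.and (hqA.eventually.and ((eventually_ne_nhds hne.symm).and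
    ((show ∀ᶠ z in 𝓝 q, z ∈ W from hW).and (show ∀ᶠ z in 𝓝 q, z ∈ Z' from hZ')))))
  filter_upwards [P.prod_nhds Q, e5] with w hw hwne h1 h2 hrw hsw
  obtain ⟨⟨p1, p2, p3, p4, p5, p6⟩, q1, q2, q3, q4, q5, q6⟩ := hw
  obtain ⟨q', a', ha', haU', hνq', hqW⟩ := p1 h1
  obtain ⟨p', b', hb', hbU', hνp', hpW⟩ := q1 (by simp [h2])
  -- The perturbed arc from `w.1` ends at some `q'` near `q` satisfying the same relation as `w.2`;
  -- local injectivity identifies the two. The same holds for the arc that starts at `w.2`, and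
  -- together they close up to a cycle inside `U`.
  have eq1 : q' = w.2 := hr' _ hqW _ q5 _ p6 hνq' h2 h1 (hr _ _ _ ha') hrw
  have eq2 : p' = w.1 := hs' _ hpW _ p5 _ q6 (by simpa using hνp') h1 h2 (hs _ _ _ hb') hsw
  subst eq1 eq2
  have hcyc : IsCycle F G w.1 w.2 (a' ∪ b') := by
    refine ⟨hwne, isCrossingPoint_iff.2 ⟨(p3.2.2 h1).1, ?_⟩,
      isCrossingPoint_iff.2 ⟨(q3.2.2 h2).1, ?_⟩, a', b', ha', hb', rfl⟩
    · rw [(p3.2.2 h1).2]; exact p2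
    · rw [(q3.2.2 h2).2]; exact q2
  have hΓ' := hiso _ (isCrossingPeriodicOrbit_iff.2 ⟨_, _, hcyc⟩) (union_subset haU' hbU')
  have hI' := hcyc.inter_Sigma
  rw [hΓ', hI] at hI'
  have m1 : w.1 ∈ ({p, q} : Set (ℝ × ℝ)) := hI' ▸ mem_insert _ _
  have m2 : w.2 ∈ ({p, q} : Set (ℝ × ℝ)) := hI' ▸ mem_insert_of_mem _ rfl
  exact Prod.ext (m1.resolve_right p4) (m2.resolve_left q4)

end Cycle

/-! ### Scalar linear equations and rational first integrals -/

theorem hasDerivWithinAt_fst {γ : ℝ → ℝ × ℝ} {v : ℝ × ℝ} {s : Set ℝ} {t : ℝ}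
    (h : HasDerivWithinAt γ v s t) : HasDerivWithinAt (fun t => (γ t).1) v.1 s t :=
  (ContinuousLinearMap.fst ℝ ℝ ℝ).hasFDerivAt.comp_hasDerivWithinAt t h

theorem hasDerivWithinAt_snd {γ : ℝ → ℝ × ℝ} {v : ℝ × ℝ} {s : Set ℝ} {t : ℝ}
    (h : HasDerivWithinAt γ v s t) : HasDerivWithinAt (fun t => (γ t).2) v.2 s t :=
  (ContinuousLinearMap.snd ℝ ℝ ℝ).hasFDerivAt.comp_hasDerivWithinAt t h

/-- Solutions of the scalar equations `f' = k f` are multiples of one positive function. -/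
theorem exists_pos_fundamental {T : ℝ} (hT : 0 ≤ T) {k : ℝ → ℝ} (hk : ContinuousOn k (Icc 0 T)) :
    ∃ E : ℝ → ℝ, (∀ t, 0 < E t) ∧ ∀ f : ℝ → ℝ,
      (∀ t ∈ Icc 0 T, HasDerivWithinAt f (k t * f t) (Icc 0 T) t) →
        ∀ t ∈ Icc 0 T, f t = f 0 * E t := by
  set k' := IccExtend hT ((Icc 0 T).domRestrict k) with hk'
  have hc : Continuous k' := (continuousOn_iff_continuous_domRestrict.1 hk).Icc_extend'
  have hkk : ∀ t ∈ Icc 0 T, k' t = k t := fun t ht => by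
    simp [hk', IccExtend_of_mem hT _ ht]
  set κ : ℝ → ℝ := fun t => ∫ s in (0 : ℝ)..t, k' s with hκ
  have hκd : ∀ t, HasDerivAt κ (k' t) t := fun t =>
    intervalIntegral.integral_hasDerivAt_right (hc.intervalIntegrable _ _)
      (hc.stronglyMeasurableAtFilter _ _) hc.continuousAt
  refine ⟨fun t => Real.exp (κ t), fun t => Real.exp_pos _, fun f hf t ht => ?_⟩
  have hg : ∀ s ∈ Icc 0 T, HasDerivWithinAt (fun s => f s * Real.exp (-κ s)) 0 (Icc 0 T) s := by
    intro s hs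
    have := (hf s hs).mul ((hκd s).neg.exp.hasDerivWithinAt (s := Icc 0 T))
    refine this.congr_deriv ?_
    rw [hkk s hs, Pi.neg_apply]; ring
  have hconst := constant_of_has_deriv_right_zero (f := fun s => f s * Real.exp (-κ s))
    (fun s hs => (hg s hs).continuousWithinAt)
    (fun s hs => (hg s (Ico_subset_Icc_self hs)).mono_of_mem_nhdsWithin
      (mem_of_superset (Icc_mem_nhdsGE hs.2) (Icc_subset_Icc_left hs.1))) t ht
  have h0 : κ 0 = 0 := by simp [hκ]
  simp only [h0, neg_zero, Real.exp_zero, mul_one] at hconst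
  rw [← hconst, mul_assoc, ← Real.exp_add, neg_add_cancel, Real.exp_zero, mul_one]

open Polynomial in
/-- A rational first integral `N / l ^ k` of the quadratic field `Q`, where `l` is affine in the
second coordinate and `l = 0` is an invariant line. -/
structure RatIntegral (Q : ℝ × ℝ → ℝ × ℝ) (m k : ℕ) where
  N : ℝ × ℝ → ℝ
  κ : ℝ × ℝ → ℝ
  ρ : ℝ × ℝ → ℝ
  l₀ : ℝ
  l₁ : ℝ
  l₁_ne : l₁ ≠ 0
  one_le : 1 ≤ k
  continuous_κ : Continuous κ
  cofactor : ∀ z : ℝ × ℝ, l₁ * (Q z).2 = κ z * (l₀ + l₁ * z.2)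
  deriv_N : ∀ {γ : ℝ → ℝ × ℝ} {s : Set ℝ} {t : ℝ}, HasDerivWithinAt γ (Q (γ t)) s t →
    HasDerivWithinAt (fun t => N (γ t)) (k * κ (γ t) * N (γ t)) s t
  exists_poly : ∀ O V : ℝ × ℝ, ∃ n d : ℝ[X], n.natDegree ≤ m ∧ d.natDegree ≤ k ∧
    -- The Wronskian identity below says that along the direction `V` the derivative of `N / l ^ k`
    -- is `ρ / l ^ (2 k)` times the determinant of `V` and the field: zeros come from tangency or
    -- from `ρ`.
    (∀ x, n.eval x = N (O + x • V)) ∧ (∀ x, d.eval x = (l₀ + l₁ * (O + x • V).2) ^ k) ∧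
    ∀ x, d.eval x * n.derivative.eval x - n.eval x * d.derivative.eval x =
      ρ (O + x • V) * (V.1 * (Q (O + x • V)).2 - V.2 * (Q (O + x • V)).1)
  ρ_pos : ∀ z : ℝ × ℝ, 0 < l₀ + l₁ * z.2 → 0 < ρ z
  contDiff : ContDiff ℝ 1 Q

namespace RatIntegral

variable {Q : ℝ × ℝ → ℝ × ℝ} {m k : ℕ} (I : RatIntegral Q m k)

/-- The equation of the invariant line. -/
def l (z : ℝ × ℝ) : ℝ := I.l₀ + I.l₁ * z.2

/-- The denominator of the first integral. -/
def D (z : ℝ × ℝ) : ℝ := I.l z ^ k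

/-- `N` and `l ^ k` have the same cofactor and are multiplied by the same positive function along an
orbit. The cross-multiplied conservation law therefore also holds on the line `l = 0`, and `l` keeps
its sign. -/
theorem exists_scale {T : ℝ} (hT : 0 ≤ T) {γ : ℝ → ℝ × ℝ} (hγ : IsSol Q T γ) :
    ∃ E : ℝ → ℝ, (∀ t, 0 < E t) ∧ ∀ t ∈ Icc 0 T, I.l (γ t) = I.l (γ 0) * E t ∧
      I.N (γ t) * I.D (γ 0) = I.N (γ 0) * I.D (γ t) := by
  have hc : ContinuousOn (fun t => I.κ (γ t)) (Icc 0 T) :=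
    I.continuous_κ.comp_continuousOn hγ.continuousOn
  obtain ⟨E, hE, h⟩ := exists_pos_fundamental hT hc
  obtain ⟨E', hE', h'⟩ := exists_pos_fundamental hT
    (show ContinuousOn (fun t => k * I.κ (γ t)) (Icc 0 T) from continuousOn_const.mul hc)
  have hl : ∀ t ∈ Icc 0 T,
      HasDerivWithinAt (fun t => I.l (γ t)) (I.κ (γ t) * I.l (γ t)) (Icc 0 T) t := by
    intro t ht
    exact (((hasDerivWithinAt_snd (hγ t ht)).const_mul I.l₁).const_add I.l₀).congr_deriv
      (I.cofactor _)
  have hD : ∀ t ∈ Icc 0 T,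
      HasDerivWithinAt (fun t => I.D (γ t)) (k * I.κ (γ t) * I.D (γ t)) (Icc 0 T) t := by
    intro t ht
    refine ((hl t ht).pow k).congr_deriv ?_
    obtain ⟨j, hj⟩ := Nat.exists_eq_add_of_le' I.one_le
    simp only [D, hj, Nat.add_sub_cancel]
    ring
  refine ⟨E, hE, fun t ht => ⟨h _ hl t ht, ?_⟩⟩
  rw [h' _ hD t ht, h' (fun t => I.N (γ t)) (fun t ht => I.deriv_N (hγ t ht)) t ht]
  ring

variable {G : ℝ × ℝ → ℝ × ℝ} {e : (ℝ × ℝ) ≃ᵃ[ℝ] (ℝ × ℝ)}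

theorem _root_.CornerPWS.hasDerivWithinAt_affine (he : ∀ z, e.linear (G z) = Q (e z))
    {γ : ℝ → ℝ × ℝ} {s : Set ℝ} {t : ℝ} (h : HasDerivWithinAt γ (G (γ t)) s t) :
    HasDerivWithinAt (fun t => e (γ t)) (Q (e (γ t))) s t := by
  rw [← he]
  have h1 : ∀ z, e z = e.linear.toLinearMap.toContinuousLinearMap z + e 0 := fun z => by
    have := e.map_vadd 0 z
    simpa using this
  rw [show (fun t => e (γ t)) = fun t => e.linear.toLinearMap.toContinuousLinearMap (γ t) + e 0
    from funext fun t => h1 _]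
  exact ((e.linear.toLinearMap.toContinuousLinearMap.hasFDerivAt).comp_hasDerivWithinAt t
    h).add_const _

theorem _root_.CornerPWS.affine_apply (e : (ℝ × ℝ) ≃ᵃ[ℝ] (ℝ × ℝ)) (z : ℝ × ℝ) :
    e z = e 0 + z.1 • e.linear (1, 0) + z.2 • e.linear (0, 1) := by
  have := e.map_vadd 0 z
  simp only [vadd_eq_add, add_zero] at this
  rw [this, add_assoc, ← map_smul, ← map_smul, ← map_add, add_comm]
  simp

theorem _root_.CornerPWS.contDiff_affineCopy (hQ : ContDiff ℝ 1 Q)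
    (he : ∀ z, e.linear (G z) = Q (e z)) : ContDiff ℝ 1 G := by
  have h1 : G = fun z => e.linear.symm.toLinearMap.toContinuousLinearMap
      (Q (e 0 + z.1 • e.linear (1, 0) + z.2 • e.linear (0, 1))) := by
    funext z
    rw [← affine_apply, ← he]
    simp
  rw [h1]
  exact (ContinuousLinearMap.contDiff _).comp (hQ.comp (by fun_prop))

theorem arc_conserved (he : ∀ z, e.linear (G z) = Q (e z)) {R : Set (ℝ × ℝ)} {u v : ℝ × ℝ}
    {b : Set (ℝ × ℝ)} (h : IsOrbitArc G R u v b) :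
    (∃ E > 0, I.l (e v) = I.l (e u) * E) ∧
      I.N (e v) * I.D (e u) = I.N (e u) * I.D (e v) ∧
      (I.l (e u) = 0 → ∀ z ∈ b, I.l (e z) = 0) := by
  obtain ⟨T, γ, hT, hs, rfl, rfl, -, rfl⟩ := h
  have hs' : IsSol Q T (fun t => e (γ t)) := fun t ht => hasDerivWithinAt_affine he (hs t ht)
  obtain ⟨E, hE, h⟩ := I.exists_scale hT.le hs'
  have hr := h T (right_mem_Icc.2 hT.le)
  refine ⟨⟨E T, hE T, hr.1⟩, hr.2, fun h0 => ?_⟩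
  rintro _ ⟨t, ht, rfl⟩
  rw [(h t ht).1, h0, zero_mul]

/-- A first integral with the zero sets of `J` and `-J` distinguished, whose derivative along the
lines transverse to the field does not vanish. -/
structure Signed where
  J : ℝ × ℝ → ℝ
  τ : ℝ × ℝ → ℝ
  hasStrictDerivAt : ∀ (O V : ℝ × ℝ) (s : ℝ), I.l (O + s • V) ≠ 0 →
    HasStrictDerivAt (fun s : ℝ => J (O + s • V))
      (τ (O + s • V) * (V.1 * (Q (O + s • V)).2 - V.2 * (Q (O + s • V)).1)) s
  τ_mul_pos : ∀ z w : ℝ × ℝ, 0 < I.l z * I.l w → 0 < τ z * τ w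
  conserved : ∀ {T : ℝ} {γ : ℝ → ℝ × ℝ}, 0 ≤ T → IsSol Q T γ → J (γ T) = J (γ 0)
  eq_or_eq_neg : ∀ z w : ℝ × ℝ, 0 < I.l z * I.l w → I.N z * I.D w = I.N w * I.D z →
    J z = J w ∨ J z = -J w

/-- The invariant line contains no arc between the two half-axes outside the first quadrant. -/
theorem l_ne_zero (he : ∀ z, e.linear (G z) = Q (e z)) {u v : ℝ × ℝ} {b : Set (ℝ × ℝ)}
    (h : IsOrbitArc G SigmaMinus u v b) {x y : ℝ} (hx : 0 < x) (hy : 0 < y)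
    (huv : (u = (x, 0) ∧ v = (0, y)) ∨ (u = (0, y) ∧ v = (x, 0))) : I.l (e u) ≠ 0 := by
  intro h0
  have hz := (I.arc_conserved he h).2.2 h0
  obtain ⟨hu, hv⟩ := h.endpoints_mem
  have h1 : I.l (e (x, 0)) = 0 ∧ I.l (e (0, y)) = 0 := by
    rcases huv with ⟨rfl, rfl⟩ | ⟨rfl, rfl⟩
    · exact ⟨hz _ hu, hz _ hv⟩
    · exact ⟨hz _ hv, hz _ hu⟩
  have hl : ∀ z, I.l (e z) = I.l (e 0) + I.l₁ * (e.linear (1, 0)).2 * z.1 +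
      I.l₁ * (e.linear (0, 1)).2 * z.2 := fun z => by
    simp only [l]
    rw [affine_apply e z]
    simp
    ring
  obtain ⟨T, γ, hT, hs, hγ0, hγT, hin, rfl⟩ := h
  have hc : ContinuousOn (fun t => (γ t).1) (uIcc 0 T) := by
    rw [uIcc_of_le hT.le]
    exact continuous_fst.comp_continuousOn (IsSol.continuousOn (V := G) hs)
  -- An arc inside the line through `(x, 0)` and `(0, y)` must pass the abscissa `x / 2`, where the
  -- line is in the open first quadrant, while the zone of the arc demands a negative ordinate
  -- there.
  have hmem : x / 2 ∈ uIcc (γ 0).1 (γ T).1 := by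
    rw [hγ0, hγT]
    rcases huv with ⟨rfl, rfl⟩ | ⟨rfl, rfl⟩
    · rw [uIcc_of_ge hx.le]; exact ⟨by linarith, by linarith⟩
    · rw [uIcc_of_le hx.le]; exact ⟨by linarith, by linarith⟩
  obtain ⟨t, ht, htx⟩ := intermediate_value_uIcc hc hmem
  rw [uIcc_of_le hT.le] at ht
  simp only at htx
  have ht0 : t ≠ 0 := by
    rintro rfl
    rw [hγ0] at htx
    rcases huv with ⟨rfl, rfl⟩ | ⟨rfl, rfl⟩ <;> simp at htx <;> linarith
  have htT : t ≠ T := by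
    rintro rfl
    rw [hγT] at htx
    rcases huv with ⟨rfl, rfl⟩ | ⟨rfl, rfl⟩ <;> simp at htx <;> linarith
  have hzone := (mem_SigmaMinus_diff_iff _).1
    (hin t ⟨lt_of_le_of_ne ht.1 ht0.symm, lt_of_le_of_ne ht.2 htT⟩)
  have h2 := hz _ (mem_image_of_mem _ ht)
  have hneg : (γ t).2 < 0 := hzone.resolve_left (by rw [htx]; linarith)
  rw [hl] at h1 h2
  rw [hl (0, y)] at h1
  simp only [mul_zero, add_zero] at h1
  set α := I.l (e 0)
  set β := I.l₁ * (e.linear (1, 0)).2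
  set δ := I.l₁ * (e.linear (0, 1)).2
  have hβ : β = -α / x := by field_simp; linarith [h1.1]
  have hδ : δ = -α / y := by field_simp; linarith [h1.2]
  have hα : α = 0 := by
    rw [htx, hβ, hδ] at h2
    have h3 : α * (1 / 2 - (γ t).2 / y) = 0 := by
      field_simp at h2 ⊢
      linarith
    refine (mul_eq_zero.1 h3).resolve_right ?_
    have : (γ t).2 / y < 0 := div_neg_of_neg_of_pos hneg hy
    linarith
  have hall : ∀ z, I.l (e z) = 0 := fun z => by
    rw [hl z, hβ, hδ]
    rw [hα]; simp
  have hs1 := hall (e.symm (0, 0))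
  have hs2 := hall (e.symm (0, 1))
  simp only [l, AffineEquiv.apply_symm_apply] at hs1 hs2
  exact I.l₁_ne (by linarith)

end RatIntegral

/-! ### Variation of the first integrals along the half-axes -/

theorem eventually_injective {f : ℝ → ℝ} {f' a : ℝ} (h : HasStrictDerivAt f f' a) (hf' : f' ≠ 0) :
    ∃ ε > 0, ∀ x y, |x - a| < ε → |y - a| < ε → f x = f y → x = y := by
  have h1 := h.hasStrictFDerivAt.isLittleO.def (half_pos (abs_pos.2 hf'))
  obtain ⟨ε, hε, h2⟩ := Metric.eventually_nhds_iff.1 h1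
  refine ⟨ε, hε, fun x y hx hy hxy => ?_⟩
  have h3 := h2 (y := (x, y)) (by simpa [Prod.dist_eq, Real.dist_eq] using ⟨hx, hy⟩)
  simp only [hxy, sub_self, zero_sub, norm_neg, Real.norm_eq_abs,
    ContinuousLinearMap.toSpanSingleton_apply, smul_eq_mul, abs_mul] at h3
  by_contra hne
  have : 0 < |x - y| := abs_pos.2 (sub_ne_zero.2 hne)
  have : 0 < |f'| := abs_pos.2 hf'
  nlinarith

theorem eventually_slope {g : ℝ → ℝ} {g' a : ℝ} (h : HasDerivAt g g' a) (hg' : g' ≠ 0) :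
    ∀ᶠ x in 𝓝 a, x ≠ a → 0 < g' * (x - a) * (g x - g a) := by
  have h1 := (hasDerivAt_iff_tendsto_slope.1 h).const_mul g'
  have h2 := h1.eventually (lt_mem_nhds (mul_self_pos.2 hg'))
  rw [eventually_nhdsWithin_iff] at h2
  filter_upwards [h2] with x hx hxa
  have h3 := mul_pos (hx hxa) (mul_self_pos.2 (sub_ne_zero.2 hxa))
  rw [slope_def_field] at h3
  have h4 : x - a ≠ 0 := sub_ne_zero.2 hxa
  rwa [show g' * ((g x - g a) / (x - a)) * ((x - a) * (x - a)) = g' * (x - a) * (g x - g a) by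
    field_simp] at h3

/-- Local injectivity along a half-axis of a function with nonzero derivative along it. -/
theorem OnAxis.exists_nhds_injective {q : ℝ × ℝ} (hq : OnAxis q) {H : ℝ × ℝ → ℝ}
    (h₁ : q.2 = 0 → ∃ f' ≠ 0, HasStrictDerivAt (fun s => H (s, 0)) f' q.1)
    (h₂ : q.1 = 0 → ∃ f' ≠ 0, HasStrictDerivAt (fun s => H (0, s)) f' q.2) :
    ∃ W ∈ 𝓝 q, ∀ w ∈ W, ∀ w' ∈ W, nu q w = 0 → nu q w' = 0 → H w = H w' → w = w' := by
  have hsub : ∀ ε > 0, ∀ w ∈ ball q ε, |w.1 - q.1| < ε ∧ |w.2 - q.2| < ε := by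
    intro ε _ w hw
    simpa [Prod.dist_eq, Real.dist_eq] using hw
  rcases hq with ⟨hx, hy⟩ | ⟨hx, hy⟩
  · obtain ⟨f', hf', hd⟩ := h₁ hy
    obtain ⟨ε, hε, h⟩ := eventually_injective hd hf'
    refine ⟨ball q ε, ball_mem_nhds _ hε, fun w hw w' hw' e e' hH => ?_⟩
    rw [nu_of_snd_eq_zero hy] at e e'
    have := h w.1 w'.1 (hsub ε hε w hw).1 (hsub ε hε w' hw').1 (by
      rwa [← show w = (w.1, 0) from Prod.ext rfl e, ← show w' = (w'.1, 0) from Prod.ext rfl e'])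
    exact Prod.ext this (e.trans e'.symm)
  · obtain ⟨f', hf', hd⟩ := h₂ hx
    obtain ⟨ε, hε, h⟩ := eventually_injective hd hf'
    refine ⟨ball q ε, ball_mem_nhds _ hε, fun w hw w' hw' e e' hH => ?_⟩
    rw [nu_of_snd_pos hy] at e e'
    have := h w.2 w'.2 (hsub ε hε w hw).2 (hsub ε hε w' hw').2 (by
      rwa [← show w = (0, w.2) from Prod.ext e rfl, ← show w' = (0, w'.2) from Prod.ext e' rfl])
    exact Prod.ext (e.trans e'.symm) this

/-- The Hamiltonian of a linear saddle. -/
noncomputable def ham (A δ μ B C : ℝ) (z : ℝ × ℝ) : ℝ :=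
  -(μ / 2) * z.1 ^ 2 - A * z.1 * z.2 - δ / 2 * z.2 ^ 2 + B * z.2 - C * z.1

section Saddle

variable {F : ℝ × ℝ → ℝ × ℝ} {A δ μ B C : ℝ}

theorem contDiff_saddle (hF : ∀ x y, F (x, y) = (-A * x - δ * y + B, μ * x + A * y + C)) :
    ContDiff ℝ 1 F := by
  rw [show F = fun z => (-A * z.1 - δ * z.2 + B, μ * z.1 + A * z.2 + C) from
    funext fun z => hF z.1 z.2]
  fun_prop

theorem ham_conserved (hF : ∀ x y, F (x, y) = (-A * x - δ * y + B, μ * x + A * y + C))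
    {R : Set (ℝ × ℝ)} {u v : ℝ × ℝ} {a : Set (ℝ × ℝ)} (h : IsOrbitArc F R u v a) :
    ham A δ μ B C u = ham A δ μ B C v := by
  obtain ⟨T, γ, hT, hs, rfl, rfl, -, -⟩ := h
  have hs : IsSol F T γ := hs
  have hd : ∀ t ∈ Icc 0 T, HasDerivWithinAt (fun t => ham A δ μ B C (γ t)) 0 (Icc 0 T) t := by
    intro t ht
    have hx := hasDerivWithinAt_fst (hs t ht)
    have hy := hasDerivWithinAt_snd (hs t ht)
    have hFt := hF (γ t).1 (γ t).2
    rw [show ((γ t).1, (γ t).2) = γ t from rfl] at hFt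
    rw [hFt] at hx hy
    refine ((((((hx.pow 2).const_mul (-(μ / 2))).sub ((hx.const_mul A).mul hy)).sub
      ((hy.pow 2).const_mul (δ / 2))).add (hy.const_mul B)).sub (hx.const_mul C)).congr_deriv ?_
    simp only [Nat.cast_ofNat]
    ring
  exact (constant_of_has_deriv_right_zero (f := fun t => ham A δ μ B C (γ t))
    (fun s hs => (hd s hs).continuousWithinAt)
    (fun s hs => (hd s (Ico_subset_Icc_self hs)).mono_of_mem_nhdsWithin
      (mem_of_superset (Icc_mem_nhdsGE hs.2) (Icc_subset_Icc_left hs.1))) T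
        (right_mem_Icc.2 hT.le)).symm

/-- Along a half-axis the derivative of a Hamiltonian is, up to sign, the normal component of its
field, hence nonzero at crossing points. -/
theorem ham_axis_deriv (hF : ∀ x y, F (x, y) = (-A * x - δ * y + B, μ * x + A * y + C))
    {p : ℝ × ℝ} :
    (p.2 = 0 → HasStrictDerivAt (fun s => ham A δ μ B C (s, 0)) (-(F p).2) p.1) ∧
    (p.1 = 0 → HasStrictDerivAt (fun s => ham A δ μ B C (0, s)) (F p).1 p.2) := by
  have hd : ∀ a b c : ℝ, HasStrictDerivAt (fun s : ℝ => a * s ^ 2 + b * s) (2 * a * c + b) c := by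
    intro a b c
    refine ((((hasStrictDerivAt_id c).pow 2).const_mul a).add
      ((hasStrictDerivAt_id c).const_mul b)).congr_deriv ?_
    simp; ring
  constructor
  · intro h
    refine ((hd (-(μ / 2)) (-C) p.1).congr_of_eventuallyEq
      (Eventually.of_forall fun s => ?_)).congr_deriv ?_
    · simp [ham]; ring
    · rw [show p = (p.1, 0) from Prod.ext rfl h, hF]; simp; ring
  · intro h
    refine ((hd (-(δ / 2)) B p.2).congr_of_eventuallyEq
      (Eventually.of_forall fun s => ?_)).congr_deriv ?_
    · simp [ham]
    · rw [show p = (0, p.2) from Prod.ext h rfl, hF]; simp only; ring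

theorem ham_locally_injective
    (hF : ∀ x y, F (x, y) = (-A * x - δ * y + B, μ * x + A * y + C)) {q : ℝ × ℝ} (hq : OnAxis q)
    (hne : nu q (F q) ≠ 0) : ∃ W ∈ 𝓝 q, ∀ w ∈ W, ∀ w' ∈ W, nu q w = 0 → nu q w' = 0 →
      ham A δ μ B C w = ham A δ μ B C w' → w = w' := by
  obtain ⟨h1, h2⟩ := ham_axis_deriv hF (p := q)
  refine hq.exists_nhds_injective (fun h => ⟨_, ?_, h1 h⟩) (fun h => ⟨_, ?_, h2 h⟩)
  · rw [nu_of_snd_eq_zero h] at hne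
    exact neg_ne_zero.2 hne
  · rw [nu_of_snd_pos (hq.resolve_left fun h' => h'.1.ne' h).2] at hne
    exact hne

end Saddle

theorem det_ne_zero (e : (ℝ × ℝ) ≃ᵃ[ℝ] (ℝ × ℝ)) :
    (e.linear (1, 0)).1 * (e.linear (0, 1)).2 - (e.linear (1, 0)).2 * (e.linear (0, 1)).1 ≠ 0 := by
  intro h
  have hlin : ∀ a b : ℝ, e.linear (a, b) = a • e.linear (1, 0) + b • e.linear (0, 1) := by
    intro a b
    rw [← map_smul, ← map_smul, ← map_add]
    simp
  have hinj : ∀ a b : ℝ, e.linear (a, b) = 0 → a = 0 ∧ b = 0 := fun a b h => by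
    rw [LinearEquiv.map_eq_zero_iff] at h
    exact Prod.mk_eq_zero.1 h
  obtain ⟨h1, h2⟩ := hinj (e.linear (0, 1)).2 (-(e.linear (1, 0)).2) (by
    rw [hlin]
    ext
    · simp; linarith
    · simp; ring)
  obtain ⟨h3, h4⟩ := hinj (e.linear (0, 1)).1 (-(e.linear (1, 0)).1) (by
    rw [hlin]
    ext
    · simp; ring
    · simp; linarith)
  have := (hinj 0 1 (Prod.ext h3 h1)).2
  exact one_ne_zero this

namespace RatIntegral

variable {Q : ℝ × ℝ → ℝ × ℝ} {m k : ℕ} (I : RatIntegral Q m k)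
  {G : ℝ × ℝ → ℝ × ℝ} {e : (ℝ × ℝ) ≃ᵃ[ℝ] (ℝ × ℝ)}

/-- Determinants are multiplied by that of `e.linear`, so transversality of `Q` to the image of a
half-axis amounts to a nonzero normal component of `G`. -/
theorem wedge (he : ∀ z, e.linear (G z) = Q (e z)) (z : ℝ × ℝ) :
    (e.linear (1, 0)).1 * (Q (e z)).2 - (e.linear (1, 0)).2 * (Q (e z)).1 = (G z).2 *
      ((e.linear (1, 0)).1 * (e.linear (0, 1)).2 - (e.linear (1, 0)).2 * (e.linear (0, 1)).1) ∧
    (e.linear (0, 1)).1 * (Q (e z)).2 - (e.linear (0, 1)).2 * (Q (e z)).1 = -(G z).1 *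
      ((e.linear (1, 0)).1 * (e.linear (0, 1)).2 - (e.linear (1, 0)).2 * (e.linear (0, 1)).1) := by
  have hlin : e.linear (G z) = (G z).1 • e.linear (1, 0) + (G z).2 • e.linear (0, 1) := by
    rw [← map_smul, ← map_smul, ← map_add]
    simp
  rw [← he, hlin]
  constructor <;> simp <;> ring

theorem Signed.axis_deriv (S : I.Signed) (he : ∀ z, e.linear (G z) = Q (e z)) {p : ℝ × ℝ}
    (hl : I.l (e p) ≠ 0) :
    (p.2 = 0 → HasStrictDerivAt (fun s => S.J (e (s, 0))) (S.τ (e p) * ((G p).2 *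
      ((e.linear (1, 0)).1 * (e.linear (0, 1)).2 -
        (e.linear (1, 0)).2 * (e.linear (0, 1)).1))) p.1) ∧
    (p.1 = 0 → HasStrictDerivAt (fun s => S.J (e (0, s))) (S.τ (e p) * (-(G p).1 *
      ((e.linear (1, 0)).1 * (e.linear (0, 1)).2 -
        (e.linear (1, 0)).2 * (e.linear (0, 1)).1))) p.2) := by
  have hw := wedge he p
  rw [← hw.1, ← hw.2]
  constructor
  · intro h
    have he' : ∀ s : ℝ, e (s, 0) = e 0 + s • e.linear (1, 0) := fun s => by
      rw [affine_apply]; simp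
    have hpp : e p = e 0 + p.1 • e.linear (1, 0) := by
      rw [← he', ← show p = (p.1, 0) from Prod.ext rfl h]
    simp only [he']
    rw [hpp] at hl ⊢
    exact S.hasStrictDerivAt _ _ _ hl
  · intro h
    have he' : ∀ s : ℝ, e (0, s) = e 0 + s • e.linear (0, 1) := fun s => by
      rw [affine_apply]; simp
    have hpp : e p = e 0 + p.2 • e.linear (0, 1) := by
      rw [← he', ← show p = (0, p.2) from Prod.ext h rfl]
    simp only [he']
    rw [hpp] at hl ⊢
    exact S.hasStrictDerivAt _ _ _ hl

theorem Signed.locally_injective (S : I.Signed) (he : ∀ z, e.linear (G z) = Q (e z)) {p : ℝ × ℝ}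
    (hp : OnAxis p) (hne : nu p (G p) ≠ 0) (hl : I.l (e p) ≠ 0) :
    ∃ W ∈ 𝓝 p, ∀ w ∈ W, ∀ w' ∈ W, nu p w = 0 → nu p w' = 0 →
      S.J (e w) = S.J (e w') → w = w' := by
  have hτ : S.τ (e p) ≠ 0 := fun h => by
    have := S.τ_mul_pos (e p) (e p) (mul_self_pos.2 hl)
    simp [h] at this
  obtain ⟨h1, h2⟩ := S.axis_deriv I he hl
  refine hp.exists_nhds_injective (H := fun w => S.J (e w)) (fun h => ⟨_, ?_, h1 h⟩)
    (fun h => ⟨_, ?_, h2 h⟩)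
  · rw [nu_of_snd_eq_zero h] at hne
    exact mul_ne_zero hτ (mul_ne_zero hne (det_ne_zero e))
  · rw [nu_of_snd_pos (hp.resolve_left fun h' => h'.1.ne' h).2] at hne
    exact mul_ne_zero hτ (mul_ne_zero (neg_ne_zero.2 hne) (det_ne_zero e))

/-- Near a crossing point, the Hamiltonian of the saddle and the first integral of the center
vary along the half-axis in a way that depends on the orientation of `e` only. -/
theorem Signed.crossing_sign (S : I.Signed) (he : ∀ z, e.linear (G z) = Q (e z))
    {F : ℝ × ℝ → ℝ × ℝ} {A δ μ B C : ℝ}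
    (hF : ∀ x y, F (x, y) = (-A * x - δ * y + B, μ * x + A * y + C)) {p : ℝ × ℝ}
    (hp : IsCrossingPoint F G p) (hl : I.l (e p) ≠ 0) :
    ∀ᶠ w in 𝓝 p, nu p w = 0 → w ≠ p →
      S.τ (e p) * ((e.linear (1, 0)).1 * (e.linear (0, 1)).2 -
        (e.linear (1, 0)).2 * (e.linear (0, 1)).1) *
        (S.J (e w) - S.J (e p)) * (ham A δ μ B C w - ham A δ μ B C p) < 0 := by
  have hτ : S.τ (e p) ≠ 0 := fun h => by
    have := S.τ_mul_pos (e p) (e p) (mul_self_pos.2 hl)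
    simp [h] at this
  obtain ⟨h1, h2⟩ := S.axis_deriv I he hl
  obtain ⟨hh1, hh2⟩ := ham_axis_deriv hF (p := p)
  have hdet := det_ne_zero e
  set Δ := (e.linear (1, 0)).1 * (e.linear (0, 1)).2 - (e.linear (1, 0)).2 * (e.linear (0, 1)).1
  -- Here `c` and `d` are the normal components of `G` and `F` (both negated on the `y`-axis), `x`
  -- is the displacement, and `a`, `b` are the increments of `J` and `ham`. Since `c * d > 0`, the
  -- sign of the displacement cancels.
  have key : ∀ {t c d a b x : ℝ}, 0 < c * d → 0 < t * (c * Δ) * x * a → 0 < -d * x * b →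
      t * Δ * a * b < 0 := by
    intro t c d a b x hcd h1 h2
    have h3 := mul_pos h1 h2
    have : t * (c * Δ) * x * a * (-d * x * b) = -(t * Δ * a * b) * ((c * d) * x ^ 2) := by ring
    rw [this] at h3
    have h4 : 0 ≤ (c * d) * x ^ 2 := by positivity
    by_contra! h5
    nlinarith
  rcases hp with ⟨hx, hy, hFG⟩ | ⟨hx, hy, hFG⟩
  · have hF0 := right_ne_zero_of_mul hFG.ne'
    have hG0 := left_ne_zero_of_mul hFG.ne'
    have e1 := continuous_fst.continuousAt.eventually (eventually_slope (h1 hy).hasDerivAt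
      (mul_ne_zero hτ (mul_ne_zero hF0 hdet)))
    have e2 := continuous_fst.continuousAt.eventually (eventually_slope (hh1 hy).hasDerivAt
      (neg_ne_zero.2 hG0))
    filter_upwards [e1, e2] with w w1 w2 hw hne
    rw [nu_of_snd_eq_zero hy] at hw
    have hne' : w.1 ≠ p.1 := fun h => hne (Prod.ext h (hw.trans hy.symm))
    replace w1 := w1 hne'
    replace w2 := w2 hne'
    rw [← show w = (w.1, 0) from Prod.ext rfl hw, ← show p = (p.1, 0) from Prod.ext rfl hy]
      at w1 w2
    exact key (by linarith) w1 w2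
  · have hF0 := right_ne_zero_of_mul hFG.ne'
    have hG0 := left_ne_zero_of_mul hFG.ne'
    have e1 := continuous_snd.continuousAt.eventually (eventually_slope (h2 hx).hasDerivAt
      (mul_ne_zero hτ (mul_ne_zero (neg_ne_zero.2 hF0) hdet)))
    have e2 := continuous_snd.continuousAt.eventually (eventually_slope (hh2 hx).hasDerivAt hG0)
    filter_upwards [e1, e2] with w w1 w2 hw hne
    rw [nu_of_snd_pos hy] at hw
    have hne' : w.2 ≠ p.2 := fun h => hne (Prod.ext (hw.trans hx.symm) h)
    replace w1 := w1 hne'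
    replace w2 := w2 hne'
    rw [← show w = (0, w.2) from Prod.ext hw rfl, ← show p = (0, p.2) from Prod.ext hx rfl]
      at w1 w2
    refine key (c := -(G p).1) (d := -(F p).1) (by linarith) w1 ?_
    rwa [neg_neg]

theorem continuous_l : Continuous fun z => I.l (e z) := by
  have : (fun z => I.l (e z)) = fun z => I.l₀ + I.l₁ *
      (e 0 + z.1 • e.linear (1, 0) + z.2 • e.linear (0, 1)).2 := by
    funext z
    simp only [l]
    rw [affine_apply e z]
  rw [this]
  fun_prop

/-- `J` has a derivative along the half-axis at `p`, so it is continuous there and a nonzero value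
keeps its sign nearby. -/
theorem Signed.near (S : I.Signed) (he : ∀ z, e.linear (G z) = Q (e z)) {p : ℝ × ℝ}
    (hp : OnAxis p) (hl : I.l (e p) ≠ 0) :
    ∀ᶠ w in 𝓝 p, nu p w = 0 → S.J (e p) ≠ 0 → 0 < S.J (e p) * S.J (e w) := by
  by_cases h0 : S.J (e p) = 0
  · exact Eventually.of_forall fun w _ h => absurd h0 h
  obtain ⟨h1, h2⟩ := S.axis_deriv I he hl
  rcases hp with ⟨hx, hy⟩ | ⟨hx, hy⟩
  · have hc := ((h1 hy).hasDerivAt.continuousAt.const_mul (S.J (e p))).eventually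
      (lt_mem_nhds (a := 0) (by
        simp only [← show p = (p.1, 0) from Prod.ext rfl hy]
        exact mul_self_pos.2 h0))
    filter_upwards [continuous_fst.continuousAt.eventually hc] with w hw hn _
    rw [nu_of_snd_eq_zero hy] at hn
    rwa [← show w = (w.1, 0) from Prod.ext rfl hn] at hw
  · have hc := ((h2 hx).hasDerivAt.continuousAt.const_mul (S.J (e p))).eventually
      (lt_mem_nhds (a := 0) (by
        simp only [← show p = (0, p.2) from Prod.ext hx rfl]
        exact mul_self_pos.2 h0))
    filter_upwards [continuous_snd.continuousAt.eventually hc] with w hw hn _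
    rw [nu_of_snd_pos hy] at hn
    rwa [← show w = (0, w.2) from Prod.ext hn rfl] at hw

/-- Passes from geometric to algebraic isolation. Equal `N / D` means `J` equal or opposite at the
two points; the first case is covered by persistence of arcs, the second must be excluded. -/
theorem Signed.isolated (S : I.Signed) {F : ℝ × ℝ → ℝ × ℝ} {A δ μ B C : ℝ}
    (hF : ∀ x y, F (x, y) = (-A * x - δ * y + B, μ * x + A * y + C))
    (he : ∀ z, e.linear (G z) = Q (e z)) {p q : ℝ × ℝ} {Γ : Set (ℝ × ℝ)}
    (h : IsCycle F G p q Γ) (hiso : IsCrossingLimitCycle F G Γ) (hlq : I.l (e q) ≠ 0) :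
    ∀ᶠ w in 𝓝 (p, q), nu p w.1 = 0 → nu q w.2 = 0 →
      ham A δ μ B C w.1 = ham A δ μ B C w.2 →
      I.N (e w.1) * I.D (e w.2) = I.N (e w.2) * I.D (e w.1) → w = (p, q) := by
  obtain ⟨-, U, hU, hΓU, hiso⟩ := hiso
  obtain ⟨s1, s2, s3, s4⟩ := h.nu_signs
  have hpA := (isCrossingPoint_iff.1 h.2.1).1
  have hqA := (isCrossingPoint_iff.1 h.2.2.1).1
  have hJ : ∀ {u v : ℝ × ℝ} {b : Set (ℝ × ℝ)}, IsOrbitArc G SigmaMinus u v b →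
      S.J (e v) = S.J (e u) := by
    rintro _ _ _ ⟨T, γ, hT, hs, rfl, rfl, -, -⟩
    exact S.conserved hT.le (γ := fun t => e (γ t)) fun t ht => hasDerivWithinAt_affine he (hs t ht)
  obtain ⟨a, b, ha, hb, -⟩ := h.2.2.2
  obtain ⟨⟨E, hE, hlE⟩, -⟩ := I.arc_conserved he hb
  have hlpq : 0 < I.l (e p) * I.l (e q) := by
    rw [hlE, mul_right_comm]
    exact mul_pos (mul_self_pos.2 hlq) hE
  have hlp : I.l (e p) ≠ 0 := left_ne_zero_of_mul hlpq.ne'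
  have hJpq := hJ hb
  have hhpq := ham_conserved hF ha
  obtain ⟨W₁, hW₁, inj₁⟩ := ham_locally_injective hF hqA s3.ne
  obtain ⟨W₂, hW₂, inj₂⟩ := S.locally_injective I he hpA s2.ne' hlp
  have main := h.eventually_eq (contDiff_saddle hF) (contDiff_affineCopy I.contDiff he) hU hΓU hiso
    (r := fun u v => ham A δ μ B C u = ham A δ μ B C v)
    (s := fun u v => S.J (e v) = S.J (e u))
    (fun u v a ha => ham_conserved hF ha) (fun u v b hb => hJ hb)
    ⟨W₁, hW₁, univ, univ_mem, fun w hw w' hw' z _ e1 e2 _ r1 r2 =>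
      inj₁ w hw w' hw' e1 e2 (r1.symm.trans r2)⟩
    ⟨W₂, hW₂, univ, univ_mem, fun w hw w' hw' z _ e1 e2 _ r1 r2 =>
      inj₂ w hw w' hw' e1 e2 (r1.trans r2.symm)⟩
  have hsgn : ∀ᶠ w in 𝓝 (p, q), 0 < I.l (e w.1) * I.l (e w.2) :=
    ((I.continuous_l.comp continuous_fst).mul
      (I.continuous_l.comp continuous_snd)).continuousAt.eventually (lt_mem_nhds hlpq)
  have hc₁ : Tendsto Prod.fst (𝓝 (p, q)) (𝓝 p) := continuous_fst.continuousAt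
  have hc₂ : Tendsto Prod.snd (𝓝 (p, q)) (𝓝 q) := continuous_snd.continuousAt
  filter_upwards [main, hsgn, hc₁.eventually (S.crossing_sign I he hF h.2.1 hlp),
    hc₂.eventually (S.crossing_sign I he hF h.2.2.1 hlq), hc₁.eventually (S.near I he hpA hlp),
    hc₂.eventually (S.near I he hqA hlq), hc₂.eventually hW₁, hc₁.eventually hW₂]
    with w hmain hl c₁ c₂ n₁ n₂ m₁ m₂ hw₁ hw₂ hham hN
  rcases S.eq_or_eq_neg _ _ hl hN with hEq | hEq
  · exact hmain hw₁ hw₂ hham hEq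
  replace n₁ := n₁ hw₁
  replace n₂ := n₂ hw₂
  -- `J` has one common value at `p` and `q`; if it is nonzero, nearby values at both points share
  -- its sign and cannot be opposite.
  have hJ0 : S.J (e p) = 0 := by
    by_contra hne
    rw [← hJpq] at n₂
    replace n₁ := n₁ hne
    replace n₂ := n₂ hne
    rw [hEq] at n₁
    nlinarith
  -- If one of the two points has not moved, local injectivity of `ham` or of `J` fixes the other.
  by_cases hp : w.1 = p
  · exact Prod.ext hp (inj₁ _ m₁ _ (mem_of_mem_nhds hW₁) hw₂ hqA.nu_self (by
      rw [← hham, ← hhpq, hp]))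
  by_cases hq : w.2 = q
  · exact Prod.ext (inj₂ _ m₂ _ (mem_of_mem_nhds hW₂) hw₁ hpA.nu_self (by
      rw [hEq, hq, ← hJpq, hJ0, neg_zero])) hq
  -- With both points moved, the increments of `ham` at `p` and `q` agree while those of `J` are
  -- opposite. But the sign relating them depends on the determinant of `e.linear` and the sign of
  -- `τ`, which are the same at both points.
  have c₁ := c₁ hw₁ hp
  have c₂ := c₂ hw₂ hq
  rw [← hJpq, hJ0, ← hhpq, ← hham] at c₂
  rw [hJ0, hEq] at c₁
  set Δ := (e.linear (1, 0)).1 * (e.linear (0, 1)).2 - (e.linear (1, 0)).2 * (e.linear (0, 1)).1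
  have hτ := S.τ_mul_pos _ _ hlpq
  have := mul_pos_of_neg_of_neg c₁ c₂
  have h3 : S.τ (e p) * Δ * (-S.J (e w.2) - 0) * (ham A δ μ B C w.1 - ham A δ μ B C p) *
      (S.τ (e q) * Δ * (S.J (e w.2) - 0) * (ham A δ μ B C w.1 - ham A δ μ B C p)) =
      -(S.τ (e p) * S.τ (e q) * (Δ * S.J (e w.2) *
        (ham A δ μ B C w.1 - ham A δ μ B C p)) ^ 2) := by ring
  rw [h3] at this
  have : 0 ≤ S.τ (e p) * S.τ (e q) * (Δ * S.J (e w.2) *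
        (ham A δ μ B C w.1 - ham A δ μ B C p)) ^ 2 := by positivity
  linarith

/-- The orientations of a corner cycle. -/
theorem _root_.CornerPWS.exists_isCycle_of_corner {F : ℝ × ℝ → ℝ × ℝ} {Γ : Set (ℝ × ℝ)}
    (hΓ : IsCrossingPeriodicOrbit F G Γ) (hx : ∃ x : ℝ, 0 < x ∧ (x, 0) ∈ Γ)
    (hy : ∃ y : ℝ, 0 < y ∧ (0, y) ∈ Γ) : ∃ x y : ℝ, 0 < x ∧ 0 < y ∧
      (IsCycle F G (x, 0) (0, y) Γ ∨ IsCycle F G (0, y) (x, 0) Γ) := by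
  obtain ⟨p, q, h⟩ := isCrossingPeriodicOrbit_iff.1 hΓ
  obtain ⟨x, hx, hxΓ⟩ := hx
  obtain ⟨y, hy, hyΓ⟩ := hy
  refine ⟨x, y, hx, hy, ?_⟩
  have h1 : ((x, 0) : ℝ × ℝ) ∈ ({p, q} : Set (ℝ × ℝ)) :=
    h.inter_Sigma ▸ ⟨hxΓ, (mem_Sigma_iff _).2 (Or.inl ⟨hx.le, rfl⟩)⟩
  have h2 : ((0, y) : ℝ × ℝ) ∈ ({p, q} : Set (ℝ × ℝ)) :=
    h.inter_Sigma ▸ ⟨hyΓ, (mem_Sigma_iff _).2 (Or.inr ⟨rfl, hy.le⟩)⟩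
  have hne : ((x, 0) : ℝ × ℝ) ≠ (0, y) := fun h => hx.ne' (congrArg Prod.fst h)
  rcases h1 with h1 | h1 <;> rcases h2 with h2 | h2
  · exact absurd (h1.trans h2.symm) hne
  · rw [mem_singleton_iff] at h2
    subst h1 h2
    exact Or.inl h
  · rw [mem_singleton_iff] at h1
    subst h1 h2
    exact Or.inr h
  · exact absurd ((mem_singleton_iff.1 h1).trans (mem_singleton_iff.1 h2).symm) hne

/-- The upper bound for the number of corner limit cycles. -/
theorem Signed.encard_cornerLimitCycles_le {I : RatIntegral Q m k} (J : I.Signed)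
    {F : ℝ × ℝ → ℝ × ℝ} (hF : IsLinearHamiltonianSaddle F)
    (hG : IsAffineCopy Q G) : (cornerLimitCycles F G).encard + 1 ≤ (2 * (m + k) : ℕ) := by
  obtain ⟨A, δ, μ, B, C, -, hF⟩ := hF
  obtain ⟨e, he⟩ := hG
  have hk := I.one_le
  rcases (cornerLimitCycles F G).eq_empty_or_nonempty with hemp | ⟨Γ₀, hΓ₀⟩
  · rw [hemp]
    simp only [encard_empty, zero_add]
    exact_mod_cast (by omega : 1 ≤ 2 * (m + k))
  obtain ⟨n₁, d₁, hn₁, hd₁, hn₁e, hd₁e, -⟩ := I.exists_poly (e 0) (e.linear (1, 0))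
  obtain ⟨n₂, d₂, hn₂, hd₂, hn₂e, hd₂e, -⟩ := I.exists_poly (e 0) (e.linear (0, 1))
  have hx : ∀ s : ℝ, e (s, 0) = e 0 + s • e.linear (1, 0) := fun s => by
    rw [affine_apply]; simp
  have hy : ∀ s : ℝ, e (0, s) = e 0 + s • e.linear (0, 1) := fun s => by
    rw [affine_apply]; simp
  have hn₁N : ∀ s, n₁.eval s = I.N (e (s, 0)) := fun s => by rw [hn₁e, hx]
  have hn₂N : ∀ s, n₂.eval s = I.N (e (0, s)) := fun s => by rw [hn₂e, hy]
  have hd₁D : ∀ s, d₁.eval s = I.D (e (s, 0)) := fun s => by rw [hd₁e, hx]; rfl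
  have hd₂D : ∀ s, d₂.eval s = I.D (e (0, s)) := fun s => by rw [hd₂e, hy]; rfl
  have hham : ∀ x y : ℝ, ham A δ μ B C (x, 0) = ham A δ μ B C (0, y) ↔
      μ / 2 * x ^ 2 + C * x = δ / 2 * y ^ 2 + -B * y := fun x y => by
    simp only [ham]
    constructor <;> intro h <;> ring_nf at h ⊢ <;> linarith
  set S := IsolatedMeets n₁ d₁ n₂ d₂ (μ / 2) C (δ / 2) (-B)
  have hnu1 : ∀ x : ℝ, 0 < x → ∀ s : ℝ, nu (x, 0) (s, 0) = 0 := fun x hx s =>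
    nu_of_snd_eq_zero rfl _
  have hnu2 : ∀ y : ℝ, 0 < y → ∀ s : ℝ, nu (0, y) (0, s) = 0 := fun y hy s =>
    nu_of_snd_pos hy _
  have hex : ∀ Γ ∈ cornerLimitCycles F G, ∃ z ∈ S,
      IsCycle F G (z.1, 0) (0, z.2) Γ ∨ IsCycle F G (0, z.2) (z.1, 0) Γ := by
    rintro Γ ⟨hΓ, hΓx, hΓy⟩
    obtain ⟨x, y, hx0, hy0, h⟩ := exists_isCycle_of_corner hΓ.1 hΓx hΓy
    refine ⟨(x, y), ⟨hx0, hy0, ?_⟩, h⟩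
    rcases h with h | h
    · have hh := h
      obtain ⟨-, hp, hq, a, b, ha, hb, -⟩ := hh
      have hlq := I.l_ne_zero he hb hx0 hy0 (Or.inr ⟨rfl, rfl⟩)
      obtain ⟨⟨E, hE, hlE⟩, hND, -⟩ := I.arc_conserved he hb
      have hlp : I.l (e (x, 0)) ≠ 0 := hlE ▸ mul_ne_zero hlq hE.ne'
      refine ⟨⟨(hham x y).1 (ham_conserved hF ha), ?_⟩, ?_⟩
      · simp only [hn₁N, hn₂N, hd₁D, hd₂D]; exact hND
      · have hc : Tendsto (fun w : ℝ × ℝ => (((w.1, 0) : ℝ × ℝ), ((0, w.2) : ℝ × ℝ)))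
            (𝓝 (x, y)) (𝓝 ((x, 0), (0, y))) := by
          refine Continuous.tendsto (f := fun w : ℝ × ℝ =>
            (((w.1, 0) : ℝ × ℝ), ((0, w.2) : ℝ × ℝ))) ?_ (x, y)
          fun_prop
        filter_upwards [hc.eventually (J.isolated I hF he h hΓ hlq)] with w hw hm
        have := hw (hnu1 x hx0 _) (hnu2 y hy0 _) ((hham _ _).2 hm.1) (by
          have := hm.2
          simp only [hn₁N, hn₂N, hd₁D, hd₂D] at this
          exact this)
        simp only [Prod.mk.injEq, and_true, true_and] at this
        exact Prod.ext this.1 this.2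
    · have hh := h
      obtain ⟨-, hp, hq, a, b, ha, hb, -⟩ := hh
      have hlq := I.l_ne_zero he hb hx0 hy0 (Or.inl ⟨rfl, rfl⟩)
      obtain ⟨⟨E, hE, hlE⟩, hND, -⟩ := I.arc_conserved he hb
      have hlp : I.l (e (0, y)) ≠ 0 := hlE ▸ mul_ne_zero hlq hE.ne'
      refine ⟨⟨(hham x y).1 (ham_conserved hF ha).symm, ?_⟩, ?_⟩
      · simp only [hn₁N, hn₂N, hd₁D, hd₂D]; exact hND.symm
      · have hc : Tendsto (fun w : ℝ × ℝ => (((0, w.2) : ℝ × ℝ), ((w.1, 0) : ℝ × ℝ)))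
            (𝓝 (x, y)) (𝓝 ((0, y), (x, 0))) := by
          refine Continuous.tendsto (f := fun w : ℝ × ℝ =>
            (((0, w.2) : ℝ × ℝ), ((w.1, 0) : ℝ × ℝ))) ?_ (x, y)
          fun_prop
        filter_upwards [hc.eventually (J.isolated I hF he h hΓ hlq)] with w hw hm
        have := hw (hnu2 y hy0 _) (hnu1 x hx0 _) ((hham _ _).2 hm.1).symm (by
          have := hm.2
          simp only [hn₁N, hn₂N, hd₁D, hd₂D] at this
          exact this.symm)
        simp only [Prod.mk.injEq, and_true, true_and] at this
        exact Prod.ext this.2 this.1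
  have hcF := contDiff_saddle hF
  have hcG := contDiff_affineCopy I.contDiff he
  choose! f hfS hf using hex
  have hinj : InjOn f (cornerLimitCycles F G) := by
    intro Γ hΓ Γ' hΓ' hff
    have h1 := hf Γ hΓ
    have h2 := hf Γ' hΓ'
    rw [← hff] at h2
    rcases h1 with h1 | h1 <;> rcases h2 with h2 | h2
    · exact h1.eq hcF hcG h2
    · exact absurd h2 h1.not_swap
    · exact absurd h2 h1.not_swap
    · exact h1.eq hcF hcG h2
  have hle := encard_le_encard_of_injOn (fun Γ hΓ => hfS Γ hΓ) hinj
  -- The conic equation is not void: with `μ = C = 0` the normal component of the saddle vanishes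
  -- along the `x`-axis, which then has no crossing point.
  have hne : μ / 2 ≠ 0 ∨ C ≠ 0 ∨ δ / 2 ≠ 0 ∨ -B ≠ 0 := by
    by_contra! hall
    obtain ⟨h1, h2, h3, h4⟩ := hall
    have key : ∀ z : ℝ × ℝ, IsCrossingPoint F G z → z.2 = 0 → False := fun z hz hz0 => by
      have := (isCrossingPoint_iff.1 hz).2
      rw [nu_of_snd_eq_zero hz0, show z = (z.1, 0) from Prod.ext rfl hz0, hF] at this
      simp [h2, show μ = 0 by linarith] at this
    rcases hf Γ₀ hΓ₀ with h | h
    · exact key _ h.2.1 rfl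
    · exact key _ h.2.2.1 rfl
  calc (cornerLimitCycles F G).encard + 1 ≤ S.encard + 1 := by gcongr
    _ ≤ (2 * (m + k) : ℕ) := encard_isolatedMeets_le (by omega) hn₁ hn₂ hd₁ hd₂
        (by rw [hn₁e, hn₂e]; simp) (by rw [hd₁e, hd₂e]; simp) hne

end RatIntegral

namespace RatIntegral

variable {Q : ℝ × ℝ → ℝ × ℝ} {m k : ℕ}

/-- If the density `ρ` has no zeros off the invariant line, the rational first integral itself
has nonzero derivatives. -/
noncomputable def signed (I : RatIntegral Q m k)
    (hρ : ∀ z w, 0 < I.l z * I.l w → 0 < I.ρ z * I.ρ w) : I.Signed where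
  J z := I.N z / I.D z
  τ z := I.ρ z / I.D z ^ 2
  hasStrictDerivAt O V s h := by
    obtain ⟨n, d, -, -, hn, hd, hder⟩ := I.exists_poly O V
    have hd' : ∀ s, d.eval s = I.D (O + s • V) := hd
    have hd0 : d.eval s ≠ 0 := by rw [hd']; exact pow_ne_zero _ h
    refine (((n.hasStrictDerivAt s).div (d.hasStrictDerivAt s) hd0).congr_of_eventuallyEq
      (Eventually.of_forall fun s => ?_)).congr_deriv ?_
    · simp only [Pi.div_apply, hn, hd']
    · rw [mul_comm (n.derivative.eval s), hder s, hd' s]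
      ring
  τ_mul_pos z w h := by
    have h1 : I.D z ≠ 0 := pow_ne_zero _ (left_ne_zero_of_mul h.ne')
    have h2 : I.D w ≠ 0 := pow_ne_zero _ (right_ne_zero_of_mul h.ne')
    rw [div_mul_div_comm]
    exact div_pos (hρ z w h) (by positivity)
  conserved {T γ} hT hγ := by
    obtain ⟨E, hE, h⟩ := I.exists_scale hT hγ
    obtain ⟨h1, h2⟩ := h T (right_mem_Icc.2 hT)
    by_cases h0 : I.l (γ 0) = 0
    · have hk := I.one_le
      have h3 : I.l (γ T) = 0 := by rw [h1, h0, zero_mul]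
      simp [D, h0, h3, show k ≠ 0 by omega]
    · have h3 : I.l (γ T) ≠ 0 := by rw [h1]; exact mul_ne_zero h0 (hE T).ne'
      rw [div_eq_div_iff (show I.D (γ T) ≠ 0 from pow_ne_zero _ h3)
        (show I.D (γ 0) ≠ 0 from pow_ne_zero _ h0), h2]
  eq_or_eq_neg z w h hN := by
    left
    rwa [div_eq_div_iff (show I.D z ≠ 0 from pow_ne_zero _ (left_ne_zero_of_mul h.ne'))
      (show I.D w ≠ 0 from pow_ne_zero _ (right_ne_zero_of_mul h.ne'))]

end RatIntegral

/-! ### First integrals of the four centers -/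

open Polynomial in
/-- The first integral of `Q1`. -/
noncomputable def integralQ1 : RatIntegral Q1 2 1 where
  N z := z.1 ^ 2 + z.2 ^ 2
  κ z := 2 * z.1
  ρ _ := 2
  l₀ := 1
  l₁ := 2
  l₁_ne := by norm_num
  one_le := le_rfl
  continuous_κ := by fun_prop
  cofactor z := by simp only [Q1]; ring
  deriv_N {γ s t} h := by
    refine (((hasDerivWithinAt_fst h).pow 2).add ((hasDerivWithinAt_snd h).pow 2)).congr_deriv ?_
    simp only [Q1]; push_cast; ring
  exists_poly O V := by
    refine ⟨(C O.1 + C V.1 * X) ^ 2 + (C O.2 + C V.2 * X) ^ 2, 1 + 2 * (C O.2 + C V.2 * X),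
      by compute_degree, by compute_degree, fun x => ?_, fun x => ?_, fun x => ?_⟩
    · simp; ring
    · simp; ring
    · simp [Q1, derivative_pow]; ring
  ρ_pos _ _ := by norm_num
  contDiff := by unfold Q1; fun_prop

open Polynomial in
/-- The first integral of `Q2`. -/
noncomputable def integralQ2 : RatIntegral Q2 2 2 where
  N z := z.1 ^ 2 + z.2 ^ 2
  κ z := z.1
  ρ z := 2 * (1 + z.2)
  l₀ := 1
  l₁ := 1
  l₁_ne := by norm_num
  one_le := by norm_num
  continuous_κ := by fun_prop
  cofactor z := by simp only [Q2]; ring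
  deriv_N {γ s t} h := by
    refine (((hasDerivWithinAt_fst h).pow 2).add ((hasDerivWithinAt_snd h).pow 2)).congr_deriv ?_
    simp only [Q2]; push_cast; ring
  exists_poly O V := by
    refine ⟨(C O.1 + C V.1 * X) ^ 2 + (C O.2 + C V.2 * X) ^ 2, (1 + (C O.2 + C V.2 * X)) ^ 2,
      by compute_degree, by compute_degree, fun x => ?_, fun x => ?_, fun x => ?_⟩
    · simp; ring
    · simp; ring
    · simp [Q2, derivative_pow]; ring
  ρ_pos z h := by linarith
  contDiff := by unfold Q2; fun_prop

open Polynomial in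
/-- The first integral of `Q3`. -/
noncomputable def integralQ3 : RatIntegral Q3 4 1 where
  N z := (4 * z.1 ^ 2 - 3 * z.2) ^ 2 + 9 * z.1 ^ 2
  κ z := -(16 / 3) * z.1
  ρ z := 6 * (32 * z.1 ^ 2 - 24 * z.2 + 9)
  l₀ := 3
  l₁ := -16
  l₁_ne := by norm_num
  one_le := le_rfl
  continuous_κ := by fun_prop
  cofactor z := by simp only [Q3]; ring
  deriv_N {γ s t} h := by
    have hx := hasDerivWithinAt_fst h
    have hy := hasDerivWithinAt_snd h
    refine (((((hx.pow 2).const_mul 4).sub (hy.const_mul 3)).pow 2).add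
      ((hx.pow 2).const_mul 9)).congr_deriv ?_
    simp only [Q3, Pi.sub_apply, Pi.pow_apply]; push_cast; ring
  exists_poly O V := by
    refine ⟨(4 * (C O.1 + C V.1 * X) ^ 2 - 3 * (C O.2 + C V.2 * X)) ^ 2 +
      9 * (C O.1 + C V.1 * X) ^ 2, 3 - 16 * (C O.2 + C V.2 * X),
      by compute_degree, by compute_degree, fun x => ?_, fun x => ?_, fun x => ?_⟩
    · simp; ring
    · simp; ring
    · simp [Q3, derivative_pow]; ring
  -- The factor `32 x ^ 2 - 24 y + 9` is the sum of `32 x ^ 2`, `3 / 2 * (3 - 16 y)` and `9 / 2`; it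
  -- can vanish only beyond the invariant line.
  ρ_pos z h := by nlinarith [sq_nonneg z.1]
  contDiff := by unfold Q3; fun_prop

open Polynomial in
/-- The first integral of `Q4`. -/
noncomputable def integralQ4 : RatIntegral Q4 2 4 where
  -- This is `9 x ^ 2 + y ^ 2 (3 + 4 y) ^ 2 - (3 + 8 y) ^ 4 / 256`. Subtracting a multiple of the
  -- denominator cancels the quartic and cubic terms, so that `m = 2`.
  N z := 9 * z.1 ^ 2 - 9 / 2 * z.2 ^ 2 - 27 / 8 * z.2 - 81 / 256
  κ z := 8 / 3 * z.1
  ρ z := 54 * (3 + 8 * z.2) ^ 3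
  l₀ := 3
  l₁ := 8
  l₁_ne := by norm_num
  one_le := by norm_num
  continuous_κ := by fun_prop
  cofactor z := by simp only [Q4]; ring
  deriv_N {γ s t} h := by
    have hx := hasDerivWithinAt_fst h
    have hy := hasDerivWithinAt_snd h
    refine (((((hx.pow 2).const_mul 9).sub ((hy.pow 2).const_mul (9 / 2))).sub
      (hy.const_mul (27 / 8))).sub_const (81 / 256)).congr_deriv ?_
    simp only [Q4]; push_cast; ring
  exists_poly O V := by
    refine ⟨9 * (C O.1 + C V.1 * X) ^ 2 - C (9 / 2) * (C O.2 + C V.2 * X) ^ 2 -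
      C (27 / 8) * (C O.2 + C V.2 * X) - C (81 / 256), (3 + 8 * (C O.2 + C V.2 * X)) ^ 4,
      by compute_degree, by compute_degree, fun x => ?_, fun x => ?_, fun x => ?_⟩
    · simp; ring
    · simp; ring
    · simp [Q4, derivative_pow]; ring
  ρ_pos z h := by positivity
  contDiff := by unfold Q4; fun_prop

noncomputable def signedQ1 : integralQ1.Signed :=
  integralQ1.signed fun _ _ _ => by simp [integralQ1]

noncomputable def signedQ2 : integralQ2.Signed :=
  integralQ2.signed fun z w h => by
    simp only [RatIntegral.l, integralQ2] at h ⊢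
    linarith

noncomputable def signedQ4 : integralQ4.Signed :=
  integralQ4.signed fun z w h => by
    simp only [RatIntegral.l, integralQ4] at h ⊢
    have := pow_pos h 3
    linarith

/-- The level curve `32 x ^ 2 - 24 y + 9 = 0` of the rational first integral of `Q3` is singular,
but that integral is, up to an affine function, the square of the following function. -/
noncomputable def signedQ3 : integralQ3.Signed where
  J z := (32 * z.1 ^ 2 - 24 * z.2 + 9) / √|3 - 16 * z.2|
  τ z := 192 / ((3 - 16 * z.2) * √|3 - 16 * z.2|)
  hasStrictDerivAt O V s h := by
    have h : 3 - 16 * (O + s • V).2 ≠ 0 := by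
      simpa [RatIntegral.l, integralQ3, sub_eq_add_neg] using h
    have hs : √|3 - 16 * (O + s • V).2| ≠ 0 := by
      rw [Real.sqrt_ne_zero']; exact abs_pos.2 h
    have hx : HasStrictDerivAt (fun s : ℝ => (O + s • V).1) V.1 s := by
      simpa using ((hasStrictDerivAt_id s).mul_const V.1).const_add O.1
    have hy : HasStrictDerivAt (fun s : ℝ => (O + s • V).2) V.2 s := by
      simpa using ((hasStrictDerivAt_id s).mul_const V.2).const_add O.2
    have hl : HasStrictDerivAt (fun s : ℝ => 3 - 16 * (O + s • V).2) (-(16 * V.2)) s :=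
      (hy.const_mul 16).const_sub 3
    have hr := ((hasStrictDerivAt_abs h).comp s hl).sqrt
      (by rw [Function.comp_apply]; exact (abs_pos.2 h).ne')
    refine (((((hx.pow 2).const_mul 32).sub (hy.const_mul 24)).add_const 9).div hr
      hs).congr_deriv ?_
    simp only [Q3, Function.comp_apply, Pi.pow_apply, Pi.sub_apply]
    set x := (O + s • V).1
    set y := (O + s • V).2
    have hr2 : √|3 - 16 * y| ^ 2 = |3 - 16 * y| := Real.sq_sqrt (abs_nonneg _)
    rcases h.lt_or_gt with h' | h'
    · rw [abs_of_neg h'] at hs hr2 ⊢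
      rw [sign_neg h']
      set r := √(-(3 - 16 * y))
      have hL : 3 - 16 * y = -r ^ 2 := by linarith
      have hy : y = (r ^ 2 + 3) / 16 := by linarith
      rw [hL, hy]
      simp only [SignType.coe_neg, SignType.coe_one]
      field_simp
      ring
    · rw [abs_of_pos h'] at hs hr2 ⊢
      rw [sign_pos h']
      set r := √(3 - 16 * y)
      have hL : 3 - 16 * y = r ^ 2 := by linarith
      have hy : y = (3 - r ^ 2) / 16 := by linarith
      rw [hL, hy]
      simp only [SignType.coe_one]
      field_simp
      ring
  τ_mul_pos z w h := by
    have h : 0 < (3 - 16 * z.2) * (3 - 16 * w.2) := by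
      simpa [RatIntegral.l, integralQ3, sub_eq_add_neg] using h
    have h1 : 0 < √|3 - 16 * z.2| := Real.sqrt_pos.2 (abs_pos.2 (left_ne_zero_of_mul h.ne'))
    have h2 : 0 < √|3 - 16 * w.2| := Real.sqrt_pos.2 (abs_pos.2 (right_ne_zero_of_mul h.ne'))
    rw [div_mul_div_comm, mul_mul_mul_comm (3 - 16 * z.2)]
    positivity
  conserved {T γ} hT hγ := by
    have hc : ContinuousOn (fun t => integralQ3.κ (γ t) / 2) (Icc 0 T) :=
      (integralQ3.continuous_κ.comp_continuousOn hγ.continuousOn).div_const 2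
    obtain ⟨E, hE, h⟩ := exists_pos_fundamental hT hc
    obtain ⟨E', -, h'⟩ := integralQ3.exists_scale hT hγ
    -- The parabola `32 x ^ 2 - 24 y + 9 = 0` is invariant with half the cofactor of the line.
    have hP := h (fun t => 32 * (γ t).1 ^ 2 - 24 * (γ t).2 + 9) (fun t ht => by
      have hx := hasDerivWithinAt_fst (hγ t ht)
      have hy := hasDerivWithinAt_snd (hγ t ht)
      refine ((((hx.pow 2).const_mul 32).sub (hy.const_mul 24)).add_const 9).congr_deriv ?_
      simp only [Q3, integralQ3]; push_cast; ring) T (right_mem_Icc.2 hT)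
    obtain ⟨h1, h2⟩ := h' T (right_mem_Icc.2 hT)
    simp only [RatIntegral.D, RatIntegral.l, integralQ3, pow_one] at h1 h2
    by_cases h0 : (32 * (γ 0).1 ^ 2 - 24 * (γ 0).2 + 9) = 0
    · rw [hP, h0]; simp
    by_cases hl : 3 + -16 * (γ 0).2 = 0
    · rw [hl, zero_mul] at h1
      simp only [← neg_mul, sub_eq_add_neg, h1, hl]
      simp
    -- Off the parabola, the scaling of `l` by the square of that of the parabola can be read off
    -- the conserved rational integral.
    have key : 3 + -16 * (γ T).2 = (3 + -16 * (γ 0).2) * E T ^ 2 := by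
      have : (32 * (γ 0).1 ^ 2 - 24 * (γ 0).2 + 9) ^ 2 *
          (3 + -16 * (γ T).2 - (3 + -16 * (γ 0).2) * E T ^ 2) = 0 := by
        have h3 : (32 * (γ T).1 ^ 2 - 24 * (γ T).2 + 9) ^ 2 * (3 + -16 * (γ 0).2) =
          (32 * (γ 0).1 ^ 2 - 24 * (γ 0).2 + 9) ^ 2 * (3 + -16 * (γ T).2) := by
          linear_combination 64 * h2
        rw [hP] at h3
        linear_combination -h3
      have := (mul_eq_zero.1 this).resolve_left (pow_ne_zero 2 h0)
      linarith
    simp only [sub_eq_add_neg (3 : ℝ), ← neg_mul] at hP ⊢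
    rw [hP, key, abs_mul, abs_of_nonneg (sq_nonneg (E T)), Real.sqrt_mul (abs_nonneg _),
      Real.sqrt_sq (hE T).le]
    exact mul_div_mul_right _ _ (hE T).ne'
  eq_or_eq_neg z w h hN := by
    simp only [RatIntegral.D, RatIntegral.l, integralQ3, pow_one] at h hN
    have e : ∀ z : ℝ × ℝ, 3 + -16 * z.2 = 3 - 16 * z.2 := fun z => by ring
    simp only [e] at h hN
    have hz : 0 < |3 - 16 * z.2| := abs_pos.2 (left_ne_zero_of_mul h.ne')
    have hw : 0 < |3 - 16 * w.2| := abs_pos.2 (right_ne_zero_of_mul h.ne')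
    have h3 : (32 * z.1 ^ 2 - 24 * z.2 + 9) ^ 2 * (3 - 16 * w.2) =
        (32 * w.1 ^ 2 - 24 * w.2 + 9) ^ 2 * (3 - 16 * z.2) := by
      linear_combination 64 * hN
    rw [← sq_eq_sq_iff_eq_or_eq_neg, div_pow, div_pow, Real.sq_sqrt hz.le, Real.sq_sqrt hw.le,
      div_eq_div_iff hz.ne' hw.ne']
    rcases mul_pos_iff.1 h with ⟨h1, h2⟩ | ⟨h1, h2⟩
    · rwa [abs_of_pos h1, abs_of_pos h2]
    · rw [abs_of_neg h1, abs_of_neg h2]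
      linarith

/-! ### The saddles of the examples -/

/-- The saddles of the examples, whose arcs join `(x, 0)` to `(0, α x ^ 2 + β x)`. -/
noncomputable def saddle (α β : ℝ) (z : ℝ × ℝ) : ℝ × ℝ := (-z.1 - 1, 2 * α * z.1 + z.2 + β)

section Saddle

variable {α β : ℝ}

theorem saddle_apply (x y : ℝ) :
    saddle α β (x, y) = (-1 * x - 0 * y + -1, 2 * α * x + 1 * y + β) := by
  simp only [saddle, Prod.mk.injEq]
  constructor <;> ring

theorem isLinearHamiltonianSaddle_saddle : IsLinearHamiltonianSaddle (saddle α β) :=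
  ⟨1, 0, 2 * α, -1, β, by norm_num, saddle_apply⟩

/-- The first equation decouples and gives `X`; then `Y` is solved from the conserved quantity `y (x
+ 1) + α x ^ 2 + β x`. The `y`-axis is reached at time `log (x + 1)`. -/
theorem exists_saddle_arc (hα : 0 < α) (hβ : 0 < β) {x : ℝ} (hx : 0 < x) :
    ∃ a, IsOrbitArc (saddle α β) SigmaPlus (x, 0) (0, α * x ^ 2 + β * x) a := by
  set X : ℝ → ℝ := fun t => (x + 1) * Real.exp (-t) - 1 with hX
  set Y : ℝ → ℝ := fun t => (α * x ^ 2 + β * x - α * X t ^ 2 - β * X t) / (X t + 1) with hY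
  have hX1 : ∀ t, 0 < X t + 1 := fun t => by
    simp only [hX, sub_add_cancel]; positivity
  have hXd : ∀ t, HasDerivAt X (-X t - 1) t := fun t => by
    refine ((((hasDerivAt_id t).neg.exp).const_mul (x + 1)).sub_const 1).congr_deriv ?_
    simp [hX]
  have hYd : ∀ t, HasDerivAt Y (2 * α * X t + Y t + β) t := fun t => by
    refine ((((hXd t).pow 2).const_mul α).const_sub (α * x ^ 2 + β * x) |>.sub
      ((hXd t).const_mul β) |>.div ((hXd t).add_const 1) (hX1 t).ne').congr_deriv ?_
    have := (hX1 t).ne'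
    simp only [hY, Pi.pow_apply, Pi.sub_apply]
    field_simp
    ring
  have hT : 0 < Real.log (x + 1) := Real.log_pos (by linarith)
  have hX0 : X 0 = x := by simp [hX]
  have hXT : X (Real.log (x + 1)) = 0 := by
    simp only [hX, Real.exp_neg, Real.exp_log (show 0 < x + 1 by linarith)]
    field_simp; ring
  have hanti : StrictAnti X := fun s t hst => by
    simp only [hX]
    have := Real.exp_lt_exp.2 (neg_lt_neg hst)
    nlinarith
  refine ⟨_, Real.log (x + 1), fun t => (X t, Y t), hT,
    fun t _ => ((hXd t).prodMk (hYd t)).hasDerivWithinAt, ?_, ?_, fun t ht => ?_, rfl⟩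
  · simp [hY, hX0]
  · simp [hY, hXT]
  · rw [mem_SigmaPlus_diff_iff]
    have h1 : 0 < X t := hXT ▸ hanti ht.2
    have h2 : X t < x := by
      have := hanti ht.1
      rwa [hX0] at this
    refine ⟨h1, div_pos ?_ (hX1 t)⟩
    nlinarith [mul_pos hα (mul_pos (sub_pos.2 h2) (add_pos h1 hx)), mul_pos hβ (sub_pos.2 h2)]

/-- The saddle points into the quadrant along the `x`-axis, so the exit is on the `y`-axis; `ham` is
injective on the `y`-axis, so the entrance is not there. -/
theorem IsCycle.of_saddle (hα : 0 < α) (hβ : 0 < β) {G : ℝ × ℝ → ℝ × ℝ} {p q : ℝ × ℝ}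
    {Γ : Set (ℝ × ℝ)} (h : IsCycle (saddle α β) G p q Γ) :
    ∃ x, 0 < x ∧ p = (x, 0) ∧ q = (0, α * x ^ 2 + β * x) := by
  obtain ⟨s1, -, s3, -⟩ := h.nu_signs
  obtain ⟨hne, hp, hq, a, b, ha, -, -⟩ := h
  have hh := ham_conserved saddle_apply ha
  replace hp := (isCrossingPoint_iff.1 hp).1
  replace hq := (isCrossingPoint_iff.1 hq).1
  obtain ⟨p₁, p₂⟩ := p
  obtain ⟨q₁, q₂⟩ := q
  rcases hq with ⟨hq1, hq2⟩ | ⟨hq1, hq2⟩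
  · exfalso
    rw [nu_of_snd_eq_zero hq2] at s3
    simp only [saddle] at s3 hq1 hq2
    subst hq2
    nlinarith
  rcases hp with ⟨hp1, hp2⟩ | ⟨hp1, hp2⟩
  · simp only at hp1 hp2 hq1 hq2
    subst hp2 hq1
    refine ⟨p₁, hp1, rfl, ?_⟩
    simp only [ham] at hh
    simp only [Prod.mk.injEq, true_and]
    linarith
  · exfalso
    simp only at hp1 hp2 hq1 hq2
    subst hp1 hq1
    simp only [ham] at hh
    exact hne (Prod.ext rfl (by simp only; linarith))

/-- The limit cycles of a system with finitely many crossing periodic orbits. -/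
theorem encard_limitCycles_of_saddle (hα : 0 < α) (hβ : 0 < β) {G : ℝ × ℝ → ℝ × ℝ}
    (hG : ContDiff ℝ 1 G) {S : Set ℝ} (hS : S.Finite) (hpos : ∀ x ∈ S, 0 < x)
    (h₁ : ∀ x Γ, 0 < x → IsCycle (saddle α β) G (x, 0) (0, α * x ^ 2 + β * x) Γ → x ∈ S)
    (h₂ : ∀ x ∈ S, ∃ Γ, IsCycle (saddle α β) G (x, 0) (0, α * x ^ 2 + β * x) Γ) :
    (cornerLimitCycles (saddle α β) G).encard = S.encard ∧
      limitCycles (saddle α β) G = cornerLimitCycles (saddle α β) G := by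
  choose! Λ hΛ using h₂
  have hF := contDiff_saddle (saddle_apply (α := α) (β := β))
  have hcpo : ∀ Γ, IsCrossingPeriodicOrbit (saddle α β) G Γ → ∃ x ∈ S, Γ = Λ x := fun Γ hΓ => by
    obtain ⟨p, q, h⟩ := isCrossingPeriodicOrbit_iff.1 hΓ
    obtain ⟨x, hx, rfl, rfl⟩ := h.of_saddle hα hβ
    have hxS := h₁ x Γ hx h
    exact ⟨x, hxS, h.eq hF hG (hΛ x hxS)⟩
  have hmem : ∀ x ∈ S, ((x, 0) : ℝ × ℝ) ∈ Λ x ∧ ((0, α * x ^ 2 + β * x) : ℝ × ℝ) ∈ Λ x := by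
    intro x hx
    have h := (hΛ x hx).inter_Sigma
    have h3 : ((x, 0) : ℝ × ℝ) ∈ Λ x ∩ Sigma := by rw [h]; exact Or.inl rfl
    have h4 : ((0, α * x ^ 2 + β * x) : ℝ × ℝ) ∈ Λ x ∩ Sigma := by rw [h]; exact Or.inr rfl
    exact ⟨h3.1, h4.1⟩
  have hsep : ∀ x ∈ S, ∀ x' ∈ S, ((x', 0) : ℝ × ℝ) ∈ Λ x → x' = x := by
    intro x hx x' hx' h
    have h3 : ((x', 0) : ℝ × ℝ) ∈ Λ x ∩ Sigma :=
      ⟨h, (mem_Sigma_iff _).2 (Or.inl ⟨(hpos x' hx').le, rfl⟩)⟩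
    rw [(hΛ x hx).inter_Sigma] at h3
    rcases h3 with h3 | h3
    · exact congrArg Prod.fst h3
    · exact absurd (congrArg Prod.fst h3) (hpos x' hx').ne'
  have hlim : ∀ x ∈ S, IsCrossingLimitCycle (saddle α β) G (Λ x) := by
    intro x hx
    -- The isolating neighbourhood is the complement of the finitely many points where the other
    -- cycles cut the `x`-axis.
    refine ⟨isCrossingPeriodicOrbit_iff.2 ⟨_, _, hΛ x hx⟩,
      ((fun x' : ℝ => ((x', 0) : ℝ × ℝ)) '' (S \ {x}))ᶜ,
      ((hS.subset sdiff_subset).image _).isClosed.isOpen_compl, ?_, fun Γ' hΓ' hsub => ?_⟩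
    · rintro z hz ⟨x', ⟨hx', hne⟩, rfl⟩
      exact hne (hsep x hx x' hx' hz)
    · obtain ⟨x', hx', rfl⟩ := hcpo Γ' hΓ'
      by_contra hne
      exact hsub (hmem x' hx').1 ⟨x', ⟨hx', fun h => hne (by rw [mem_singleton_iff.1 h])⟩, rfl⟩
  have hcorner : cornerLimitCycles (saddle α β) G = Λ '' S := by
    apply subset_antisymm
    · rintro Γ ⟨hΓ, -⟩
      obtain ⟨x, hx, rfl⟩ := hcpo Γ hΓ.1
      exact ⟨x, hx, rfl⟩
    · rintro _ ⟨x, hx, rfl⟩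
      have hx0 := hpos x hx
      exact ⟨hlim x hx, ⟨x, hx0, (hmem x hx).1⟩, ⟨_, by positivity, (hmem x hx).2⟩⟩
  refine ⟨?_, subset_antisymm (fun Γ hΓ => ?_) fun Γ hΓ => hΓ.1⟩
  · rw [hcorner]
    exact InjOn.encard_image fun x hx x' hx' h => (hsep x' hx' x hx (h ▸ (hmem x hx).1))
  · obtain ⟨x, hx, rfl⟩ := hcpo Γ hΓ.1
    rw [hcorner]
    exact ⟨x, hx, rfl⟩

end Saddle

/-! ### A criterion for exactly four limit cycles -/

/-- A piece of an orbit joins `z` to `w` without meeting either in between. -/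
def Connects (Q : ℝ × ℝ → ℝ × ℝ) (z w : ℝ × ℝ) : Prop :=
  ∃ (T : ℝ) (γ : ℝ → ℝ × ℝ), 0 < T ∧ IsSol Q T γ ∧ γ 0 = z ∧ γ T = w ∧
    ∀ t ∈ Ioo 0 T, γ t ≠ z ∧ γ t ≠ w

/-- An orbit that leaves the first quadrant at a point of the `y`-axis and does not meet the
switching curve any more is in the other zone. -/
theorem exists_arc_of_avoids {G : ℝ × ℝ → ℝ × ℝ} {T y : ℝ} (hT : 0 < T)
    {γ : ℝ → ℝ × ℝ} (hγ : IsSol G T γ) (h0 : γ 0 = (0, y)) (hG : (G (0, y)).1 < 0)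
    (hav : ∀ t ∈ Ioo 0 T, γ t ∉ Sigma) : IsOrbitArc G SigmaMinus (0, y) (γ T) (γ '' Icc 0 T) := by
  refine ⟨T, γ, hT, hγ, h0, rfl, ?_, rfl⟩
  have hc : ContinuousOn γ (Ioo 0 T) := hγ.continuousOn.mono Ioo_subset_Icc_self
  have hpre : IsPreconnected (γ '' Ioo 0 T) := isPreconnected_Ioo.image _ hc
  have hcov : γ '' Ioo 0 T ⊆ (SigmaMinus \ Sigma) ∪ (SigmaPlus \ Sigma) := by
    rintro _ ⟨t, ht, rfl⟩
    have h1 := hav t ht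
    by_cases h2 : γ t ∈ SigmaMinus \ Sigma
    · exact Or.inl h2
    · right
      rw [mem_SigmaMinus_diff_iff] at h2
      push Not at h2
      exact ⟨h2, h1⟩
  have hstart : ∃ t ∈ Ioo 0 T, (γ t).1 < 0 := by
    have hd := hasDerivWithinAt_fst (hγ 0 (left_mem_Icc.2 hT.le))
    rw [h0] at hd
    have h2 : Tendsto (slope (fun t => (γ t).1) 0) (𝓝[Ioo 0 T] 0) (𝓝 (G (0, y)).1) :=
      (hasDerivWithinAt_iff_tendsto_slope.1 hd).mono_left
        (nhdsWithin_mono _ fun t ht => ⟨Ioo_subset_Icc_self ht, ht.1.ne'⟩)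
    have : (𝓝[Ioo 0 T] (0 : ℝ)).NeBot := left_nhdsWithin_Ioo_neBot hT
    obtain ⟨t, hlt, ht⟩ := ((h2.eventually (gt_mem_nhds hG)).and self_mem_nhdsWithin).exists
    refine ⟨t, ht, ?_⟩
    rw [slope_def_field, h0, sub_zero, sub_zero, div_neg_iff] at hlt
    rcases hlt with h | h
    · exact absurd ht.1 (by linarith [h.2])
    · exact h.1
  obtain ⟨t₀, ht₀, hneg⟩ := hstart
  -- The open arc is connected and avoids the switching curve, hence stays in one zone; the initial
  -- velocity, with negative first component, decides which.
  rcases hpre.subset_or_subset isOpen_SigmaMinus_diff isOpen_SigmaPlus_diff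
    (by
      rw [disjoint_iff_inter_eq_empty]
      ext z
      simp only [mem_inter_iff, mem_SigmaMinus_diff_iff, mem_SigmaPlus_diff_iff,
        mem_empty_iff_false, iff_false]
      rintro ⟨h1 | h1, h2, h3⟩ <;> linarith) hcov with h | h
  · exact fun t ht => h ⟨t, ht, rfl⟩
  · have := h ⟨t₀, ht₀, rfl⟩
    rw [mem_SigmaPlus_diff_iff] at this
    linarith [this.1]

/-- The affine map with linear part `!![a, b; c, d]` and value `O` at the origin. -/
noncomputable def affineMk (O : ℝ × ℝ) {a b c d : ℝ} (h : a * d - b * c ≠ 0) :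
    (ℝ × ℝ) ≃ᵃ[ℝ] (ℝ × ℝ) :=
  (LinearEquiv.toAffineEquiv
    { toFun := fun z : ℝ × ℝ => (a * z.1 + b * z.2, c * z.1 + d * z.2)
      map_add' := fun z w => by ext <;> simp <;> ring
      map_smul' := fun r z => by ext <;> simp <;> ring
      invFun := fun z : ℝ × ℝ =>
        ((d * z.1 - b * z.2) / (a * d - b * c), (a * z.2 - c * z.1) / (a * d - b * c))
      left_inv := fun z => by ext <;> exact (div_eq_iff h).2 (by ring)
      right_inv := fun z => by
        ext <;> simp only [← mul_div_assoc, ← add_div] <;> exact (div_eq_iff h).2 (by ring) }).trans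
    (AffineEquiv.constVAdd ℝ (ℝ × ℝ) O)

theorem affineMk_apply {O : ℝ × ℝ} {a b c d : ℝ} (h : a * d - b * c ≠ 0) (z : ℝ × ℝ) :
    affineMk O h z = (O.1 + (a * z.1 + b * z.2), O.2 + (c * z.1 + d * z.2)) := by
  simp [affineMk, AffineEquiv.trans_apply]
  rfl

theorem affineMk_linear {O : ℝ × ℝ} {a b c d : ℝ} (h : a * d - b * c ≠ 0) (z : ℝ × ℝ) :
    (affineMk O h).linear z = (a * z.1 + b * z.2, c * z.1 + d * z.2) := by
  rfl

/-- The field `Q` in the coordinates `e`. -/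
noncomputable def pullback (Q : ℝ × ℝ → ℝ × ℝ) (e : (ℝ × ℝ) ≃ᵃ[ℝ] (ℝ × ℝ)) (z : ℝ × ℝ) : ℝ × ℝ :=
  e.linear.symm (Q (e z))

theorem linear_pullback {Q : ℝ × ℝ → ℝ × ℝ} {e : (ℝ × ℝ) ≃ᵃ[ℝ] (ℝ × ℝ)} (z : ℝ × ℝ) :
    e.linear (pullback Q e z) = Q (e z) := by
  simp [pullback]

namespace RatIntegral

variable {Q : ℝ × ℝ → ℝ × ℝ} {m k : ℕ} (I : RatIntegral Q m k)

/-- The first integral separates the points of a line transverse to the field. -/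
theorem injOn_line (O V : ℝ × ℝ)
    (hw : ∀ s : ℝ, 0 < s → 0 < I.l (O + s • V) →
      0 < V.1 * (Q (O + s • V)).2 - V.2 * (Q (O + s • V)).1) {s t : ℝ} (hs : 0 ≤ s) (ht : 0 ≤ t)
    (hls : 0 < I.l (O + s • V)) (hlt : 0 < I.l (O + t • V))
    (h : I.N (O + s • V) * I.D (O + t • V) = I.N (O + t • V) * I.D (O + s • V)) : s = t := by
  -- `l` is affine along the line, so positivity at two points gives it in between, where the
  -- quotient is then strictly increasing.
  have hconv : ∀ r ∈ uIcc s t, 0 < I.l (O + r • V) := by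
    intro r hr
    have e : ∀ r : ℝ, I.l (O + r • V) = I.l O + r * (I.l₁ * V.2) := fun r => by
      simp [l]; ring
    rw [e] at hls hlt ⊢
    rcases mem_uIcc.1 hr with ⟨h1, h2⟩ | ⟨h1, h2⟩ <;>
    · rcases le_total 0 (I.l₁ * V.2) with h3 | h3 <;> nlinarith
  obtain ⟨n, d, -, -, hn, hd, hder⟩ := I.exists_poly O V
  have hd' : ∀ r, d.eval r = I.D (O + r • V) := hd
  have hd0 : ∀ r ∈ uIcc s t, d.eval r ≠ 0 := fun r hr => by
    rw [hd']; exact pow_ne_zero _ (hconv r hr).ne'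
  have hmono : StrictMonoOn (fun r => n.eval r / d.eval r) (uIcc s t) := by
    refine strictMonoOn_of_deriv_pos (convex_uIcc _ _)
      (n.continuous.continuousOn.div d.continuous.continuousOn hd0) fun r hr => ?_
    have hr' : r ∈ uIcc s t := interior_subset hr
    have h0 : 0 < r := by
      rw [uIcc, interior_Icc] at hr
      exact (le_min hs ht).trans_lt hr.1
    have hdd := (n.hasDerivAt r).div (d.hasDerivAt r) (hd0 r hr')
    rw [show (fun r => n.eval r / d.eval r) = ((fun r => n.eval r) / fun r => d.eval r) from rfl,
      hdd.deriv, mul_comm (n.derivative.eval r), hder r]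
    have := hd0 r hr'
    have := mul_pos (I.ρ_pos (O + r • V) (hconv r hr')) (hw r h0 (hconv r hr'))
    positivity
  refine hmono.injOn left_mem_uIcc right_mem_uIcc ?_
  rw [div_eq_div_iff (hd0 s left_mem_uIcc) (hd0 t right_mem_uIcc), hn, hn, hd', hd', h]

end RatIntegral

namespace RatIntegral

variable {Q : ℝ × ℝ → ℝ × ℝ} {m k : ℕ} (I : RatIntegral Q m k)

/-- A criterion for a system with exactly four crossing limit cycles: `T` is the set of the
abscissas of the points that the levels of both first integrals allow, and the center has an orbit
between each of the corresponding pairs of points. -/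
theorem exists_four_limitCycles {O : ℝ × ℝ} {a b c d α β : ℝ} (hΔ : 0 < a * d - b * c)
    (hα : 0 < α) (hβ : 0 < β) (hly : ∀ y, 0 ≤ y → 0 < I.l (O.1 + b * y, O.2 + d * y))
    (hwx : ∀ x, 0 < x → 0 < I.l (O.1 + a * x, O.2 + c * x) →
      0 < a * (Q (O.1 + a * x, O.2 + c * x)).2 - c * (Q (O.1 + a * x, O.2 + c * x)).1)
    (hwy : ∀ y, 0 < y →
      0 < b * (Q (O.1 + b * y, O.2 + d * y)).2 - d * (Q (O.1 + b * y, O.2 + d * y)).1)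
    {T : Set ℝ} (hT : T.encard = 4)
    (hmem : ∀ x, x ∈ T ↔ 0 < x ∧ 0 < I.l (O.1 + a * x, O.2 + c * x) ∧
      I.N (O.1 + a * x, O.2 + c * x) *
        I.D (O.1 + b * (α * x ^ 2 + β * x), O.2 + d * (α * x ^ 2 + β * x)) =
      I.N (O.1 + b * (α * x ^ 2 + β * x), O.2 + d * (α * x ^ 2 + β * x)) *
        I.D (O.1 + a * x, O.2 + c * x))
    (hconn : ∀ x ∈ T, Connects Q
      (O.1 + b * (α * x ^ 2 + β * x), O.2 + d * (α * x ^ 2 + β * x))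
      (O.1 + a * x, O.2 + c * x)) :
    ∃ F G : ℝ × ℝ → ℝ × ℝ, IsLinearHamiltonianSaddle F ∧ IsAffineCopy Q G ∧
      (cornerLimitCycles F G).encard = 4 ∧ limitCycles F G = cornerLimitCycles F G := by
  set e := affineMk O hΔ.ne' with he
  set G := pullback Q e
  have hG : ∀ z, e.linear (G z) = Q (e z) := linear_pullback
  have ex : ∀ x, e (x, 0) = (O.1 + a * x, O.2 + c * x) := fun x => by
    rw [he, affineMk_apply]; simp
  have ey : ∀ y, e (0, y) = (O.1 + b * y, O.2 + d * y) := fun y => by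
    rw [he, affineMk_apply]; simp
  have e1 : e.linear (1, 0) = (a, c) := by rw [he, affineMk_linear]; simp
  have e2 : e.linear (0, 1) = (b, d) := by rw [he, affineMk_linear]; simp
  have exV : ∀ x : ℝ, e (x, 0) = O + x • (a, c) := fun x => by
    rw [ex]; ext <;> simp <;> ring
  have eyV : ∀ y : ℝ, e (0, y) = O + y • (b, d) := fun y => by
    rw [ey]; ext <;> simp <;> ring
  simp only [← ex, ← ey] at hly hwx hwy hmem hconn
  have hG2 : ∀ x, 0 < x → 0 < I.l (e (x, 0)) → 0 < (G (x, 0)).2 := fun x hx hl => by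
    have h := (wedge hG (x, 0)).1
    simp only [e1, e2] at h
    have := hwx x hx hl
    rw [h, show a * d - c * b = a * d - b * c by ring] at this
    exact pos_of_mul_pos_left this hΔ.le
  have hG1 : ∀ y, 0 < y → (G (0, y)).1 < 0 := fun y hy => by
    have h := (wedge hG (0, y)).2
    simp only [e1, e2] at h
    have := hwy y hy
    rw [h, show a * d - c * b = a * d - b * c by ring] at this
    have := pos_of_mul_pos_left this hΔ.le
    linarith
  have hfin : T.Finite := finite_of_encard_eq_coe (k := 4) (by exact_mod_cast hT)
  rw [← hT]
  refine ⟨saddle α β, G, isLinearHamiltonianSaddle_saddle, ⟨e, hG⟩,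
    encard_limitCycles_of_saddle hα hβ (contDiff_affineCopy I.contDiff hG) hfin
      (fun x hx => ((hmem x).1 hx).1) (fun x Γ hx hΓ => ?_) fun x hx => ?_⟩
  -- `l` is positive on the image of the `y`-half-axis and keeps its sign along the arc, so only
  -- abscissas with `l > 0` occur.
  · obtain ⟨-, -, -, p, q, -, hb, -⟩ := hΓ
    obtain ⟨⟨E, hE, hl⟩, hN, -⟩ := I.arc_conserved hG hb
    refine (hmem x).2 ⟨hx, ?_, hN⟩
    rw [hl]
    exact mul_pos (hly _ (by positivity)) hE
  · obtain ⟨hx0, hlx, hN⟩ := (hmem x).1 hx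
    set y := α * x ^ 2 + β * x with hy
    have hy0 : 0 < y := by positivity
    obtain ⟨p, hp⟩ := exists_saddle_arc hα hβ hx0
    obtain ⟨τ, ψ, hτ, hψ, hψ0, hψτ, hav⟩ := hconn x hx
    have hsol : IsSol G τ (fun t => e.symm (ψ t)) := fun t ht =>
      hasDerivWithinAt_affine (Q := G) (e := e.symm) (G := Q)
        (fun z => by
          apply e.linear.injective
          rw [hG, AffineEquiv.apply_symm_apply]
          simp [AffineEquiv.linear_symm]) (hψ t ht)
    have hy1 : e.symm (ψ 0) = (0, y) := by rw [hψ0, AffineEquiv.symm_apply_apply]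
    have hx1 : e.symm (ψ τ) = (x, 0) := by rw [hψτ, AffineEquiv.symm_apply_apply]
    obtain ⟨E, hE, hlev⟩ := I.exists_scale hτ.le hψ
    -- A point of the orbit on a half-axis lies on the level of the end point on that half-axis;
    -- injectivity of the first integral makes it that end point, which the orbit does not meet in
    -- between.
    have harc := exists_arc_of_avoids hτ hsol hy1 (hG1 y hy0) fun t ht hS => by
      obtain ⟨h1, h2⟩ := hlev t (Ioo_subset_Icc_self ht)
      rw [hψ0] at h1 h2
      have hly0 := hly y hy0.le
      have hlt : 0 < I.l (ψ t) := by rw [h1]; exact mul_pos hly0 (hE t)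
      rcases (mem_Sigma_iff _).1 hS with ⟨h3, h4⟩ | ⟨h3, h4⟩
      · have h5 : ψ t = e ((e.symm (ψ t)).1, 0) := by
          rw [← h4]; simp
        set s := (e.symm (ψ t)).1
        refine (hav t ht).2 ?_
        have hDy : I.D (e (0, y)) ≠ 0 := pow_ne_zero _ hly0.ne'
        have h6 : I.N (ψ t) * I.D (e (x, 0)) = I.N (e (x, 0)) * I.D (ψ t) := by
          apply mul_right_cancel₀ hDy
          linear_combination I.D (e (x, 0)) * h2 - I.D (ψ t) * hN
        rw [h5] at h6 hlt ⊢
        simp only [exV] at h6 hlt hlx hwx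
        rw [I.injOn_line O (a, c) hwx h3 hx0.le hlt hlx h6]
      · have h5 : ψ t = e (0, (e.symm (ψ t)).2) := by
          rw [← h3]; simp
        set s := (e.symm (ψ t)).2
        refine (hav t ht).1 ?_
        rw [h5] at h2 hlt ⊢
        simp only [eyV] at h2 hlt hly0 hwy
        rw [I.injOn_line O (b, d) (fun s hs _ => hwy s hs) h4 hy0.le hlt hly0 h2]
    simp only [hx1] at harc
    refine ⟨_, fun h => hx0.ne' (congrArg Prod.fst h), Or.inl ⟨hx0, rfl, ?_⟩,
      Or.inr ⟨rfl, hy0, ?_⟩, p, _, hp, harc, rfl⟩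
    · refine mul_pos ?_ (hG2 x hx0 hlx)
      simp only [saddle]; positivity
    · refine mul_pos_of_neg_of_neg ?_ (hG1 y hy0)
      simp [saddle]

end RatIntegral

/-! ### Linearizations of the centers -/

/-- Two distinct points on a circle are joined by an arc of it. -/
theorem exists_rotation {z w : ℝ × ℝ} (h : z.1 ^ 2 + z.2 ^ 2 = w.1 ^ 2 + w.2 ^ 2) (hne : z ≠ w) :
    ∃ (T : ℝ) (u v : ℝ → ℝ), 0 < T ∧ (∀ t, HasDerivAt u (-v t) t) ∧ (∀ t, HasDerivAt v (u t) t) ∧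
      (∀ t, u t ^ 2 + v t ^ 2 = z.1 ^ 2 + z.2 ^ 2) ∧ (u 0, v 0) = z ∧ (u T, v T) = w ∧
      ∀ t ∈ Ioo 0 T, (u t, v t) ≠ z ∧ (u t, v t) ≠ w := by
  obtain ⟨a, b⟩ := z
  obtain ⟨c, d⟩ := w
  simp only at h ⊢
  have hR : 0 < a ^ 2 + b ^ 2 := by
    by_contra! h0
    have h1 : a = 0 ∧ b = 0 := ⟨by nlinarith [sq_nonneg a, sq_nonneg b],
      by nlinarith [sq_nonneg a, sq_nonneg b]⟩
    have h2 : c = 0 ∧ d = 0 := ⟨by nlinarith [sq_nonneg c, sq_nonneg d],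
      by nlinarith [sq_nonneg c, sq_nonneg d]⟩
    exact hne (by rw [h1.1, h1.2, h2.1, h2.2])
  set u : ℝ → ℝ := fun t => a * Real.cos t - b * Real.sin t with hu
  set v : ℝ → ℝ := fun t => b * Real.cos t + a * Real.sin t with hv
  have huv : ∀ t, u t ^ 2 + v t ^ 2 = a ^ 2 + b ^ 2 := fun t => by
    simp only [hu, hv]; linear_combination (a ^ 2 + b ^ 2) * Real.cos_sq_add_sin_sq t
  have hret : ∀ s t, 0 < t - s → t - s < 2 * Real.pi → (u s, v s) ≠ (u t, v t) := by
    intro s t h1 h2 h3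
    rw [Prod.mk.injEq] at h3
    have h4 : Real.cos (t - s) = 1 := by
      rw [Real.cos_sub]
      have h5 := huv t
      have h6 : (a ^ 2 + b ^ 2) * (Real.cos t * Real.cos s + Real.sin t * Real.sin s) =
          u s * u t + v s * v t := by simp only [hu, hv]; ring
      rw [h3.1, h3.2, ← sq, ← sq, h5] at h6
      exact mul_left_cancel₀ hR.ne' (by rw [h6, mul_one])
    rw [Real.cos_eq_one_iff_of_lt_of_lt (by linarith) h2] at h4
    exact h1.ne' h4
  -- The angle is the argument of the complex quotient `(c + i d) / (a + i b)`, of modulus one,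
  -- moved into `[0, 2π)`.
  obtain ⟨T, hT0, hT2, hTu⟩ : ∃ T, 0 ≤ T ∧ T < 2 * Real.pi ∧ (u T, v T) = (c, d) := by
    have hn :
        ‖(⟨(a * c + b * d) / (a ^ 2 + b ^ 2), (a * d - b * c) / (a ^ 2 + b ^ 2)⟩ : ℂ)‖ = 1 := by
      rw [← sq_eq_sq₀ (norm_nonneg _) zero_le_one, Complex.sq_norm, Complex.normSq_apply]
      simp only
      rw [← mul_div_mul_comm]
      field_simp
      linear_combination (-(a ^ 2 + b ^ 2)) * h
    set ζ : ℂ := ⟨(a * c + b * d) / (a ^ 2 + b ^ 2), (a * d - b * c) / (a ^ 2 + b ^ 2)⟩ with hζ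
    have hζ0 : ζ ≠ 0 := fun h => by rw [h, norm_zero] at hn; exact zero_ne_one hn
    have hc := Complex.cos_arg hζ0
    have hs := Complex.sin_arg ζ
    rw [hn, div_one] at hc hs
    have key : ∀ T, Real.cos T = ζ.re → Real.sin T = ζ.im → (u T, v T) = (c, d) := by
      intro T h1 h2
      rw [Prod.mk.injEq]
      simp only [hu, hv, h1, h2, hζ]
      constructor <;> field_simp <;> ring
    rcases le_or_gt 0 ζ.arg with h0 | h0
    · exact ⟨ζ.arg, h0, by linarith [Complex.arg_le_pi ζ, Real.pi_pos], key _ hc hs⟩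
    · exact ⟨ζ.arg + 2 * Real.pi, by linarith [Complex.neg_pi_lt_arg ζ, Real.pi_pos],
        by linarith, key _ (by rw [Real.cos_add_two_pi, hc]) (by rw [Real.sin_add_two_pi, hs])⟩
  have h0 : (u 0, v 0) = (a, b) := by simp [hu, hv]
  have hT : 0 < T := hT0.lt_of_ne fun h => hne (by rw [← h0, ← hTu, ← h])
  refine ⟨T, u, v, hT, fun t => ?_, fun t => ?_, huv, h0, hTu, fun t ht => ⟨?_, ?_⟩⟩
  · refine (((Real.hasDerivAt_cos t).const_mul a).sub
      ((Real.hasDerivAt_sin t).const_mul b)).congr_deriv ?_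
    simp only [hv]; ring
  · refine (((Real.hasDerivAt_cos t).const_mul b).add
      ((Real.hasDerivAt_sin t).const_mul a)).congr_deriv ?_
    simp only [hu]; ring
  · rw [← h0]
    exact (hret 0 t (by linarith [ht.1]) (by linarith [ht.2])).symm
  · rw [← hTu]
    exact hret t T (by linarith [ht.2]) (by linarith [ht.1])

/-- Orbits of a field that a change of variables `Φ` with inverse `Λ` turns into the rotation. -/
theorem connects_of_linearization {Q Φ Λ : ℝ × ℝ → ℝ × ℝ} {z w : ℝ × ℝ}
    (hzw : (Φ z).1 ^ 2 + (Φ z).2 ^ 2 = (Φ w).1 ^ 2 + (Φ w).2 ^ 2) (hne : z ≠ w)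
    (hz : Λ (Φ z) = z) (hw : Λ (Φ w) = w)
    (hΦ : ∀ p : ℝ × ℝ, p.1 ^ 2 + p.2 ^ 2 = (Φ z).1 ^ 2 + (Φ z).2 ^ 2 → Φ (Λ p) = p)
    (hd : ∀ (u v : ℝ → ℝ) (t : ℝ), HasDerivAt u (-v t) t → HasDerivAt v (u t) t →
      u t ^ 2 + v t ^ 2 = (Φ z).1 ^ 2 + (Φ z).2 ^ 2 →
        HasDerivAt (fun t => Λ (u t, v t)) (Q (Λ (u t, v t))) t) : Connects Q z w := by
  obtain ⟨T, u, v, hT, hu, hv, huv, h0, hT1, hav⟩ :=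
    exists_rotation hzw fun h => hne (by rw [← hz, h, hw])
  refine ⟨T, fun t => Λ (u t, v t), hT,
    fun t _ => (hd u v t (hu t) (hv t) (huv t)).hasDerivWithinAt, ?_, ?_, fun t ht => ⟨?_, ?_⟩⟩
  · simp only [h0, hz]
  · simp only [hT1, hw]
  · intro h
    exact (hav t ht).1 ((hΦ (u t, v t) (huv t)).symm.trans (congrArg Φ h))
  · intro h
    exact (hav t ht).2 ((hΦ (u t, v t) (huv t)).symm.trans (congrArg Φ h))

/-- In the complex coordinate `ζ = x + i y` the field is `ζ' = i ζ + ζ ^ 2`, and `Φ` is `ζ / (ζ +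
i)`, which satisfies the equation of the rotation. The half-plane `1 + 2 y > 0` corresponds to the
open unit disc. -/
theorem connects_Q1 {z w : ℝ × ℝ} (hz : 0 < 1 + 2 * z.2) (hw : 0 < 1 + 2 * w.2)
    (h : (z.1 ^ 2 + z.2 ^ 2) * (1 + 2 * w.2) = (w.1 ^ 2 + w.2 ^ 2) * (1 + 2 * z.2))
    (hne : z ≠ w) : Connects Q1 z w := by
  set M : ℝ × ℝ → ℝ := fun z => z.1 ^ 2 + z.2 ^ 2 + 1 + 2 * z.2 with hM
  set Φ : ℝ × ℝ → ℝ × ℝ := fun z => ((z.1 ^ 2 + z.2 ^ 2 + z.2) / M z, -z.1 / M z) with hΦ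
  set R := (Φ z).1 ^ 2 + (Φ z).2 ^ 2 with hR
  have hMp : ∀ z : ℝ × ℝ, 0 < 1 + 2 * z.2 → 0 < M z := fun z h => by
    simp only [hM]; nlinarith [sq_nonneg z.1, sq_nonneg z.2]
  have hR' : ∀ z : ℝ × ℝ, 0 < 1 + 2 * z.2 →
      (Φ z).1 ^ 2 + (Φ z).2 ^ 2 = (z.1 ^ 2 + z.2 ^ 2) / M z := fun z h => by
    have := (hMp z h).ne'
    simp only [hΦ]
    field_simp
    simp only [hM]; ring
  have hRw : R = (Φ w).1 ^ 2 + (Φ w).2 ^ 2 := by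
    rw [hR, hR' z hz, hR' w hw, div_eq_div_iff (hMp z hz).ne' (hMp w hw).ne']
    simp only [hM]; linear_combination h
  have hR1 : R < 1 := by
    rw [hR, hR' z hz, div_lt_one (hMp z hz)]
    simp only [hM]; linarith
  -- With `ω = p.1 + i p.2`, on the circle of squared radius `R` this is `|1 - ω| ^ 2`, and `Λ` is
  -- `i ω / (1 - ω)`; off that circle `Λ` need not invert `Φ`.
  set m : ℝ × ℝ → ℝ := fun p => 1 - 2 * p.1 + R with hm
  set Λ : ℝ × ℝ → ℝ × ℝ := fun p => (-p.2 / m p, (p.1 - R) / m p) with hΛ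
  have hmp : ∀ p : ℝ × ℝ, p.1 ^ 2 + p.2 ^ 2 = R → 0 < m p := fun p hp => by
    simp only [hm]
    nlinarith [sq_nonneg (1 - p.1), sq_nonneg p.2, sq_nonneg (p.1 - R), sq_nonneg (1 - R)]
  have inv : ∀ z : ℝ × ℝ, 0 < 1 + 2 * z.2 → (Φ z).1 ^ 2 + (Φ z).2 ^ 2 = R → Λ (Φ z) = z := by
    intro z h hzR
    have hMz := (hMp z h).ne'
    have hm' : m (Φ z) = 1 / M z := by
      simp only [hm]
      rw [← hzR, hR' z h]
      simp only [hΦ]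
      field_simp
      simp only [hM]; ring
    simp only [hΛ]
    rw [hm', ← hzR, hR' z h]
    ext
    · simp only [hΦ]; field_simp
    · simp only [hΦ]; field_simp; ring
  refine connects_of_linearization (Φ := Φ) (Λ := Λ) hRw hne (inv z hz rfl) (inv w hw hRw.symm)
    (fun p hp => ?_) fun u v t hu hv huv => ?_
  · have hmp' := (hmp p hp).ne'
    have hp2 : p.2 ^ 2 = R - p.1 ^ 2 := by linarith
    have hMm : M (Λ p) = 1 / m p := by
      simp only [hM, hΛ]
      field_simp
      rw [hp2]; simp only [hm]; ring
    simp only [hΦ]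
    rw [hMm]
    ext
    · simp only [hΛ]
      field_simp
      rw [hp2]; simp only [hm]; ring
    · simp only [hΛ]
      field_simp
  · have hmp' := (hmp (u t, v t) huv).ne'
    have hv2 : v t ^ 2 = R - u t ^ 2 := by linarith
    have hmd : HasDerivAt (fun t => m (u t, v t)) (2 * v t) t := by
      refine (((hu.const_mul 2).const_sub 1).add_const R).congr_deriv ?_
      ring
    refine ((hv.neg.div hmd hmp').prodMk ((hu.sub_const R).div hmd hmp')).congr_deriv ?_
    simp only [Q1, hΛ]
    simp only [hm] at hmp' ⊢
    ext
    · simp only [Pi.neg_apply]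
      field_simp
      rw [hv2]; ring
    · simp only
      field_simp
      ring

/-- The projective map `(x, y) / (1 + y)` linearizes the field. The hypothesis on `w` puts the
circle inside the unit disc, where it avoids the line `p.2 = 1` sent to infinity by the inverse. -/
theorem connects_Q2 {z w : ℝ × ℝ} (hz : 0 < 1 + z.2) (hw : 0 < 1 + w.2)
    (h : (z.1 ^ 2 + z.2 ^ 2) * (1 + w.2) ^ 2 = (w.1 ^ 2 + w.2 ^ 2) * (1 + z.2) ^ 2)
    (hlt : w.1 ^ 2 + w.2 ^ 2 < (1 + w.2) ^ 2) (hne : z ≠ w) : Connects Q2 z w := by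
  set Φ : ℝ × ℝ → ℝ × ℝ := fun z => (z.1 / (1 + z.2), z.2 / (1 + z.2)) with hΦ
  set Λ : ℝ × ℝ → ℝ × ℝ := fun p => (p.1 / (1 - p.2), p.2 / (1 - p.2)) with hΛ
  have inv : ∀ z : ℝ × ℝ, 0 < 1 + z.2 → Λ (Φ z) = z := by
    intro z h
    have hm : 1 - z.2 / (1 + z.2) = 1 / (1 + z.2) := by field_simp; ring
    simp only [hΛ, hΦ, hm]
    ext <;> simp only <;> field_simp
  have hR : ∀ z : ℝ × ℝ, (Φ z).1 ^ 2 + (Φ z).2 ^ 2 = (z.1 ^ 2 + z.2 ^ 2) / (1 + z.2) ^ 2 :=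
    fun z => by simp only [hΦ]; rw [div_pow, div_pow, ← add_div]
  have hRw : (Φ z).1 ^ 2 + (Φ z).2 ^ 2 = (Φ w).1 ^ 2 + (Φ w).2 ^ 2 := by
    rw [hR, hR, div_eq_div_iff (by positivity) (by positivity), h]
  have hR1 : (Φ z).1 ^ 2 + (Φ z).2 ^ 2 < 1 := by
    rw [hRw, hR, div_lt_one (by positivity)]
    exact hlt
  have hpos : ∀ p : ℝ × ℝ, p.1 ^ 2 + p.2 ^ 2 = (Φ z).1 ^ 2 + (Φ z).2 ^ 2 → 0 < 1 - p.2 :=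
    fun p hp => by nlinarith [sq_nonneg p.1]
  refine connects_of_linearization (Φ := Φ) (Λ := Λ) hRw hne (inv z hz) (inv w hw)
    (fun p hp => ?_) fun u v t hu hv huv => ?_
  · have hp' := hpos p hp
    have hm : 1 + p.2 / (1 - p.2) = 1 / (1 - p.2) := by field_simp; ring
    simp only [hΛ, hΦ, hm]
    ext <;> simp only <;> field_simp
  · have hp' := (hpos (u t, v t) huv).ne'
    refine ((hu.div (hv.const_sub 1) hp').prodMk (hv.div (hv.const_sub 1) hp')).congr_deriv ?_
    simp only [Q2, hΛ] at hp' ⊢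
    ext
    · simp only
      field_simp
      ring
    · simp only
      field_simp
      ring

/-- The linearization is `(x, y - 4 / 3 x ^ 2) / r` with `r = √(1 - 16 y / 3)`. On the circle of
squared radius `R` one has `3 / (8 r) = K + p.2` with `K > |p.2|`, so the inverse is rational there
and no bound on the level is needed. -/
theorem connects_Q3 {z w : ℝ × ℝ} (hz : 0 < 3 - 16 * z.2) (hw : 0 < 3 - 16 * w.2)
    (h : ((4 * z.1 ^ 2 - 3 * z.2) ^ 2 + 9 * z.1 ^ 2) * (3 - 16 * w.2) =
      ((4 * w.1 ^ 2 - 3 * w.2) ^ 2 + 9 * w.1 ^ 2) * (3 - 16 * z.2))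
    (hne : z ≠ w) : Connects Q3 z w := by
  set r : ℝ × ℝ → ℝ := fun z => √(1 - 16 / 3 * z.2) with hr
  set Φ : ℝ × ℝ → ℝ × ℝ := fun z => (z.1 / r z, (z.2 - 4 / 3 * z.1 ^ 2) / r z) with hΦ
  set R := (Φ z).1 ^ 2 + (Φ z).2 ^ 2 with hR
  set K := √(R + 9 / 64) with hK
  have hR0 : 0 ≤ R := by positivity
  have hK2 : K ^ 2 = R + 9 / 64 := Real.sq_sqrt (by positivity)
  have hK0 : 0 < K := Real.sqrt_pos.2 (by positivity)
  set Λ : ℝ × ℝ → ℝ × ℝ := fun p =>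
    (3 / 8 * p.1 / (K + p.2), 3 / 16 - 27 / 1024 / (K + p.2) ^ 2) with hΛ
  have hrp : ∀ z : ℝ × ℝ, 0 < 3 - 16 * z.2 → 0 < r z := fun z h =>
    Real.sqrt_pos.2 (by linarith)
  have hr2 : ∀ z : ℝ × ℝ, 0 < 3 - 16 * z.2 → r z ^ 2 = 1 - 16 / 3 * z.2 := fun z h =>
    Real.sq_sqrt (by linarith)
  have hR' : ∀ z : ℝ × ℝ, 0 < 3 - 16 * z.2 → (Φ z).1 ^ 2 + (Φ z).2 ^ 2 =
      ((4 * z.1 ^ 2 - 3 * z.2) ^ 2 + 9 * z.1 ^ 2) / (3 * (3 - 16 * z.2)) := fun z h => by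
    simp only [hΦ]
    rw [div_pow, div_pow, hr2 z h, ← add_div, div_eq_div_iff (by linarith) (by linarith)]
    ring
  have hRw : R = (Φ w).1 ^ 2 + (Φ w).2 ^ 2 := by
    rw [hR, hR' z hz, hR' w hw, div_eq_div_iff (by linarith) (by linarith)]
    linear_combination 3 * h
  have hpos : ∀ p : ℝ × ℝ, p.1 ^ 2 + p.2 ^ 2 = R → 0 < K + p.2 := fun p hp => by
    nlinarith [sq_nonneg p.1, abs_nonneg p.2, neg_abs_le p.2, sq_abs p.2]
  have inv : ∀ z : ℝ × ℝ, 0 < 3 - 16 * z.2 → (Φ z).1 ^ 2 + (Φ z).2 ^ 2 = R → Λ (Φ z) = z := by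
    intro z h hzR
    have h1 := hrp z h
    have h2 := hr2 z h
    have hy : z.2 = 3 / 16 * (1 - r z ^ 2) := by linarith
    have h3 := hpos (Φ z) hzR
    have h4 : K + (Φ z).2 = 3 / 8 / r z := by
      have h5 : (K + (Φ z).2 - 3 / 8 / r z) * (K - (Φ z).2 + 3 / 8 / r z) = 0 := by
        have : (K + (Φ z).2 - 3 / 8 / r z) * (K - (Φ z).2 + 3 / 8 / r z) =
          K ^ 2 - ((Φ z).2 - 3 / 8 / r z) ^ 2 := by ring
        rw [this, hK2, ← hzR]
        simp only [hΦ]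
        rw [hy]
        field_simp
        ring
      have h6 : 0 < K + -(Φ z).2 := hpos ((Φ z).1, -(Φ z).2) (by simpa using hzR)
      have h7 : 0 < 3 / 8 / r z := by positivity
      have := (mul_eq_zero.1 h5).resolve_right (by linarith)
      linarith
    simp only [hΛ]
    rw [h4]
    ext
    · simp only [hΦ]; field_simp
    · simp only [hy]; field_simp; ring
  refine connects_of_linearization (Φ := Φ) (Λ := Λ) hRw hne (inv z hz rfl) (inv w hw hRw.symm)
    (fun p hp => ?_) fun u v t hu hv huv => ?_
  · have hp' := hpos p hp
    have hp2 : p.1 ^ 2 = K ^ 2 - 9 / 64 - p.2 ^ 2 := by linarith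
    have hrl : r (Λ p) = 3 / 8 / (K + p.2) := by
      simp only [hr, hΛ]
      rw [show 1 - 16 / 3 * (3 / 16 - 27 / 1024 / (K + p.2) ^ 2) = (3 / 8 / (K + p.2)) ^ 2 by
        rw [div_pow]; ring, Real.sqrt_sq (by positivity)]
    simp only [hΦ]
    rw [hrl]
    simp only [hΛ]
    ext
    · simp only; field_simp
    · simp only; field_simp; rw [hp2]; ring
  · have hp' := (hpos (u t, v t) huv).ne'
    have hu2 : u t ^ 2 = K ^ 2 - 9 / 64 - v t ^ 2 := by linarith
    refine (((hu.const_mul (3 / 8)).div (hv.const_add K) hp').prodMk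
      (((hasDerivAt_const t (27 / 1024 : ℝ)).div ((hv.const_add K).pow 2)
        (pow_ne_zero 2 hp')).const_sub (3 / 16))).congr_deriv ?_
    simp only [Q3, hΛ, Pi.pow_apply] at hp' ⊢
    ext
    · simp only
      field_simp
      rw [hu2]; ring
    · simp only
      field_simp
      ring

/-- Here `1 - 16 (Φ z).2` is the square of `3 / (3 + 8 y)`, which inverts `Φ` by a square root. A
negative numerator of the first integral means `|Φ| < 1 / 16`, so the root is defined on the whole
circle. -/
theorem connects_Q4 {z w : ℝ × ℝ} (hz : 0 < 3 + 8 * z.2) (hw : 0 < 3 + 8 * w.2)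
    (h : (9 * z.1 ^ 2 - 9 / 2 * z.2 ^ 2 - 27 / 8 * z.2 - 81 / 256) * (3 + 8 * w.2) ^ 4 =
      (9 * w.1 ^ 2 - 9 / 2 * w.2 ^ 2 - 27 / 8 * w.2 - 81 / 256) * (3 + 8 * z.2) ^ 4)
    (hlt : 9 * w.1 ^ 2 - 9 / 2 * w.2 ^ 2 - 27 / 8 * w.2 - 81 / 256 < 0)
    (hne : z ≠ w) : Connects Q4 z w := by
  set Φ : ℝ × ℝ → ℝ × ℝ := fun z =>
    (3 * z.1 / (3 + 8 * z.2) ^ 2, z.2 * (3 + 4 * z.2) / (3 + 8 * z.2) ^ 2) with hΦ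
  set r : ℝ × ℝ → ℝ := fun p => √(1 - 16 * p.2) with hr
  set Λ : ℝ × ℝ → ℝ × ℝ := fun p => (3 * p.1 / r p ^ 2, (3 / r p - 3) / 8) with hΛ
  have hR : ∀ z : ℝ × ℝ, 0 < 3 + 8 * z.2 → (Φ z).1 ^ 2 + (Φ z).2 ^ 2 = 1 / 256 +
      (9 * z.1 ^ 2 - 9 / 2 * z.2 ^ 2 - 27 / 8 * z.2 - 81 / 256) / (3 + 8 * z.2) ^ 4 := by
    intro z h
    simp only [hΦ]
    field_simp
    ring
  have hRw : (Φ z).1 ^ 2 + (Φ z).2 ^ 2 = (Φ w).1 ^ 2 + (Φ w).2 ^ 2 := by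
    rw [hR z hz, hR w hw, add_right_inj, div_eq_div_iff (by positivity) (by positivity), h]
  have hR1 : (Φ z).1 ^ 2 + (Φ z).2 ^ 2 < 1 / 256 := by
    rw [hRw, hR w hw]
    have := div_neg_of_neg_of_pos hlt (show 0 < (3 + 8 * w.2) ^ 4 by positivity)
    linarith
  have hpos : ∀ p : ℝ × ℝ, p.1 ^ 2 + p.2 ^ 2 = (Φ z).1 ^ 2 + (Φ z).2 ^ 2 → 0 < 1 - 16 * p.2 :=
    fun p hp => by nlinarith [sq_nonneg p.1]
  have inv : ∀ z : ℝ × ℝ, 0 < 3 + 8 * z.2 → Λ (Φ z) = z := by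
    intro z h
    have h0 := h.ne'
    have hrz : r (Φ z) = 3 / (3 + 8 * z.2) := by
      simp only [hr, hΦ]
      rw [show 1 - 16 * (z.2 * (3 + 4 * z.2) / (3 + 8 * z.2) ^ 2) = (3 / (3 + 8 * z.2)) ^ 2 by
        rw [div_pow, mul_div_assoc', one_sub_div (pow_ne_zero 2 h0)]
        congr 1
        ring, Real.sqrt_sq (by positivity)]
    simp only [hΛ]
    rw [hrz]
    simp only [hΦ]
    ext
    · simp only; field_simp
    · simp only; field_simp; ring
  refine connects_of_linearization (Φ := Φ) (Λ := Λ) hRw hne (inv z hz) (inv w hw)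
    (fun p hp => ?_) fun u v t hu hv huv => ?_
  · have hp' := hpos p hp
    have hr0 : 0 < r p := Real.sqrt_pos.2 hp'
    have hr2 : r p ^ 2 = 1 - 16 * p.2 := Real.sq_sqrt hp'.le
    have hp2 : p.2 = (1 - r p ^ 2) / 16 := by linarith
    have hs : 3 + 8 * (Λ p).2 = 3 / r p := by simp only [hΛ]; ring
    simp only [hΦ]
    rw [hs]
    simp only [hΛ]
    ext
    · simp only; field_simp
    · simp only; field_simp; rw [hp2]; ring
  · have hp' := hpos (u t, v t) huv
    have hr0 : 0 < r (u t, v t) := Real.sqrt_pos.2 hp'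
    have hr2 : r (u t, v t) ^ 2 = 1 - 16 * v t := Real.sq_sqrt hp'.le
    have hv2 : v t = (1 - r (u t, v t) ^ 2) / 16 := by linarith
    have hrd : HasDerivAt (fun t => r (u t, v t)) (-(8 * u t) / r (u t, v t)) t := by
      refine (((hv.const_mul 16).const_sub 1).sqrt hp'.ne').congr_deriv ?_
      simp only [hr]
      field_simp
      ring
    refine (((hu.const_mul 3).div (hrd.pow 2) (pow_ne_zero 2 hr0.ne')).prodMk
      ((((hasDerivAt_const t (3 : ℝ)).div hrd hr0.ne').sub_const 3).div_const 8)).congr_deriv ?_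
    simp only [Q4, hΛ, Pi.pow_apply]
    set ρ := r (u t, v t)
    ext
    · simp only
      rw [hv2]
      field_simp
      ring
    · simp only
      field_simp
      ring

/-! ### Bounds for the number of positive roots -/

open Polynomial in
theorem card_pos_roots_le {p : ℝ[X]} (hp : derivative p ≠ 0) :
    (p.roots.toFinset.filter (0 < ·)).card ≤
      ((derivative p).roots.toFinset.filter (0 < ·)).card + 1 := by
  have hp0 : p ≠ 0 := fun h => hp (by rw [h, derivative_zero])
  refine Finset.card_le_of_interleaved fun x hx y hy hxy _ => ?_
  simp only [Finset.mem_filter, Multiset.mem_toFinset, mem_roots hp0, mem_roots hp,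
    IsRoot.def] at hx hy ⊢
  obtain ⟨z, hz1, hz2⟩ := exists_deriv_eq_zero hxy p.continuousOn (hx.1.trans hy.1.symm)
  rw [p.deriv] at hz2
  exact ⟨z, ⟨hz2, hx.2.trans hz1.1⟩, hz1⟩

open Polynomial in
/-- A polynomial whose coefficients from that of `X ^ n` on are nonnegative, the first of them being
positive, has at most `n` positive roots. -/
theorem encard_pos_roots_le {n : ℕ} {p : ℝ[X]} (hn : 0 < p.coeff n)
    (hp : ∀ j, n ≤ j → 0 ≤ p.coeff j) : {x : ℝ | 0 < x ∧ p.eval x = 0}.encard ≤ n := by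
  -- Differentiation shifts the sign condition down by one degree, and by Rolle's theorem it loses
  -- at most one positive root.
  have key : ∀ (n : ℕ) (p : ℝ[X]), 0 < p.coeff n → (∀ j, n ≤ j → 0 ≤ p.coeff j) →
      (p.roots.toFinset.filter (0 < ·)).card ≤ n := by
    intro n
    induction n with
    | zero =>
      intro p hn hp
      have hp0 : p ≠ 0 := fun h => by simp [h] at hn
      refine (Finset.card_eq_zero.2 (Finset.filter_eq_empty_iff.2 fun x hx h0 => ?_)).le
      rw [Multiset.mem_toFinset, mem_roots hp0, IsRoot.def, eval_eq_sum_range] at hx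
      refine hx.not_gt ?_
      refine Finset.sum_pos' (fun j _ => mul_nonneg (hp j (Nat.zero_le j)) (pow_nonneg h0.le j))
        ⟨0, by simp, by simpa using hn⟩
    | succ n ih =>
      intro p hn hp
      have hc : 0 < (derivative p).coeff n := by
        rw [coeff_derivative]; positivity
      refine (card_pos_roots_le fun h => by simp [h] at hc).trans (Nat.add_le_add_right
        (ih _ hc fun j hj => ?_) 1)
      rw [coeff_derivative]
      exact mul_nonneg (hp _ (by omega)) (by positivity)
  have hp0 : p ≠ 0 := fun h => by simp [h] at hn
  have hset : {x : ℝ | 0 < x ∧ p.eval x = 0} = (p.roots.toFinset.filter (0 < ·) : Finset ℝ) := by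
    ext x
    simp only [mem_ofPred_eq, Finset.coe_filter, Multiset.mem_toFinset, mem_roots hp0,
      IsRoot.def]
    tauto
  rw [hset, encard_coe_eq_coe_finsetCard]
  exact_mod_cast key n p hn hp

-- The injective substitution `s = x / (1 - c x)` sends the part of the positive axis where `1 - c x
-- > 0` to positive numbers. Roots outside this range are thus ignored, and the sign rule can apply
-- in `s` when it does not in `x`.
open Polynomial in
theorem encard_le_pos_roots {T : Set ℝ} {p : ℝ[X]} {c : ℝ}
    (h : ∀ x ∈ T, 0 < x ∧ 0 < 1 - c * x ∧ p.eval (x / (1 - c * x)) = 0) :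
    T.encard ≤ {s : ℝ | 0 < s ∧ p.eval s = 0}.encard := by
  refine encard_le_encard_of_injOn (f := fun x => x / (1 - c * x)) (fun x hx => ?_) ?_
  · obtain ⟨h1, h2, h3⟩ := h x hx
    exact ⟨div_pos h1 h2, h3⟩
  · intro x hx y hy hxy
    simp only at hxy
    rw [div_eq_div_iff (h x hx).2.1.ne' (h y hy).2.1.ne'] at hxy
    linarith

/-- Four zeros from five sign changes. -/
theorem exists_four_zeros {f : ℝ → ℝ} (hf : Continuous f) {x₁ x₂ x₃ x₄ x₅ : ℝ} (h12 : x₁ < x₂)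
    (h23 : x₂ < x₃) (h34 : x₃ < x₄) (h45 : x₄ < x₅) (h1 : 0 < f x₁) (h2 : f x₂ < 0)
    (h3 : 0 < f x₃) (h4 : f x₄ < 0) (h5 : 0 < f x₅) :
    ∃ S : Set ℝ, S.encard = 4 ∧ S ⊆ Ioo x₁ x₅ ∧ ∀ x ∈ S, f x = 0 := by
  obtain ⟨a, ha, ha0⟩ := intermediate_value_Ioo' h12.le hf.continuousOn ⟨h2, h1⟩
  obtain ⟨b, hb, hb0⟩ := intermediate_value_Ioo h23.le hf.continuousOn ⟨h2, h3⟩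
  obtain ⟨c, hc, hc0⟩ := intermediate_value_Ioo' h34.le hf.continuousOn ⟨h4, h3⟩
  obtain ⟨d, hd, hd0⟩ := intermediate_value_Ioo h45.le hf.continuousOn ⟨h4, h5⟩
  have hab := ha.2.trans hb.1
  have hbc := hb.2.trans hc.1
  have hcd := hc.2.trans hd.1
  refine ⟨{a, b, c, d}, ?_, ?_, ?_⟩
  · have e1 : c ∉ ({d} : Set ℝ) := by
      simp only [mem_singleton_iff]; exact hcd.ne
    have e2 : b ∉ ({c, d} : Set ℝ) := by
      simp only [mem_insert_iff, mem_singleton_iff, not_or]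
      exact ⟨hbc.ne, (hbc.trans hcd).ne⟩
    have e3 : a ∉ ({b, c, d} : Set ℝ) := by
      simp only [mem_insert_iff, mem_singleton_iff, not_or]
      exact ⟨hab.ne, (hab.trans hbc).ne, (hab.trans (hbc.trans hcd)).ne⟩
    rw [encard_insert_of_notMem e3, encard_insert_of_notMem e2, encard_insert_of_notMem e1,
      encard_singleton]
    norm_num
  · have l1 := ha.1
    have l2 := hd.2
    rintro x (rfl | rfl | rfl | rfl) <;> constructor <;> linarith
  · rintro x (rfl | rfl | rfl | rfl) <;> assumption

/-! ### Examples with exactly four limit cycles -/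

namespace RatIntegral

variable {Q : ℝ × ℝ → ℝ × ℝ} {m k : ℕ} (I : RatIntegral Q m k)

/-- The criterion `exists_four_limitCycles` with the abscissas given as zeros of a function. -/
theorem exists_four_limitCycles_of_zeros {O : ℝ × ℝ} {a b c d α β : ℝ} (hΔ : 0 < a * d - b * c)
    (hα : 0 < α) (hβ : 0 < β) (hly : ∀ y, 0 ≤ y → 0 < I.l (O.1 + b * y, O.2 + d * y))
    (hwx : ∀ x, 0 < x → 0 < I.l (O.1 + a * x, O.2 + c * x) →
      0 < a * (Q (O.1 + a * x, O.2 + c * x)).2 - c * (Q (O.1 + a * x, O.2 + c * x)).1)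
    (hwy : ∀ y, 0 < y →
      0 < b * (Q (O.1 + b * y, O.2 + d * y)).2 - d * (Q (O.1 + b * y, O.2 + d * y)).1)
    {R : ℝ → ℝ} (hR : Continuous R) {r : ℝ} (hr : r ≠ 0)
    (hfac : ∀ x, I.N (O.1 + a * x, O.2 + c * x) *
        I.D (O.1 + b * (α * x ^ 2 + β * x), O.2 + d * (α * x ^ 2 + β * x)) -
      I.N (O.1 + b * (α * x ^ 2 + β * x), O.2 + d * (α * x ^ 2 + β * x)) *
        I.D (O.1 + a * x, O.2 + c * x) = r * (x * R x))
    (hle : {x | 0 < x ∧ 0 < I.l (O.1 + a * x, O.2 + c * x) ∧ R x = 0}.encard ≤ 4)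
    (x₁ x₂ x₃ x₄ x₅ : ℝ) (h01 : 0 < x₁) (h12 : x₁ < x₂) (h23 : x₂ < x₃) (h34 : x₃ < x₄)
    (h45 : x₄ < x₅) (h1 : 0 < R x₁) (h2 : R x₂ < 0) (h3 : 0 < R x₃) (h4 : R x₄ < 0) (h5 : 0 < R x₅)
    (hlx : ∀ x, x < x₅ → 0 < I.l (O.1 + a * x, O.2 + c * x))
    (hconn : ∀ x, 0 < x → x < x₅ → I.N (O.1 + a * x, O.2 + c * x) *
        I.D (O.1 + b * (α * x ^ 2 + β * x), O.2 + d * (α * x ^ 2 + β * x)) =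
      I.N (O.1 + b * (α * x ^ 2 + β * x), O.2 + d * (α * x ^ 2 + β * x)) *
        I.D (O.1 + a * x, O.2 + c * x) → Connects Q
      (O.1 + b * (α * x ^ 2 + β * x), O.2 + d * (α * x ^ 2 + β * x))
      (O.1 + a * x, O.2 + c * x)) :
    ∃ F G : ℝ × ℝ → ℝ × ℝ, IsLinearHamiltonianSaddle F ∧ IsAffineCopy Q G ∧
      (cornerLimitCycles F G).encard = 4 ∧ limitCycles F G = cornerLimitCycles F G := by
  -- The five signs give four zeros and `hle` shows that there are no others. The factor `x` split
  -- off in `hfac` is the root at the corner.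
  obtain ⟨S, hS4, hSI, hS0⟩ := exists_four_zeros hR h12 h23 h34 h45 h1 h2 h3 h4 h5
  have hsub : S ⊆ {x | 0 < x ∧ 0 < I.l (O.1 + a * x, O.2 + c * x) ∧ R x = 0} := fun x hx =>
    ⟨h01.trans (hSI hx).1, hlx x (hSI hx).2, hS0 x hx⟩
  have hfin : S.Finite := finite_of_encard_eq_coe (k := 4) (by exact_mod_cast hS4)
  have heq := hfin.eq_of_subset_of_encard_le hsub (hle.trans hS4.ge)
  have hiff : ∀ x, 0 < x → (I.N (O.1 + a * x, O.2 + c * x) *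
        I.D (O.1 + b * (α * x ^ 2 + β * x), O.2 + d * (α * x ^ 2 + β * x)) =
      I.N (O.1 + b * (α * x ^ 2 + β * x), O.2 + d * (α * x ^ 2 + β * x)) *
        I.D (O.1 + a * x, O.2 + c * x) ↔ R x = 0) := fun x hx => by
    rw [← sub_eq_zero, hfac, mul_eq_zero, mul_eq_zero]
    simp [hr, hx.ne']
  refine I.exists_four_limitCycles hΔ hα hβ hly hwx hwy hS4 (fun x => ?_) fun x hx => ?_
  · constructor
    · intro hx
      obtain ⟨e1, e2, e3⟩ := hsub hx
      exact ⟨e1, e2, (hiff x e1).2 e3⟩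
    · rintro ⟨e1, e2, e3⟩
      rw [heq]
      exact ⟨e1, e2, (hiff x e1).1 e3⟩
  · have e1 := (hsub hx).1
    exact hconn x e1 (hSI hx).2 ((hiff x e1).2 (hS0 x hx))

end RatIntegral

-- The half-axes go to `(1 / 6, -x)` and `(1 / 6 + y, 0)`. The conic is a parabola, so the level
-- equation has degree five in `x`; without the root at the corner a quartic is left, and all its
-- roots are realized.
open Polynomial in
theorem exists_four_limitCycles_Q1 : ∃ F G : ℝ × ℝ → ℝ × ℝ,
    IsLinearHamiltonianSaddle F ∧ IsAffineCopy Q1 G ∧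
      (cornerLimitCycles F G).encard = 4 ∧ limitCycles F G = cornerLimitCycles F G := by
  set p : ℝ[X] := C 2695 - C 161532 * X + C 3247524 * X ^ 2 - C 25375680 * X ^ 3 +
    C 62726400 * X ^ 4 with hp
  refine integralQ1.exists_four_limitCycles_of_zeros (O := (1 / 6, 0)) (a := 0) (b := 1) (c := -1)
    (d := 0) (α := 24 / 7) (β := 9 / 55) (by norm_num) (by norm_num) (by norm_num)
    (fun y hy => ?_) (fun x hx hl => ?_) (fun y hy => ?_) (R := fun x => p.eval x) p.continuous
    (r := 1 / 2668050) (by norm_num) (fun x => ?_) ?_ (1 / 28) (1 / 20) (1 / 12) (1 / 6) (1 / 4)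
    (by norm_num) (by norm_num) (by norm_num) (by norm_num) (by norm_num)
    (by norm_num [hp]) (by norm_num [hp]) (by norm_num [hp]) (by norm_num [hp]) (by norm_num [hp])
    (fun x hx => ?_) fun x hx0 hx hN => ?_
  · simp [RatIntegral.l, integralQ1]
  · simp only [RatIntegral.l, integralQ1, Q1] at hl ⊢
    nlinarith
  · simp only [Q1]; linarith
  · simp [RatIntegral.D, RatIntegral.l, integralQ1, hp]
    ring
  · refine (encard_le_encard (t := {x | 0 < x ∧ p.eval x = 0})
      fun x hx => ⟨hx.1, hx.2.2⟩).trans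
      (encard_pos_roots_le (n := 4) (p := p) (by simp [hp]) fun j hj => ?_)
    simp only [hp, coeff_add, coeff_sub, coeff_C_mul, coeff_X_pow, coeff_C, coeff_X,
      show j ≠ 0 by omega, show 1 ≠ j by omega, show j ≠ 2 by omega, show j ≠ 3 by omega,
      if_false]
    split_ifs <;> norm_num
  · simp only [RatIntegral.l, integralQ1]; linarith
  · simp only [RatIntegral.D, RatIntegral.l, integralQ1, pow_one] at hN
    refine connects_Q1 ?_ ?_ hN.symm fun h => ?_
    · norm_num
    · simp only; linarith
    · have := congrArg Prod.fst h
      simp only at this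
      nlinarith

-- The level equation leaves a quintic whose coefficients change sign five times. Multiplied out in
-- `s = x / (1 - x)`, where `1 - x` is `l` on the `x`-axis, it becomes `p`, with positive
-- coefficients from degree four on.
open Polynomial in
theorem exists_four_limitCycles_Q2 : ∃ F G : ℝ × ℝ → ℝ × ℝ,
    IsLinearHamiltonianSaddle F ∧ IsAffineCopy Q2 G ∧
      (cornerLimitCycles F G).encard = 4 ∧ limitCycles F G = cornerLimitCycles F G := by
  set p : ℝ[X] := C 112 - C 5041 * X + C 70376 * X ^ 2 - C 321616 * X ^ 3 + C 332416 * X ^ 4 +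
    C 81536 * X ^ 5 with hp
  refine integralQ2.exists_four_limitCycles_of_zeros (O := (1 / 5, 0)) (a := 0) (b := 1) (c := -1)
    (d := 0) (α := 23 / 8) (β := 11 / 56) (by norm_num) (by norm_num) (by norm_num)
    (fun y hy => ?_) (fun x hx hl => ?_) (fun y hy => ?_)
    (R := fun x => 112 - 5601 * x + 91660 * x ^ 2 - 564110 * x ^ 3 + 1207500 * x ^ 4 -
      648025 * x ^ 5) (by fun_prop)
    (r := 1 / 78400) (by norm_num) (fun x => ?_) ?_ (1 / 24) (1 / 18) (1 / 9) (1 / 4) (2 / 5)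
    (by norm_num) (by norm_num) (by norm_num) (by norm_num) (by norm_num)
    (by norm_num) (by norm_num) (by norm_num) (by norm_num) (by norm_num)
    (fun x hx => ?_) fun x hx0 hx hN => ?_
  · simp [RatIntegral.l, integralQ2]
  · simp only [Q2]; nlinarith
  · simp only [Q2]; linarith
  · simp only [RatIntegral.D, RatIntegral.l, integralQ2]
    ring
  · refine (encard_le_pos_roots (p := p) (c := 1) fun x hx => ?_).trans
      (encard_pos_roots_le (n := 4) (p := p) (by simp [hp]) fun j hj => ?_)
    · obtain ⟨h1, h2, h3⟩ := hx
      simp only [RatIntegral.l, integralQ2] at h2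
      have h4 : 0 < 1 - 1 * x := by linarith
      have h5 := h4.ne'
      refine ⟨h1, h4, (mul_eq_zero.1 (?_ : (1 - 1 * x) ^ 5 * _ = 0)).resolve_left
        (pow_ne_zero _ h5)⟩
      simp only [hp, eval_add, eval_sub, eval_mul, eval_pow, eval_C, eval_X]
      obtain ⟨w, hw⟩ : ∃ w, w = 1 - 1 * x := ⟨_, rfl⟩
      rw [← hw] at h5 ⊢
      field_simp
      rw [hw]
      linear_combination 1 * h3
    · simp only [hp, coeff_add, coeff_sub, coeff_C_mul, coeff_X_pow, coeff_C, coeff_X,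
        show j ≠ 0 by omega, show 1 ≠ j by omega, show j ≠ 2 by omega, show j ≠ 3 by omega,
        if_false]
      split_ifs <;> norm_num
  · simp only [RatIntegral.l, integralQ2]; linarith
  · simp only [RatIntegral.D, RatIntegral.l, integralQ2] at hN
    refine connects_Q2 ?_ ?_ (by simp only; linear_combination -hN) ?_ fun h => ?_
    · norm_num
    · simp only; linarith
    · simp only; nlinarith
    · have := congrArg Prod.fst h
      simp only at this
      nlinarith

-- With this base point and these directions the quintic already has positive coefficients in
-- degrees four and five, so no substitution is needed.
open Polynomial in
theorem exists_four_limitCycles_Q3 : ∃ F G : ℝ × ℝ → ℝ × ℝ,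
    IsLinearHamiltonianSaddle F ∧ IsAffineCopy Q3 G ∧
      (cornerLimitCycles F G).encard = 4 ∧ limitCycles F G = cornerLimitCycles F G := by
  set p : ℝ[X] := C 9071 - C 3985164 * X + C 344642112 * X ^ 2 - C 9036823104 * X ^ 3 +
    C 56434724352 * X ^ 4 + C 549669888 * X ^ 5 with hp
  refine integralQ3.exists_four_limitCycles_of_zeros (O := (-1 / 12, -1 / 16)) (a := -1 / 2)
    (b := 0) (c := 1) (d := -1) (α := 12) (β := 2 / 47) (by norm_num) (by norm_num) (by norm_num)
    (fun y hy => ?_) (fun x hx hl => ?_) (fun y hy => ?_) (R := fun x => p.eval x) p.continuous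
    (r := 1 / 2862864) (by norm_num) (fun x => ?_) ?_ (1 / 341) (1 / 80) (1 / 38) (1 / 12) (1 / 7)
    (by norm_num) (by norm_num) (by norm_num) (by norm_num) (by norm_num)
    (by norm_num [hp]) (by norm_num [hp]) (by norm_num [hp]) (by norm_num [hp]) (by norm_num [hp])
    (fun x hx => ?_) fun x hx0 hx hN => ?_
  · simp only [RatIntegral.l, integralQ3]; linarith
  · simp only [RatIntegral.l, integralQ3, Q3] at hl ⊢
    nlinarith
  · simp only [Q3]; linarith
  · simp [RatIntegral.D, RatIntegral.l, integralQ3, hp]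
    ring
  · refine (encard_le_encard (t := {x | 0 < x ∧ p.eval x = 0})
      fun x hx => ⟨hx.1, hx.2.2⟩).trans
      (encard_pos_roots_le (n := 4) (p := p) (by simp [hp]) fun j hj => ?_)
    simp only [hp, coeff_add, coeff_sub, coeff_C_mul, coeff_X_pow, coeff_C, coeff_X,
      show j ≠ 0 by omega, show 1 ≠ j by omega, show j ≠ 2 by omega, show j ≠ 3 by omega,
      if_false]
    split_ifs <;> norm_num
  · simp only [RatIntegral.l, integralQ3]; linarith
  · simp only [RatIntegral.D, RatIntegral.l, integralQ3, pow_one] at hN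
    refine connects_Q3 ?_ ?_ (by simp only; linear_combination -hN) fun h => ?_
    · simp only; nlinarith
    · simp only; linarith
    · have := congrArg Prod.fst h
      simp only at this
      linarith

-- As for `Q2`, with `s = x / (1 - 8 x / 3)`, where `1 - 8 x / 3` is a third of `l` on the `x`-axis:
-- the degree seven polynomial alternates in `x`, but `p` has positive coefficients from degree four
-- on. Clearing denominators in `p(s)` gives 81 times the polynomial in `x`.
open Polynomial in
theorem exists_four_limitCycles_Q4 : ∃ F G : ℝ × ℝ → ℝ × ℝ,
    IsLinearHamiltonianSaddle F ∧ IsAffineCopy Q4 G ∧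
      (cornerLimitCycles F G).encard = 4 ∧ limitCycles F G = cornerLimitCycles F G := by
  set p : ℝ[X] := C 96228 - C 34706961 * X + C 2864479140 * X ^ 2 - C 54197820900 * X ^ 3 +
    C 238594498560 * X ^ 4 + C 370153783296 * X ^ 5 + C 301842038784 * X ^ 6 +
    C 100614012928 * X ^ 7 with hp
  refine integralQ4.exists_four_limitCycles_of_zeros (O := (1 / 18, 0)) (a := 0) (b := 1)
    (c := -1) (d := 0) (α := 21 / 2) (β := 13 / 44) (by norm_num) (by norm_num) (by norm_num)
    (fun y hy => ?_) (fun x hx hl => ?_) (fun y hy => ?_)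
    (R := fun x => 1188 - 450657 * x + 42397044 * x ^ 2 - 1187121220 * x ^ 3 +
      12762149760 * x ^ 4 - 54578161152 * x ^ 5 + 102238101504 * x ^ 6 - 70815596544 * x ^ 7)
    (by fun_prop)
    (r := 1 / 17424) (by norm_num) (fun x => ?_) ?_ (1 / 255) (1 / 106) (1 / 24) (1 / 14) (1 / 11)
    (by norm_num) (by norm_num) (by norm_num) (by norm_num) (by norm_num)
    (by norm_num) (by norm_num) (by norm_num) (by norm_num) (by norm_num)
    (fun x hx => ?_) fun x hx0 hx hN => ?_
  · simp [RatIntegral.l, integralQ4]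
  · simp only [RatIntegral.l, integralQ4, Q4] at hl ⊢
    nlinarith
  · simp only [Q4]; linarith
  · simp only [RatIntegral.D, RatIntegral.l, integralQ4]
    ring
  · refine (encard_le_pos_roots (p := p) (c := 8 / 3) fun x hx => ?_).trans
      (encard_pos_roots_le (n := 4) (p := p) (by simp [hp]) fun j hj => ?_)
    · obtain ⟨h1, h2, h3⟩ := hx
      simp only [RatIntegral.l, integralQ4] at h2
      have h4 : 0 < 1 - 8 / 3 * x := by linarith
      have h5 := h4.ne'
      refine ⟨h1, h4, (mul_eq_zero.1 (?_ : (1 - 8 / 3 * x) ^ 7 * _ = 0)).resolve_left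
        (pow_ne_zero _ h5)⟩
      simp only [hp, eval_add, eval_sub, eval_mul, eval_pow, eval_C, eval_X]
      obtain ⟨w, hw⟩ : ∃ w, w = 1 - 8 / 3 * x := ⟨_, rfl⟩
      rw [← hw] at h5 ⊢
      field_simp
      rw [hw]
      linear_combination 81 * h3
    · simp only [hp, coeff_add, coeff_sub, coeff_C_mul, coeff_X_pow, coeff_C, coeff_X,
        show j ≠ 0 by omega, show 1 ≠ j by omega, show j ≠ 2 by omega, show j ≠ 3 by omega,
        if_false]
      split_ifs <;> norm_num
  · simp only [RatIntegral.l, integralQ4]; linarith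
  · simp only [RatIntegral.D, RatIntegral.l, integralQ4] at hN
    refine connects_Q4 ?_ ?_ (by simp only; linear_combination -hN) ?_ fun h => ?_
    · norm_num
    · simp only; linarith
    · simp only; nlinarith
    · have := congrArg Prod.fst h
      simp only at this
      nlinarith

end CornerPWS

theorem theorem1 :
    ((∀ F G : ℝ × ℝ → ℝ × ℝ, IsLinearHamiltonianSaddle F → IsAffineCopy Q1 G →
        (cornerLimitCycles F G).encard ≤ 5) ∧
      ∃ F G : ℝ × ℝ → ℝ × ℝ, IsLinearHamiltonianSaddle F ∧ IsAffineCopy Q1 G ∧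
        (cornerLimitCycles F G).encard = 4 ∧ limitCycles F G = cornerLimitCycles F G) ∧
    ((∀ F G : ℝ × ℝ → ℝ × ℝ, IsLinearHamiltonianSaddle F → IsAffineCopy Q2 G →
        (cornerLimitCycles F G).encard ≤ 7) ∧
      ∃ F G : ℝ × ℝ → ℝ × ℝ, IsLinearHamiltonianSaddle F ∧ IsAffineCopy Q2 G ∧
        (cornerLimitCycles F G).encard = 4 ∧ limitCycles F G = cornerLimitCycles F G) ∧
    ((∀ F G : ℝ × ℝ → ℝ × ℝ, IsLinearHamiltonianSaddle F → IsAffineCopy Q3 G →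
        (cornerLimitCycles F G).encard ≤ 9) ∧
      ∃ F G : ℝ × ℝ → ℝ × ℝ, IsLinearHamiltonianSaddle F ∧ IsAffineCopy Q3 G ∧
        (cornerLimitCycles F G).encard = 4 ∧ limitCycles F G = cornerLimitCycles F G) ∧
    ((∀ F G : ℝ × ℝ → ℝ × ℝ, IsLinearHamiltonianSaddle F → IsAffineCopy Q4 G →
        (cornerLimitCycles F G).encard ≤ 11) ∧
      ∃ F G : ℝ × ℝ → ℝ × ℝ, IsLinearHamiltonianSaddle F ∧ IsAffineCopy Q4 G ∧
        (cornerLimitCycles F G).encard = 4 ∧ limitCycles F G = cornerLimitCycles F G) := by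
  -- The bounds count the root at the corner too: `encard + 1` is at most `2 (m + k)`, that is 6, 8,
  -- 10 and 12.
  have key : ∀ {c : ℕ∞} {n : ℕ}, c + 1 ≤ ((n + 1 : ℕ) : ℕ∞) → c ≤ n := fun h => by
    push_cast at h
    exact (ENat.add_le_add_iff_right ENat.one_ne_top).1 h
  exact ⟨⟨fun F G hF hG => key (signedQ1.encard_cornerLimitCycles_le hF hG),
      exists_four_limitCycles_Q1⟩,
    ⟨fun F G hF hG => key (signedQ2.encard_cornerLimitCycles_le hF hG),
      exists_four_limitCycles_Q2⟩,
    ⟨fun F G hF hG => key (signedQ3.encard_cornerLimitCycles_le hF hG),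
      exists_four_limitCycles_Q3⟩,
    ⟨fun F G hF hG => key (signedQ4.encard_cornerLimitCycles_le hF hG),
      exists_four_limitCycles_Q4⟩⟩
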